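/- Let $\mathbb D$ be the open unit disc with the hyperbolic metric $ds=2|dz|/(1-|z|^2)$ and distance $d$, and let $\mathbb S^1$ be its circle at infinity. Let $G$ be a finitely generated Fuchsian group of the first kind acting on $\mathbb D$ by orientation preserving isometries. Let $R\subset\mathbb D$ be a convex, locally finite fundamental domain for $G$, taken closed in $\mathbb D$, which contains $0$ in its interior. Let $G_R$ be the set of side-pairings of $R$, i.e. of those $e\in G\setminus\{1\}$ for which $R\cap eR$ is a geodesic segment of positive length; this segment is called the side of $R$ with exterior label $e$, and for $g\in G$ the side $gR\cap geR$ of $gR$ has exterior label $e$. Write $N=G\,\partial R$. Assume that $R$ is admissible: $N$ is a union of complete geodesics, $R$ has at least four sides, and if $R$ has precisely four sides and all its vertices lie in $\mathbb D$, then at least three geodesics in $N$ meet at each vertex of $R$. Let $\mathscr R$ be the set of oriented complete geodesics that intersect the interior of $R$, and write $\gamma^+\in\mathbb S^1$ for the positive endpoint of $\gamma\in\mathscr R$. If $\gamma$ passes through a vertex of $N$ in $\mathbb D$ (a $G$-image of a vertex of $R$), it is understood to be deformed to the right around that vertex. A sequence $(g_n)_{n\ge0}$ in $G_R$ is the (infinite)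 cutting sequence of $\gamma$ if $\gamma$ crosses successively $R,\ g_0R,\ g_0g_1R,\dots$, leaving $g_0\cdots g_{n-1}R$ (which is $R$ for $n=0$) through its side with exterior label $g_n$. Put $t_n(\gamma)=d(0,g_0\cdots g_{n-1}0)$. Let $e_1,\dots,e_m$ be the exterior labels of the sides of $R$ in anticlockwise order. For each $i$, the complete geodesic containing the side with exterior label $e_i$ cuts off from $0$ an arc of $\mathbb S^1$; let $P_i$ be the first endpoint of this arc in anticlockwise order, with indices modulo $m$. The Bowen–Series map $f:\mathbb S^1\to\mathbb S^1$ is given by $f(x)=e_i^{-1}x$ for $x\in[P_i,P_{i+1})$ (anticlockwise arcs). Derivatives of iterates of $f$ at points where two branches meet are the one-sided derivatives from the anticlockwise side. **Proposition 2.1.** Suppose that $G$ has no parabolic element. Then there is a constant $C_0>0$ such that for every $\gamma\in\mathscr R$ with infinite cutting sequence $(g_n)_{n\ge0}$ and every $n\ge0$, $$\bigl|t_n(\gamma)-\log|((g_0\cdots g_{n-1})^{-1})'(\gamma^+)|\bigr|\le C_0\quad\text{and}\quad \bigl|t_n(\gamma)-\log|(f^n)'(\gamma^+)|\bigr|\le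 C_0 .$$ -/

import Mathlib

open Set Filter Topology

noncomputable section

namespace HypDisc

/-- The closed unit disc `𝔻 ∪ 𝕊¹`, with the topology induced from `ℂ`. -/
abbrev CDisc : Type := Metric.closedBall (0 : ℂ) 1

/-- The open disc `𝔻`, as a subset of the closed disc. -/
def openDisc : Set CDisc := {z | ‖(z : ℂ)‖ < 1}

/-- The circle at infinity `𝕊¹`, as a subset of the closed disc. -/
def unitCircle : Set CDisc := {z | ‖(z : ℂ)‖ = 1}

/-- The origin. -/
def origin : CDisc := ⟨0, by simp⟩

/-- The point `x e^{iθ}`. -/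
def rot (θ : ℝ) (x : CDisc) : CDisc :=
  ⟨(x : ℂ) * Complex.exp (θ * Complex.I), by
    have hx := x.2
    simp only [Metric.mem_closedBall, dist_zero_right] at hx ⊢
    rw [norm_mul, Complex.norm_exp_ofReal_mul_I, mul_one]
    exact hx⟩

/-- The hyperbolic distance (curvature `-1`, i.e. `ds = 2|dz| / (1 - |z|²)`) between two points of
`𝔻`, by `sinh (d / 2) = |z - w| / √((1 - |z|²)(1 - |w|²))`. Only used for points of `𝔻`. -/
def hdist (z w : CDisc) : ℝ :=
  2 * Real.arsinh (‖(z : ℂ) - w‖ / √((1 - ‖(z : ℂ)‖ ^ 2) * (1 - ‖(w : ℂ)‖ ^ 2)))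

/-- A set is hyperbolically convex if it contains the geodesic segment between any two of its
points; the segment from `x` to `y` is the set of `z ∈ 𝔻` with `d(x,z) + d(z,y) = d(x,y)`. -/
def HypConvex (A : Set CDisc) : Prop :=
  ∀ x ∈ A, ∀ y ∈ A, ∀ z ∈ openDisc, hdist x z + hdist z y = hdist x y → z ∈ A

/-- An oriented complete geodesic of `𝔻`, parametrized by arc length. -/
def IsGeodesic (γ : ℝ → CDisc) : Prop :=
  (∀ t, γ t ∈ openDisc) ∧ ∀ s t, hdist (γ s) (γ t) = |s - t|

/-- The complete geodesics of `𝔻` as point sets. -/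
def IsGeodesicLine (L : Set CDisc) : Prop := ∃ γ, IsGeodesic γ ∧ range γ = L

/-- The orientation preserving isometry `w ↦ (w - p) / (1 - p̄ w)` of `𝔻`, which moves `p` to `0`. -/
def centre (p w : CDisc) : ℂ := ((w : ℂ) - p) / (1 - star (p : ℂ) * w)

/-- The open half plane to the right of the oriented geodesic `γ`: after moving `γ 0` to the
origin, `γ` is the diameter pointing in the direction of `γ 1`. -/
def rightSide (γ : ℝ → CDisc) : Set CDisc :=
  {z | z ∈ openDisc ∧ (star (centre (γ 0) (γ 1)) * centre (γ 0) z).im < 0}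

/-! ### Fuchsian groups -/

/-- `g` is an orientation preserving isometry of `𝔻` (extended to the closed disc), i.e. a Möbius
transformation `z ↦ (a z + b) / (b̄ z + ā)` with `|a|² - |b|² = 1`. -/
def IsDiscMoebius (g : Equiv.Perm CDisc) : Prop :=
  ∃ a b : ℂ, ‖a‖ ^ 2 - ‖b‖ ^ 2 = 1 ∧
    ∀ z : CDisc, ((g z : CDisc) : ℂ) = (a * z + b) / (star b * z + star a)

/-- A Fuchsian group acting on `𝔻`: a discrete group of orientation preserving isometries
(the identity is isolated for uniform convergence on the closed disc). -/
def IsFuchsian (G : Subgroup (Equiv.Perm CDisc)) : Prop :=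
  (∀ g ∈ G, IsDiscMoebius g) ∧ ∃ ε > 0, ∀ g ∈ G, (∀ z, dist (g z) z < ε) → g = 1

/-- The limit set: the points of `𝕊¹` that are limits of points of the orbit `G 0`. -/
def limitSet (G : Subgroup (Equiv.Perm CDisc)) : Set CDisc :=
  unitCircle ∩ closure {z | ∃ g ∈ G, z = g origin}

/-- The group is of the first kind: its limit set is the whole circle. -/
def IsFirstKind (G : Subgroup (Equiv.Perm CDisc)) : Prop := limitSet G = unitCircle

/-- A parabolic isometry: its only fixed point in the closed disc lies on the circle. -/
def IsParabolic (g : Equiv.Perm CDisc) : Prop :=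
  ∃ ξ ∈ unitCircle, ∀ z, g z = z ↔ z = ξ

/-- The complex derivative of `g` at a point of the closed disc (one differentiates within the
closed disc, on which `g` is defined). -/
def moebiusDeriv (g : Equiv.Perm CDisc) (ξ : CDisc) : ℂ :=
  derivWithin (Function.extend Subtype.val (fun z => ((g z : CDisc) : ℂ)) 0)
    (Metric.closedBall (0 : ℂ) 1) ξ

/-! ### Fundamental domains -/

/-- `R` is a (closed) convex, locally finite fundamental domain for `G` with `0` in its interior. -/
structure IsFundamentalDomain (G : Subgroup (Equiv.Perm CDisc)) (R : Set CDisc) : Prop where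
  subset_disc : R ⊆ openDisc
  isClosed : closure R ∩ openDisc ⊆ R
  convex : HypConvex R
  origin_mem : origin ∈ interior R
  covers : ∀ z ∈ openDisc, ∃ g ∈ G, z ∈ g '' R
  disjoint : ∀ g ∈ G, g ≠ 1 → Disjoint (interior R) (g '' interior R)
  locallyFinite : ∀ K : Set CDisc, IsCompact K → K ⊆ openDisc →
    {g | g ∈ G ∧ (g '' R ∩ K).Nonempty}.Finite

/-- The side of `R` along which `e R` is adjacent to `R`; its exterior label is `e`. -/
def side (R : Set CDisc) (e : Equiv.Perm CDisc) : Set CDisc := R ∩ e '' R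

/-- The set `G_R` of side-pairings, i.e. of the exterior labels of the sides of `R`. By convexity
`R ∩ e R` is a geodesic segment; it is a side if it does not reduce to a point. There is exactly
one label for each side, so the number of sides is the number of elements of `G_R`. -/
def sidePairings (G : Subgroup (Equiv.Perm CDisc)) (R : Set CDisc) : Set (Equiv.Perm CDisc) :=
  {e | e ∈ G ∧ e ≠ 1 ∧ (side R e).Nontrivial}

/-- The vertices of `R` in `𝔻 ∪ 𝕊¹`: the common endpoints of two different sides. -/
def vertices (G : Subgroup (Equiv.Perm CDisc)) (R : Set CDisc) : Set CDisc :=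
  {v | ∃ e ∈ sidePairings G R, ∃ e' ∈ sidePairings G R, e ≠ e' ∧
    v ∈ closure (side R e) ∩ closure (side R e')}

/-- `N = G ∂R`. -/
def net (G : Subgroup (Equiv.Perm CDisc)) (R : Set CDisc) : Set CDisc :=
  {z | ∃ g ∈ G, z ∈ g '' (R \ interior R)}

/-- `R` has even corners: `N` is a union of complete geodesics. -/
def HasEvenCorners (G : Subgroup (Equiv.Perm CDisc)) (R : Set CDisc) : Prop :=
  ∀ z ∈ net G R, ∃ L, IsGeodesicLine L ∧ z ∈ L ∧ L ⊆ net G R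

/-- `R` is admissible: it has even corners and at least four sides, and if it has precisely four
sides and all its vertices lie in `𝔻`, then at least three geodesics in `N` meet at each vertex. -/
structure IsAdmissible (G : Subgroup (Equiv.Perm CDisc)) (R : Set CDisc) : Prop where
  evenCorners : HasEvenCorners G R
  four_le : 4 ≤ (sidePairings G R).encard
  three_lines : (sidePairings G R).encard = 4 → vertices G R ⊆ openDisc →
    ∀ v ∈ vertices G R,
      3 ≤ {L : Set CDisc | IsGeodesicLine L ∧ L ⊆ net G R ∧ v ∈ L}.encard

/-! ### Cutting sequences -/

/-- The set of oriented complete geodesics that meet the interior of `R`. -/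
def geodesicsThrough (R : Set CDisc) : Set (ℝ → CDisc) :=
  {γ | IsGeodesic γ ∧ ∃ t, γ t ∈ interior R}

/-- The product `g₀ g₁ ⋯ g_{n-1}`. -/
def prefixProd (g : ℕ → Equiv.Perm CDisc) : ℕ → Equiv.Perm CDisc
  | 0 => 1
  | n + 1 => prefixProd g n * g n

/-- `(g_n)` is the infinite cutting sequence of `γ`, where `γ` is deformed to the right around each
vertex of `N` through which it passes.
Writing `T_n = g₀ ⋯ g_{n-1} R`, the (deformed) geodesic starts in `R = T_0` and crosses, at the
non-decreasing times `t 0, t 1, …`, the side common to `T_n` and `T_{n+1}`, whose exterior label is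
`g_n`. Between two crossings at different times `γ` runs inside the tile in between. Two consecutive
crossings take place at the same time if `γ` passes through a vertex; the tile in between is then
one that only the deformed geodesic visits, so it lies to the right of `γ`.
The crossing `n + 1` never undoes the crossing `n`. -/
structure IsCuttingSequence (G : Subgroup (Equiv.Perm CDisc)) (R : Set CDisc)
    (γ : ℝ → CDisc) (g : ℕ → Equiv.Perm CDisc) : Prop where
  mem_sidePairings : ∀ n, g n ∈ sidePairings G R
  no_backtrack : ∀ n, g (n + 1) ≠ (g n)⁻¹
  crossings : ∃ t : ℕ → ℝ,
    (∃ s < t 0, ∀ u ∈ Ioo s (t 0), γ u ∈ interior R) ∧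
    (∀ n, γ (t n) ∈ prefixProd g n '' R ∩ prefixProd g (n + 1) '' R) ∧
    ∀ n, (t n < t (n + 1) ∧
          ∀ u ∈ Ioo (t n) (t (n + 1)), γ u ∈ interior (prefixProd g (n + 1) '' R)) ∨
        (t n = t (n + 1) ∧ interior (prefixProd g (n + 1) '' R) ⊆ rightSide γ)

/-- `t_n(γ) = d(0, g₀ ⋯ g_{n-1} 0)`, in terms of the cutting sequence of `γ`. -/
def growth (g : ℕ → Equiv.Perm CDisc) (n : ℕ) : ℝ := hdist origin (prefixProd g n origin)

/-! ### The Bowen–Series map -/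

/-- `P` is the first endpoint `P_i`, in anticlockwise order, of the complete geodesic that contains
the side of `R` with exterior label `e = e_i`: the arc that this geodesic cuts off from `0` runs
anticlockwise from `P` to the second endpoint `Q`, and is shorter than a half circle. -/
def IsFirstEndpoint (R : Set CDisc) (e : Equiv.Perm CDisc) (P : CDisc) : Prop :=
  ∃ (γ : ℝ → CDisc) (Q : CDisc), IsGeodesic γ ∧ side R e ⊆ range γ ∧
    Tendsto γ atBot (𝓝 P) ∧ Tendsto γ atTop (𝓝 Q) ∧ 0 < (star (P : ℂ) * (Q : ℂ)).im

/-- `x` lies in the arc `[P_i, P_{i+1})`, where `e = e_i`: moving anticlockwise from `P_i` to `x`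
one meets no other of the points `P_j`. -/
def InArc (G : Subgroup (Equiv.Perm CDisc)) (R : Set CDisc) (e : Equiv.Perm CDisc) (x : CDisc) :
    Prop :=
  e ∈ sidePairings G R ∧ ∃ (P : CDisc) (θ : ℝ), IsFirstEndpoint R e P ∧ 0 ≤ θ ∧
    θ < 2 * Real.pi ∧ x = rot θ P ∧
    ∀ e' ∈ sidePairings G R, ∀ φ : ℝ, 0 < φ → φ ≤ θ → ¬ IsFirstEndpoint R e' (rot φ P)

open Classical in
/-- The Bowen–Series map `f`: `f x = e_i⁻¹ x` for `x ∈ [P_i, P_{i+1})`. Only its values on `𝕊¹`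
matter. -/
def bowenSeries (G : Subgroup (Equiv.Perm CDisc)) (R : Set CDisc) (x : CDisc) : CDisc :=
  if h : ∃ e, InArc G R e x then (h.choose)⁻¹ x else x

/-- `|F'(ξ)|` for a self-map `F` of the circle and `ξ ∈ 𝕊¹`, as a derivative with respect to arc
length from the anticlockwise side. At a point where `F` is differentiable it is the absolute value
of the derivative; for iterates of `f` it is the appropriate one-sided derivative at the points
where branches of the iterate meet, since the branches are defined on arcs `[P, P')`. -/
def circleAbsDeriv (F : CDisc → CDisc) (ξ : CDisc) : ℝ :=
  ‖derivWithin (fun θ : ℝ => ((F (rot θ ξ) : CDisc) : ℂ)) (Ici 0) 0‖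

end HypDisc

end

/-! Call the complete geodesics contained in `N` walls, and let `sep G R g h` be the set of walls
between the tiles `g R` and `h R`. As `N` is a union of complete geodesics, a wall never enters the
interior of a tile, distinct tiles are separated by a finite nonempty set of walls, and crossing a
side changes this set by exactly one wall. So the number of walls between `R` and `g R` serves as a
word length.

Let `ξ` be the positive endpoint of `γ`. Say that `g` is `Toward` `ξ` if every wall between `R` and
`g R` has `g R` and the circle just after `ξ` on the same side. Germs after `ξ` replace the point
`ξ` because `ξ` may be the endpoint of a wall and because the branches of `f` live on arcs closed at
their first endpoint. The prefix `g₀ ⋯ g_{n-1}` is `Toward` `ξ` and lies behind exactly `n` walls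
(`toward_prefixProd`). Near `ξ`, on the anticlockwise side, `f^n` is the inverse of an element `h`
with the same two properties (`exists_iterate_bowenSeries`).

Without parabolic elements no point at infinity belongs to the closure of `R`: each is strictly cut
off by a side (`exists_sideWall_neg`), and by compactness with a uniform margin `δ`. Hence `|g⁻¹ 0 -
g⁻¹ ξ| ≥ δ` for every `g` that is `Toward` `ξ` (`exists_le_norm_of_toward`), and then `log
|(g⁻¹)'(ξ)|` differs from `d(0, g 0)` by a bounded amount (`abs_growth_sub_le`). This is the first
estimate, and the same statement for `h` reduces the second one to comparing `d(0, g 0)` with `d(0,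
h 0)`.

For that comparison (`exists_growth_bound`), take `g 0` to be no closer to the circle than `h 0`.
The walls behind which `g R` but not `h R` lies separate, seen from `g R`, the origin from two
points at a definite Euclidean distance, so by local finiteness their number is bounded. As `g` and
`h` lie behind equally many walls, the walls with the roles exchanged are equally many. Thus `g⁻¹ h`
has bounded length and ranges over a finite set.

All this requires that `R` has finitely many sides, which is deduced from finite generation of `G`
(`finite_sidePairings`). -/

noncomputable section

namespace HypDisc

variable {G : Subgroup (Equiv.Perm CDisc)} {R : Set CDisc}

/-! ### Möbius maps and the functionals that cut out geodesics. -/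

/-- The value at `z` of the (homogeneous) functional `l`; its zero set in the disc is a geodesic. -/
def ev (l : ℝ × ℂ) (z : CDisc) : ℝ :=
  l.1 * (1 + ((z : ℂ).re ^ 2 + (z : ℂ).im ^ 2)) + 2 * (l.2.re * (z : ℂ).re + l.2.im * (z : ℂ).im)

/-- `g` is the Möbius map with coefficients `a, b`. -/
def Coef (g : Equiv.Perm CDisc) (a b : ℂ) : Prop :=
  ‖a‖ ^ 2 - ‖b‖ ^ 2 = 1 ∧
    ∀ z : CDisc, ((g z : CDisc) : ℂ) = (a * z + b) / (star b * z + star a)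

theorem norm_sq_eq (a : ℂ) : ‖a‖ ^ 2 = a.re ^ 2 + a.im ^ 2 := by
  rw [← Complex.normSq_eq_norm_sq, Complex.normSq_apply]; ring

theorem CDisc.norm_le (z : CDisc) : ‖(z : ℂ)‖ ≤ 1 :=
  mem_closedBall_zero_iff.1 z.2

theorem det_eq {a b : ℂ} (h : ‖a‖ ^ 2 - ‖b‖ ^ 2 = 1) : a * star a - b * star b = 1 := by
  simp only [Complex.star_def, Complex.mul_conj, Complex.normSq_eq_norm_sq]
  exact_mod_cast h

theorem den_ne {a b : ℂ} (h : ‖a‖ ^ 2 - ‖b‖ ^ 2 = 1) (z : CDisc) :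
    star b * (z : ℂ) + star a ≠ 0 := by
  intro h0
  have h1 : star a = -(star b * (z : ℂ)) := by linear_combination h0
  have h2 : ‖a‖ = ‖b‖ * ‖(z : ℂ)‖ := by
    have := congrArg norm h1
    rwa [norm_star, norm_neg, norm_mul, norm_star] at this
  have h3 := CDisc.norm_le z
  nlinarith [norm_nonneg b, norm_nonneg a, norm_nonneg (z : ℂ), mul_le_mul_of_nonneg_left h3 (norm_nonneg b)]

/-- The pullback of a functional by a Möbius map. -/
def pull (a b : ℂ) (l : ℝ × ℂ) : ℝ × ℂ :=
  (l.1 * (‖a‖ ^ 2 + ‖b‖ ^ 2) + 2 * (star l.2 * a * b).re,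
    2 * (l.1 : ℂ) * star a * b + l.2 * star a ^ 2 + star l.2 * b ^ 2)

/-- `ev l z` is a Hermitian form with diagonal entries `l.1` and off-diagonal entry `l.2`, taken at
the vector `(z, 1)`. A Möbius map is a linear change of variables followed by division by the second
coordinate, which costs only a positive factor. Signs of functionals are therefore meaningful for
the whole group action. -/
theorem ev_coef {g : Equiv.Perm CDisc} {a b : ℂ} (h : Coef g a b) (l : ℝ × ℂ) (z : CDisc) :
    ev l (g z) * ‖star b * (z : ℂ) + star a‖ ^ 2 = ev (pull a b l) z := by
  have hd := den_ne h.1 z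
  have hw : ((g z : CDisc) : ℂ) * (star b * z + star a) = a * z + b := by
    rw [h.2 z, div_mul_cancel₀ _ hd]
  set w : ℂ := ((g z : CDisc) : ℂ) with hwdef
  set d : ℂ := star b * (z : ℂ) + star a with hddef
  have e1 : (w.re ^ 2 + w.im ^ 2) * (d.re ^ 2 + d.im ^ 2)
      = (a * z + b).re ^ 2 + (a * z + b).im ^ 2 := by
    rw [← hw]; simp only [Complex.mul_re, Complex.mul_im]; ring
  have e2 : w.re * (d.re ^ 2 + d.im ^ 2) = ((a * z + b) * star d).re := by
    rw [← hw]
    simp only [Complex.mul_re, Complex.mul_im, Complex.star_def, Complex.conj_re, Complex.conj_im]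
    ring
  have e3 : w.im * (d.re ^ 2 + d.im ^ 2) = ((a * z + b) * star d).im := by
    rw [← hw]
    simp only [Complex.mul_re, Complex.mul_im, Complex.star_def, Complex.conj_re, Complex.conj_im]
    ring
  have key : ev l (g z) * ‖d‖ ^ 2
      = l.1 * ((d.re ^ 2 + d.im ^ 2) + (w.re ^ 2 + w.im ^ 2) * (d.re ^ 2 + d.im ^ 2))
        + 2 * (l.2.re * (w.re * (d.re ^ 2 + d.im ^ 2)) + l.2.im * (w.im * (d.re ^ 2 + d.im ^ 2))) := by
    rw [norm_sq_eq]; unfold ev; ring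
  rw [key, e1, e2, e3, hddef]
  unfold ev pull
  rw [norm_sq_eq a, norm_sq_eq b]
  simp only [Complex.mul_re, Complex.mul_im, Complex.star_def, Complex.conj_re,
    Complex.conj_im, Complex.add_re, Complex.add_im, pow_two, Complex.ofReal_re, Complex.ofReal_im,
    Complex.re_ofNat, Complex.im_ofNat]
  ring

theorem one_sub_norm_coef {g : Equiv.Perm CDisc} {a b : ℂ} (h : Coef g a b) (z : CDisc) :
    (1 - ‖((g z : CDisc) : ℂ)‖ ^ 2) * ‖star b * (z : ℂ) + star a‖ ^ 2 = 1 - ‖(z : ℂ)‖ ^ 2 := by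
  have hd := den_ne h.1 z
  have hd' : ‖star b * (z : ℂ) + star a‖ ≠ 0 := norm_ne_zero_iff.2 hd
  rw [h.2 z, norm_div, div_pow, sub_mul, div_mul_cancel₀ _ (pow_ne_zero 2 hd')]
  have h1 := h.1
  simp only [norm_sq_eq, Complex.mul_re, Complex.mul_im, Complex.star_def, Complex.conj_re,
    Complex.conj_im, Complex.add_re, Complex.add_im] at h1 ⊢
  linear_combination (1 - ((z : ℂ).re ^ 2 + (z : ℂ).im ^ 2)) * h1

theorem sub_coef {g : Equiv.Perm CDisc} {a b : ℂ} (h : Coef g a b) (z w : CDisc) :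
    ((g z : CDisc) : ℂ) - (g w : CDisc)
      = ((z : ℂ) - w) / ((star b * (z : ℂ) + star a) * (star b * (w : ℂ) + star a)) := by
  have hd := den_ne h.1 z
  have hd' := den_ne h.1 w
  rw [h.2 z, h.2 w, div_sub_div _ _ hd hd']
  congr 1
  have h1 := det_eq h.1
  linear_combination ((z : ℂ) - w) * h1

theorem Coef.mul {g h : Equiv.Perm CDisc} {a b c d : ℂ} (hg : Coef g a b) (hh : Coef h c d) :
    Coef (g * h) (a * c + b * star d) (a * d + b * star c) := by
  refine ⟨?_, fun z => ?_⟩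
  · have h1 := hg.1
    have h2 := hh.1
    simp only [norm_sq_eq, Complex.mul_re, Complex.mul_im, Complex.star_def, Complex.conj_re,
      Complex.conj_im, Complex.add_re, Complex.add_im] at h1 h2 ⊢
    linear_combination (c.re ^ 2 + c.im ^ 2 - (d.re ^ 2 + d.im ^ 2)) * h1 + h2
  · have h1 := den_ne hh.1 z
    have hw : ((h z : CDisc) : ℂ) * (star d * z + star c) = c * z + d := by
      rw [hh.2 z, div_mul_cancel₀ _ h1]
    rw [Equiv.Perm.mul_apply, hg.2 (h z), ← mul_div_mul_right _ _ h1]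
    simp only [star_add, star_mul, star_star]
    congr 1
    · linear_combination a * hw
    · linear_combination star b * hw

theorem Coef.inv {g : Equiv.Perm CDisc} {a b : ℂ} (hg : Coef g a b) :
    Coef g⁻¹ (star a) (-b) := by
  refine ⟨by simpa using hg.1, fun z => ?_⟩
  obtain ⟨y, rfl⟩ := g.surjective z
  rw [show g⁻¹ (g y) = y from g.symm_apply_apply y]
  have h1 := den_ne hg.1 y
  have h3 := den_ne (a := star a) (b := -b) (by simpa using hg.1) (g y)
  have hw : ((g y : CDisc) : ℂ) * (star b * y + star a) = a * y + b := by
    rw [hg.2 y, div_mul_cancel₀ _ h1]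
  rw [eq_div_iff h3]
  apply mul_right_cancel₀ h1
  simp only [star_neg, star_star]
  linear_combination (- star b * y - star a) * hw

theorem IsDiscMoebius.coef {g : Equiv.Perm CDisc} (h : IsDiscMoebius g) : ∃ a b, Coef g a b := h
theorem Coef.moeb {g : Equiv.Perm CDisc} {a b : ℂ} (h : Coef g a b) : IsDiscMoebius g := ⟨a, b, h⟩
theorem IsDiscMoebius.inv {g : Equiv.Perm CDisc} (h : IsDiscMoebius g) : IsDiscMoebius g⁻¹ := by
  obtain ⟨a, b, hc⟩ := h.coef
  exact hc.inv.moeb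

theorem IsDiscMoebius.continuous {g : Equiv.Perm CDisc} (h : IsDiscMoebius g) : Continuous g := by
  obtain ⟨a, b, hc⟩ := h.coef
  rw [continuous_induced_rng]
  have : (Subtype.val ∘ g : CDisc → ℂ) = fun z : CDisc => (a * z + b) / (star b * z + star a) := by
    funext z; exact hc.2 z
  rw [this]
  exact Continuous.div (by fun_prop) (by fun_prop) (fun z => den_ne hc.1 z)

/-- A Möbius map as a homeomorphism of the closed disc. -/
def IsDiscMoebius.homeo {g : Equiv.Perm CDisc} (h : IsDiscMoebius g) : CDisc ≃ₜ CDisc where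
  toEquiv := g
  continuous_toFun := h.continuous
  continuous_invFun := h.inv.continuous

theorem IsDiscMoebius.image_interior {g : Equiv.Perm CDisc} (h : IsDiscMoebius g) (A : Set CDisc) :
    g '' interior A = interior (g '' A) := h.homeo.image_interior A
theorem IsDiscMoebius.image_closure {g : Equiv.Perm CDisc} (h : IsDiscMoebius g) (A : Set CDisc) :
    g '' closure A = closure (g '' A) := h.homeo.image_closure A

theorem mem_openDisc_iff (z : CDisc) : z ∈ openDisc ↔ 0 < 1 - ‖(z : ℂ)‖ ^ 2 := by
  change ‖(z : ℂ)‖ < 1 ↔ _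
  have := norm_nonneg (z : ℂ)
  constructor <;> intro h <;> nlinarith

theorem mem_unitCircle_iff (z : CDisc) : z ∈ unitCircle ↔ 1 - ‖(z : ℂ)‖ ^ 2 = 0 := by
  change ‖(z : ℂ)‖ = 1 ↔ _
  have := norm_nonneg (z : ℂ)
  constructor <;> intro h
  · rw [h]; norm_num
  · nlinarith

theorem IsDiscMoebius.mem_openDisc {g : Equiv.Perm CDisc} (h : IsDiscMoebius g) {z : CDisc} :
    g z ∈ openDisc ↔ z ∈ openDisc := by
  obtain ⟨a, b, hc⟩ := h.coef
  rw [mem_openDisc_iff, mem_openDisc_iff, ← one_sub_norm_coef hc z]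
  have hd : 0 < ‖star b * (z : ℂ) + star a‖ ^ 2 := by
    have := norm_pos_iff.2 (den_ne hc.1 z); positivity
  exact (mul_pos_iff_of_pos_right hd).symm

theorem IsDiscMoebius.mem_unitCircle {g : Equiv.Perm CDisc} (h : IsDiscMoebius g) {z : CDisc} :
    g z ∈ unitCircle ↔ z ∈ unitCircle := by
  obtain ⟨a, b, hc⟩ := h.coef
  rw [mem_unitCircle_iff, mem_unitCircle_iff, ← one_sub_norm_coef hc z]
  have hd : ‖star b * (z : ℂ) + star a‖ ^ 2 ≠ 0 := by
    have := norm_pos_iff.2 (den_ne hc.1 z); positivity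
  exact (mul_eq_zero_iff_right hd).symm

theorem IsDiscMoebius.hdist {g : Equiv.Perm CDisc} (h : IsDiscMoebius g) (z w : CDisc) :
    hdist (g z) (g w) = hdist z w := by
  obtain ⟨a, b, hc⟩ := h.coef
  unfold HypDisc.hdist
  have h1 := norm_pos_iff.2 (den_ne hc.1 z)
  have h2 := norm_pos_iff.2 (den_ne hc.1 w)
  rw [sub_coef hc, ← one_sub_norm_coef hc z, ← one_sub_norm_coef hc w, norm_div, norm_mul]
  set A := ‖star b * (z : ℂ) + star a‖
  set B := ‖star b * (w : ℂ) + star a‖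
  congr 2
  have hAB : (1 - ‖((g z : CDisc) : ℂ)‖ ^ 2) * A ^ 2 * ((1 - ‖((g w : CDisc) : ℂ)‖ ^ 2) * B ^ 2)
      = ((1 - ‖((g z : CDisc) : ℂ)‖ ^ 2) * (1 - ‖((g w : CDisc) : ℂ)‖ ^ 2)) * (A * B) ^ 2 := by ring
  rw [hAB, Real.sqrt_mul' _ (sq_nonneg _), Real.sqrt_sq (mul_pos h1 h2).le, div_div, mul_comm]

/-- A functional can be moved by a Möbius map, up to a positive factor. -/
theorem IsDiscMoebius.exists_pull {g : Equiv.Perm CDisc} (h : IsDiscMoebius g) (l : ℝ × ℂ) :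
    ∃ l', ∀ z, ∃ m > 0, ev l (g z) = m * ev l' z := by
  obtain ⟨a, b, hc⟩ := h.coef
  refine ⟨pull a b l, fun z => ⟨(‖star b * (z : ℂ) + star a‖ ^ 2)⁻¹, ?_, ?_⟩⟩
  · have := norm_pos_iff.2 (den_ne hc.1 z); positivity
  · rw [← ev_coef hc]
    have := norm_pos_iff.2 (den_ne hc.1 z)
    field_simp

theorem IsDiscMoebius.exists_push {g : Equiv.Perm CDisc} (h : IsDiscMoebius g) (l : ℝ × ℂ) :
    ∃ l', ∀ z, ∃ m > 0, ev l' (g z) = m * ev l z := by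
  obtain ⟨l', hl⟩ := h.inv.exists_pull l
  refine ⟨l', fun z => ?_⟩
  obtain ⟨m, hm, e⟩ := hl (g z)
  rw [show g⁻¹ (g z) = z from g.symm_apply_apply z] at e
  refine ⟨m⁻¹, inv_pos.2 hm, ?_⟩
  rw [e]; field_simp

theorem continuous_ev (l : ℝ × ℂ) : Continuous (ev l) := by
  unfold ev
  have h1 : Continuous fun z : CDisc => (z : ℂ).re := Complex.continuous_re.comp continuous_subtype_val
  have h2 : Continuous fun z : CDisc => (z : ℂ).im := Complex.continuous_im.comp continuous_subtype_val
  fun_prop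

theorem ev_neg (l : ℝ × ℂ) (z : CDisc) : ev (-l) z = -ev l z := by
  unfold ev; simp; ring

theorem ev_smul (r : ℝ) (l : ℝ × ℂ) (z : CDisc) : ev (r • l) z = r * ev l z := by
  unfold ev; simp; ring

theorem ev_origin (l : ℝ × ℂ) : ev l origin = l.1 := by
  unfold ev origin; simp

/-- The Möbius map with given coefficients, as a permutation of the closed disc. -/
theorem exists_coef {a b : ℂ} (h : ‖a‖ ^ 2 - ‖b‖ ^ 2 = 1) : ∃ g, Coef g a b := by
  have key : ∀ {a b : ℂ}, ‖a‖ ^ 2 - ‖b‖ ^ 2 = 1 → ∀ z : CDisc,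
      (a * z + b) / (star b * z + star a) ∈ Metric.closedBall (0 : ℂ) 1 := by
    intro a b h z
    have hd := den_ne h z
    rw [mem_closedBall_zero_iff, norm_div, div_le_one (norm_pos_iff.2 hd)]
    have h1 : ‖(z : ℂ)‖ ^ 2 ≤ 1 := by
      have := CDisc.norm_le z; have := norm_nonneg (z : ℂ); nlinarith
    apply le_of_sq_le_sq _ (norm_nonneg _)
    simp only [norm_sq_eq, Complex.mul_re, Complex.mul_im, Complex.star_def, Complex.conj_re,
      Complex.conj_im, Complex.add_re, Complex.add_im] at h h1 ⊢
    nlinarith [congrArg (fun t => (1 - ((z : ℂ).re ^ 2 + (z : ℂ).im ^ 2)) * t) h]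
  have h' : ‖star a‖ ^ 2 - ‖-b‖ ^ 2 = 1 := by simpa using h
  refine ⟨⟨fun z => ⟨_, key h z⟩, fun z => ⟨_, key h' z⟩, fun z => ?_, fun z => ?_⟩, h, fun z => rfl⟩
  · apply Subtype.ext
    have hd := den_ne h z
    have hd' := den_ne h' ⟨_, key h z⟩
    have hw := div_mul_cancel₀ (a * (z : ℂ) + b) hd
    change (star a * ((a * (z : ℂ) + b) / (star b * z + star a)) + -b) /
      (star (-b) * ((a * (z : ℂ) + b) / (star b * z + star a)) + star (star a)) = (z : ℂ)
    change _ ≠ (0 : ℂ) at hd'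
    rw [div_eq_iff hd']
    apply mul_right_cancel₀ hd
    simp only [star_neg, star_star]
    generalize (a * (z : ℂ) + b) / (star b * z + star a) = w at hw ⊢
    linear_combination (star a + star b * z) * hw
  · apply Subtype.ext
    have hd := den_ne h' z
    have hd' : star b * ((star a * (z : ℂ) + -b) / (star (-b) * z + star (star a))) + star a ≠ 0 :=
      den_ne h ⟨_, key h' z⟩
    have hw := div_mul_cancel₀ (star a * (z : ℂ) + -b) hd
    change (a * ((star a * (z : ℂ) + -b) / (star (-b) * z + star (star a))) + b) /
      (star b * ((star a * (z : ℂ) + -b) / (star (-b) * z + star (star a))) + star a) = (z : ℂ)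
    rw [div_eq_iff hd']
    apply mul_right_cancel₀ hd
    generalize (star a * (z : ℂ) + -b) / (star (-b) * z + star (star a)) = w at hw ⊢
    simp only [star_neg, star_star] at hw ⊢
    linear_combination (a - star b * z) * hw

theorem exists_centre {p : CDisc} (hp : p ∈ openDisc) :
    ∃ g, IsDiscMoebius g ∧ ∀ z, ((g z : CDisc) : ℂ) = centre p z := by
  rw [mem_openDisc_iff] at hp
  set r := √(1 - ‖(p : ℂ)‖ ^ 2) with hr
  have hr0 : 0 < r := Real.sqrt_pos.2 hp
  have hr2 : r ^ 2 = 1 - ‖(p : ℂ)‖ ^ 2 := Real.sq_sqrt hp.le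
  have hrc : (r : ℂ) ≠ 0 := by exact_mod_cast hr0.ne'
  obtain ⟨g, hg⟩ := exists_coef (a := ((r⁻¹ : ℝ) : ℂ)) (b := -((r⁻¹ : ℝ) : ℂ) * p) (by
    rw [norm_mul, norm_neg, Complex.norm_real, Real.norm_of_nonneg (inv_pos.2 hr0).le]
    field_simp
    linarith)
  refine ⟨g, hg.moeb, fun z => ?_⟩
  have h1 := den_ne hg.1 z
  rw [hg.2 z]
  unfold centre
  have e1 : star (-((r⁻¹ : ℝ) : ℂ) * p) * (z : ℂ) + star ((r⁻¹ : ℝ) : ℂ)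
      = ((r⁻¹ : ℝ) : ℂ) * (1 - star (p : ℂ) * z) := by
    simp only [star_mul, star_neg, Complex.star_def, Complex.conj_ofReal]; ring
  have e2 : ((r⁻¹ : ℝ) : ℂ) * (z : ℂ) + -((r⁻¹ : ℝ) : ℂ) * p = ((r⁻¹ : ℝ) : ℂ) * (z - p) := by ring
  rw [e1, e2, mul_div_mul_left]
  simpa using hrc

theorem centre_self (p : CDisc) : centre p p = 0 := by simp [centre]

/-! ### Normal form of a geodesic and signs of functionals along it. -/

/-- `tanh (t / 2)`. -/
def th (t : ℝ) : ℝ := (Real.exp t - 1) / (Real.exp t + 1)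

theorem th_eq (t : ℝ) : th t = Real.sinh (t / 2) / Real.cosh (t / 2) := by
  have h := Real.exp_pos (t / 2)
  have h2 : Real.exp t = Real.exp (t / 2) ^ 2 := by rw [← Real.exp_nat_mul]; congr 1; push_cast; ring
  rw [th, Real.sinh_eq, Real.cosh_eq, Real.exp_neg, h2]
  field_simp

theorem one_sub_th_sq (t : ℝ) : 1 - th t ^ 2 = 1 / Real.cosh (t / 2) ^ 2 := by
  rw [th_eq]
  have := Real.cosh_pos (t / 2)
  field_simp
  linarith [Real.cosh_sq (t / 2)]

theorem th_sub (s t : ℝ) :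
    th s - th t = Real.sinh ((s - t) / 2) / (Real.cosh (s / 2) * Real.cosh (t / 2)) := by
  have := Real.cosh_pos (t / 2)
  have := Real.cosh_pos (s / 2)
  rw [th_eq, th_eq, sub_div, Real.sinh_sub]
  field_simp

theorem continuous_th : Continuous th := by
  unfold th
  exact Continuous.div (by fun_prop) (by fun_prop) (fun t => by positivity)

theorem tendsto_th_atTop : Tendsto th atTop (𝓝 1) := by
  have : th = fun t => 1 - 2 / (Real.exp t + 1) := by
    funext t; unfold th
    have := Real.exp_pos t
    field_simp; ring
  rw [this]
  have h : Tendsto (fun t : ℝ => 2 / (Real.exp t + 1)) atTop (𝓝 0) :=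
    Tendsto.const_div_atTop (tendsto_atTop_add_const_right _ _ Real.tendsto_exp_atTop) 2
  simpa using tendsto_const_nhds.sub h

theorem tendsto_th_atBot : Tendsto th atBot (𝓝 (-1)) := by
  unfold th
  have h := Real.tendsto_exp_atBot
  have h1 := (h.sub_const 1).div (h.add_const 1) (by norm_num)
  rw [show ((0 : ℝ) - 1) / (0 + 1) = -1 by norm_num] at h1
  exact h1

theorem abs_th_lt_one (t : ℝ) : |th t| < 1 := by
  have h1 := one_sub_th_sq t
  have h2 : 0 < 1 / Real.cosh (t / 2) ^ 2 := by have := Real.cosh_pos (t / 2); positivity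
  have : th t ^ 2 < 1 ^ 2 := by linarith
  exact abs_lt_of_sq_lt_sq this (by norm_num)

theorem exists_th {r : ℝ} (h : |r| < 1) : ∃ t, th t = r := by
  rw [abs_lt] at h
  refine ⟨Real.log ((1 + r) / (1 - r)), ?_⟩
  have h1 : 0 < 1 + r := by linarith
  have h2 : 0 < 1 - r := by linarith
  rw [th, Real.exp_log (by positivity)]
  field_simp
  ring

theorem norm_sub_sq_of_hdist {z w : CDisc} (hz : z ∈ openDisc) (hw : w ∈ openDisc) {d : ℝ}
    (h : hdist z w = |d|) :
    ‖(z : ℂ) - w‖ ^ 2 = Real.sinh (d / 2) ^ 2 * ((1 - ‖(z : ℂ)‖ ^ 2) * (1 - ‖(w : ℂ)‖ ^ 2)) := by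
  rw [mem_openDisc_iff] at hz hw
  have h0 := mul_pos hz hw
  have h1 : Real.arsinh (‖(z : ℂ) - w‖ / √((1 - ‖(z : ℂ)‖ ^ 2) * (1 - ‖(w : ℂ)‖ ^ 2))) = |d| / 2 := by
    unfold hdist at h; linarith
  have h2 := congrArg Real.sinh h1
  rw [Real.sinh_arsinh, div_eq_iff (Real.sqrt_pos.2 h0).ne'] at h2
  rw [h2, mul_pow, Real.sq_sqrt h0.le]
  congr 1
  rcases abs_choice d with e | e <;> rw [e]
  rw [neg_div, Real.sinh_neg, neg_sq]

/-- A geodesic becomes a diameter after moving `γ 0` to the origin. -/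
theorem IsGeodesic.normal {γ : ℝ → CDisc} (h : IsGeodesic γ) :
    ∃ g, IsDiscMoebius g ∧ (∀ z, ((g z : CDisc) : ℂ) = centre (γ 0) z) ∧
      ∃ u : ℂ, ‖u‖ = 1 ∧ ∀ t, ((g (γ t) : CDisc) : ℂ) = th t * u := by
  obtain ⟨g, hg, hc⟩ := exists_centre (h.1 0)
  refine ⟨g, hg, hc, ?_⟩
  set w : ℝ → CDisc := fun t => g (γ t) with hw
  have w0 : (w 0 : ℂ) = 0 := by rw [hw]; simp only; rw [hc, centre_self]
  have hD : ∀ t, w t ∈ openDisc := fun t => hg.mem_openDisc.2 (h.1 t)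
  have hdi : ∀ s t, hdist (w s) (w t) = |s - t| := fun s t => by
    rw [hw]; simp only; rw [hg.hdist, h.2]
  have hn : ∀ t, ‖(w t : ℂ)‖ ^ 2 = th t ^ 2 := by
    intro t
    have := norm_sub_sq_of_hdist (hD t) (hD 0) (hdi t 0)
    rw [w0] at this
    simp only [sub_zero, norm_zero] at this
    have h1 := one_sub_th_sq t
    have h2 := Real.cosh_sq (t / 2)
    have h3 : 0 < Real.cosh (t / 2) ^ 2 := by have := Real.cosh_pos (t / 2); positivity
    rw [th_eq, div_pow]
    field_simp
    nlinarith
  have hd : ∀ s t, ‖(w s : ℂ) - w t‖ ^ 2 = (th s - th t) ^ 2 := by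
    intro s t
    rw [norm_sub_sq_of_hdist (hD s) (hD t) (hdi s t), hn, hn, one_sub_th_sq, one_sub_th_sq, th_sub]
    ring
  have h1 : th 1 ≠ 0 := by
    have := Real.exp_pos 1
    have := Real.add_one_lt_exp (x := 1) (by norm_num)
    unfold th
    have : 0 < Real.exp 1 - 1 := by linarith
    positivity
  refine ⟨(w 1 : ℂ) / th 1, ?_, fun t => ?_⟩
  · rw [norm_div, Complex.norm_real, Real.norm_eq_abs]
    have : ‖(w 1 : ℂ)‖ = |th 1| := by
      rw [← abs_of_nonneg (norm_nonneg (w 1 : ℂ))]; exact sq_eq_sq_iff_abs_eq_abs _ _ |>.1 (hn 1)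
    rw [this]; exact div_self (abs_ne_zero.2 h1)
  · have hre : (w t : ℂ).re * (w 1 : ℂ).re + (w t : ℂ).im * (w 1 : ℂ).im = th t * th 1 := by
      have a1 := hn t
      have a2 := hn 1
      have a3 := hd t 1
      rw [norm_sq_eq] at a1 a2 a3
      simp only [Complex.sub_re, Complex.sub_im] at a3
      linarith
    have h0 : ‖(w t : ℂ) * th 1 - th t * w 1‖ ^ 2 = 0 := by
      have a1 := hn t
      have a2 := hn 1
      rw [norm_sq_eq] at a1 a2 ⊢
      simp only [Complex.sub_re, Complex.sub_im, Complex.mul_re, Complex.mul_im,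
        Complex.ofReal_re, Complex.ofReal_im]
      linear_combination th 1 ^ 2 * a1 + th t ^ 2 * a2 - 2 * th t * th 1 * hre
    have h2 : (w t : ℂ) * th 1 - th t * w 1 = 0 := by simpa using h0
    have h1c : (th 1 : ℂ) ≠ 0 := by exact_mod_cast h1
    change (w t : ℂ) = _
    field_simp
    linear_combination h2

/-- A point on a diameter. -/
def diam (u : ℂ) (hu : ‖u‖ = 1) (r : ℝ) (hr : |r| ≤ 1) : CDisc :=
  ⟨r * u, by rw [mem_closedBall_zero_iff, norm_mul, hu, mul_one, Complex.norm_real]; exact hr⟩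

/-- On a diameter with `r = tanh (t / 2)` a functional becomes `A (1 + r²) + 2 β r`, which is a
positive multiple of `(A + β) exp (2 t) + (A - β)`. So its sign changes at most once along a
geodesic, and the coefficients `P` and `Q` carry its signs at the positive and the negative
endpoint. -/
theorem IsGeodesic.sign {γ : ℝ → CDisc} (h : IsGeodesic γ) :
    ∃ ξ ∈ unitCircle, ∃ η ∈ unitCircle, ξ ≠ η ∧ Tendsto γ atTop (𝓝 ξ) ∧ Tendsto γ atBot (𝓝 η) ∧
      ∀ l, ∃ P Q : ℝ, (∀ t, ∃ m > 0, ev l (γ t) = m * (P * Real.exp (2 * t) + Q)) ∧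
        (∃ m > 0, ev l ξ = m * P) ∧ (∃ m > 0, ev l η = m * Q) := by
  obtain ⟨g, hg, -, u, hu, hγ⟩ := h.normal
  have hγ' : ∀ t, γ t = g⁻¹ (diam u hu (th t) (abs_th_lt_one t).le) := by
    intro t
    rw [Equiv.Perm.eq_inv_iff_eq]
    exact Subtype.ext (hγ t)
  have hlim : ∀ (F : Filter ℝ) (r : ℝ) (hr : |r| ≤ 1), Tendsto th F (𝓝 r) →
      Tendsto γ F (𝓝 (g⁻¹ (diam u hu r hr))) := by
    intro F r hr hF
    have : γ = fun t => g⁻¹ (diam u hu (th t) (abs_th_lt_one t).le) := funext hγ'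
    rw [this]
    refine (hg.inv.continuous.tendsto _).comp ?_
    rw [tendsto_subtype_rng]
    exact ((Complex.continuous_ofReal.tendsto r).comp hF).mul_const u
  have hc : ∀ (r : ℝ) (hr : |r| ≤ 1), |r| = 1 → g⁻¹ (diam u hu r hr) ∈ unitCircle := by
    intro r hr h1
    rw [hg.inv.mem_unitCircle]
    change ‖(r : ℂ) * u‖ = 1
    rw [norm_mul, hu, mul_one, Complex.norm_real, Real.norm_eq_abs, h1]
  refine ⟨_, hc 1 (by simp) (by simp), _, hc (-1) (by simp) (by simp), ?_, hlim _ _ _ tendsto_th_atTop,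
    hlim _ _ _ tendsto_th_atBot, fun l => ?_⟩
  · intro he
    have := congrArg Subtype.val (g⁻¹.injective he)
    simp only [diam] at this
    have hu0 : u ≠ 0 := by rintro rfl; simp at hu
    have h2 := mul_right_cancel₀ hu0 this
    norm_num at h2
  · obtain ⟨l', hl⟩ := hg.inv.exists_pull l
    have hev : ∀ (r : ℝ) (hr : |r| ≤ 1), ev l' (diam u hu r hr)
        = l'.1 * (1 + r ^ 2) + 2 * r * (l'.2.re * u.re + l'.2.im * u.im) := by
      intro r hr
      have h1 : u.re ^ 2 + u.im ^ 2 = 1 := by rw [← norm_sq_eq, hu]; norm_num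
      simp only [ev, diam, Complex.mul_re, Complex.mul_im, Complex.ofReal_re, Complex.ofReal_im]
      linear_combination l'.1 * r ^ 2 * h1
    set β := l'.2.re * u.re + l'.2.im * u.im with hβ
    refine ⟨l'.1 + β, l'.1 - β, fun t => ?_, ?_, ?_⟩
    · obtain ⟨m, hm, e⟩ := hl (diam u hu (th t) (abs_th_lt_one t).le)
      have := Real.exp_pos t
      refine ⟨m * (2 / (Real.exp t + 1) ^ 2), by positivity, ?_⟩
      rw [hγ', e, hev, two_mul t, Real.exp_add, th]
      field_simp
      ring
    · obtain ⟨m, hm, e⟩ := hl (diam u hu 1 (by simp))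
      refine ⟨m * 2, by positivity, ?_⟩
      rw [e, hev]; ring
    · obtain ⟨m, hm, e⟩ := hl (diam u hu (-1) (by simp))
      refine ⟨m * 2, by positivity, ?_⟩
      rw [e, hev]; ring

theorem IsGeodesic.continuous {γ : ℝ → CDisc} (h : IsGeodesic γ) : Continuous γ := by
  obtain ⟨g, hg, -, u, hu, hγ⟩ := h.normal
  have : γ = fun t => g⁻¹ (diam u hu (th t) (abs_th_lt_one t).le) := by
    funext t
    rw [Equiv.Perm.eq_inv_iff_eq]
    exact Subtype.ext (hγ t)
  rw [this]
  refine hg.inv.continuous.comp (Continuous.subtype_mk ?_ _)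
  exact (Complex.continuous_ofReal.comp continuous_th).mul continuous_const

theorem IsGeodesic.injective {γ : ℝ → CDisc} (h : IsGeodesic γ) : Function.Injective γ := by
  intro s t e
  have := h.2 s t
  rw [e] at this
  have h2 : |s - t| = 0 := by rw [← this]; simp [hdist]
  linarith [abs_eq_zero.1 h2]

theorem IsGeodesic.map {γ : ℝ → CDisc} (h : IsGeodesic γ) {g : Equiv.Perm CDisc}
    (hg : IsDiscMoebius g) : IsGeodesic (g ∘ γ) :=
  ⟨fun t => hg.mem_openDisc.2 (h.1 t), fun s t => by
    rw [Function.comp_apply, Function.comp_apply, hg.hdist, h.2]⟩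

theorem IsGeodesic.reverse {γ : ℝ → CDisc} (h : IsGeodesic γ) : IsGeodesic (fun t => γ (-t)) :=
  ⟨fun t => h.1 _, fun s t => by rw [h.2, ← abs_neg]; congr 1; ring⟩

theorem IsGeodesic.shift {γ : ℝ → CDisc} (h : IsGeodesic γ) (c : ℝ) : IsGeodesic (fun t => γ (t + c)) :=
  ⟨fun t => h.1 _, fun s t => by rw [h.2]; congr 1; ring⟩

/-- The functional that vanishes on a geodesic and is negative on its right. -/
theorem IsGeodesic.exists_functional {γ : ℝ → CDisc} (h : IsGeodesic γ) :
    ∃ l, l ≠ 0 ∧ (∀ z ∈ openDisc, ev l z = 0 ↔ z ∈ range γ) ∧ ∀ z, z ∈ rightSide γ ↔ z ∈ openDisc ∧ ev l z < 0 := by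
  obtain ⟨g, hg, hc, u, hu, hγ⟩ := h.normal
  have h1u : u.re ^ 2 + u.im ^ 2 = 1 := by rw [← norm_sq_eq, hu]; norm_num
  have h1 : 0 < th 1 := by
    have := Real.exp_pos 1
    have := Real.add_one_lt_exp (x := 1) (by norm_num)
    unfold th
    have : 0 < Real.exp 1 - 1 := by linarith
    positivity
  obtain ⟨l, hl⟩ := hg.exists_pull (0, (⟨-u.im, u.re⟩ : ℂ))
  have hev : ∀ z : CDisc, ev (0, (⟨-u.im, u.re⟩ : ℂ)) z = 2 * (u.re * (z : ℂ).im - u.im * (z : ℂ).re) := by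
    intro z; simp only [ev]; ring
  refine ⟨l, ?_, fun z hz => ?_, fun z => ?_⟩
  · rintro rfl
    have hw : ‖Complex.I * u‖ = 1 := by simp [hu]
    obtain ⟨m, -, e⟩ := hl (g⁻¹ (diam _ hw 1 (by simp)))
    rw [show g (g⁻¹ _) = _ from g.apply_symm_apply _, hev] at e
    simp [diam, ev] at e
    linarith
  · obtain ⟨m, hm, e⟩ := hl z
    rw [hev] at e
    constructor
    · intro h0
      rw [h0, mul_zero] at e
      have hgz := hg.mem_openDisc.2 hz
      set w : ℂ := ((g z : CDisc) : ℂ) with hw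
      have h2 : w = ((u.re * w.re + u.im * w.im : ℝ) : ℂ) * u := by
        apply Complex.ext <;>
          simp only [Complex.mul_re, Complex.mul_im, Complex.ofReal_re, Complex.ofReal_im]
        · linear_combination (-w.re) * h1u - u.im * e / 2
        · linear_combination (-w.im) * h1u + u.re * e / 2
      have h3 : |u.re * w.re + u.im * w.im| < 1 := by
        have : ‖w‖ < 1 := hgz
        rw [h2, norm_mul, hu, mul_one, Complex.norm_real] at this
        exact this
      obtain ⟨t, ht⟩ := exists_th h3
      refine ⟨t, g.injective (Subtype.ext ?_)⟩
      rw [hγ, ht]; exact h2.symm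
    · rintro ⟨t, rfl⟩
      rw [hγ] at e
      simp only [Complex.mul_re, Complex.mul_im, Complex.ofReal_re, Complex.ofReal_im] at e
      have : m * ev l (γ t) = 0 := by rw [← e]; ring
      exact (mul_eq_zero.1 this).resolve_left hm.ne'
  · unfold rightSide
    rw [mem_ofPred_eq, ← hc, ← hc, hγ]
    obtain ⟨m, hm, e⟩ := hl z
    rw [hev] at e
    apply and_congr_right
    intro _
    have : (star ((th 1 : ℂ) * u) * ((g z : CDisc) : ℂ)).im = (th 1 * m / 2) * ev l z := by
      simp only [Complex.mul_re, Complex.mul_im, Complex.ofReal_re, Complex.ofReal_im,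
        Complex.star_def, Complex.conj_re, Complex.conj_im]
      linear_combination th 1 / 2 * e
    rw [this, mul_neg_iff]
    have : 0 < th 1 * m / 2 := by positivity
    constructor
    · rintro (h | h)
      · exact h.2
      · linarith [h.1]
    · exact fun h => Or.inl ⟨this, h⟩

/-! ### The Klein model, segments and radial scaling. -/

/-- The Klein coordinate of a point. -/
def kl (z : CDisc) : ℂ := ((2 / (1 + ‖(z : ℂ)‖ ^ 2) : ℝ) : ℂ) * z

theorem kl_re (z : CDisc) : (kl z).re = 2 / (1 + ‖(z : ℂ)‖ ^ 2) * (z : ℂ).re := by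
  simp [kl, -Complex.ofReal_div]

theorem kl_im (z : CDisc) : (kl z).im = 2 / (1 + ‖(z : ℂ)‖ ^ 2) * (z : ℂ).im := by
  simp [kl, -Complex.ofReal_div]

theorem ev_eq_kl (l : ℝ × ℂ) (z : CDisc) :
    ev l z = (1 + ‖(z : ℂ)‖ ^ 2) * (l.1 + (l.2.re * (kl z).re + l.2.im * (kl z).im)) := by
  have : 0 < 1 + ‖(z : ℂ)‖ ^ 2 := by positivity
  rw [kl_re, kl_im, ev, ← norm_sq_eq]
  field_simp

theorem norm_kl (z : CDisc) : ‖kl z‖ = 2 * ‖(z : ℂ)‖ / (1 + ‖(z : ℂ)‖ ^ 2) := by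
  rw [kl, norm_mul, Complex.norm_real, Real.norm_of_nonneg (by positivity)]; ring

theorem kl_injective : Function.Injective kl := by
  intro z w h
  have h1 := congrArg norm h
  rw [norm_kl, norm_kl, div_eq_div_iff (by positivity) (by positivity)] at h1
  have hz := CDisc.norm_le z
  have hw := CDisc.norm_le w
  have hz0 := norm_nonneg (z : ℂ)
  have hw0 := norm_nonneg (w : ℂ)
  have h2 : ‖(z : ℂ)‖ = ‖(w : ℂ)‖ := by
    have h3 : (‖(z : ℂ)‖ - ‖(w : ℂ)‖) * (1 - ‖(z : ℂ)‖ * ‖(w : ℂ)‖) = 0 := by linarith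
    rcases mul_eq_zero.1 h3 with h4 | h4
    · linarith
    · nlinarith
  unfold kl at h
  rw [h2] at h
  refine Subtype.ext (mul_left_cancel₀ ?_ h)
  have : 0 < 2 / (1 + ‖(w : ℂ)‖ ^ 2) := by positivity
  exact_mod_cast this.ne'

theorem exists_kl {w : ℂ} (hw : ‖w‖ < 1) : ∃ z ∈ openDisc, kl z = w ∧ ‖(z : ℂ)‖ ≤ ‖w‖ := by
  set r := √(1 - ‖w‖ ^ 2) with hr
  have h0 := norm_nonneg w
  have hr0 : 0 ≤ r := Real.sqrt_nonneg _
  have hr2 : r ^ 2 = 1 - ‖w‖ ^ 2 := Real.sq_sqrt (by nlinarith)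
  have h1 : ‖((1 + r : ℝ)⁻¹ : ℂ) * w‖ = ‖w‖ / (1 + r) := by
    rw [norm_mul, norm_inv, Complex.norm_real, Real.norm_of_nonneg (by linarith)]; ring
  have h2 : ‖w‖ / (1 + r) ≤ ‖w‖ := div_le_self h0 (by linarith)
  refine ⟨⟨((1 + r : ℝ)⁻¹ : ℂ) * w, by rw [mem_closedBall_zero_iff, h1]; linarith⟩, ?_, ?_, ?_⟩
  · change ‖((1 + r : ℝ)⁻¹ : ℂ) * w‖ < 1
    rw [h1]; linarith
  · unfold kl
    simp only
    rw [h1, ← mul_assoc]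
    have : (((2 / (1 + (‖w‖ / (1 + r)) ^ 2) : ℝ) : ℂ) * ((1 + r : ℝ)⁻¹ : ℂ)) = 1 := by
      rw [← Complex.ofReal_inv, ← Complex.ofReal_mul, ← Complex.ofReal_one]
      congr 1
      have : 0 < 1 + r := by linarith
      have : 0 < (1 + r) ^ 2 + ‖w‖ ^ 2 := by positivity
      field_simp
      nlinarith
    rw [this, one_mul]
  · change ‖((1 + r : ℝ)⁻¹ : ℂ) * w‖ ≤ _
    rw [h1]; exact h2

/-- Two functionals that vanish at the same two points are proportional. -/
theorem functional_unique {l l' : ℝ × ℂ} {x y : CDisc} (hxy : x ≠ y) (hx : ev l x = 0)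
    (hy : ev l y = 0) (hx' : ev l' x = 0) (hy' : ev l' y = 0) (hl : l ≠ 0) : ∃ r : ℝ, l' = r • l := by
  have pos : ∀ z : CDisc, (1 + ‖(z : ℂ)‖ ^ 2) ≠ 0 := fun z => by positivity
  rw [ev_eq_kl, mul_eq_zero, or_iff_right (pos _)] at hx hy hx' hy'
  set k := kl x
  set k' := kl y
  have hne : 0 < (k'.re - k.re) ^ 2 + (k'.im - k.im) ^ 2 := by
    by_contra h0
    push Not at h0
    have a1 : k'.re - k.re = 0 := by nlinarith [sq_nonneg (k'.re - k.re), sq_nonneg (k'.im - k.im)]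
    have a2 : k'.im - k.im = 0 := by nlinarith [sq_nonneg (k'.re - k.re), sq_nonneg (k'.im - k.im)]
    exact hxy (kl_injective (Complex.ext (by linarith) (by linarith)))
  set D1 := k'.re - k.re with hD1
  set D2 := k'.im - k.im with hD2
  -- In Klein coordinates both gradients are orthogonal to the direction `(D1, D2)`, so each is a
  -- multiple of the rotated direction; `s` and `s'` are these multiples up to the common factor
  -- `D1² + D2²`.
  set s := l.2.im * D1 - l.2.re * D2 with hs
  set s' := l'.2.im * D1 - l'.2.re * D2 with hs'
  have e : l.2.re * D1 + l.2.im * D2 = 0 := by rw [hD1, hD2]; linarith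
  have e' : l'.2.re * D1 + l'.2.im * D2 = 0 := by rw [hD1, hD2]; linarith
  have f1 : l.2.re * (D1 ^ 2 + D2 ^ 2) = -s * D2 := by rw [hs]; linear_combination D1 * e
  have f2 : l.2.im * (D1 ^ 2 + D2 ^ 2) = s * D1 := by rw [hs]; linear_combination D2 * e
  have f1' : l'.2.re * (D1 ^ 2 + D2 ^ 2) = -s' * D2 := by rw [hs']; linear_combination D1 * e'
  have f2' : l'.2.im * (D1 ^ 2 + D2 ^ 2) = s' * D1 := by rw [hs']; linear_combination D2 * e'
  have hs0 : s ≠ 0 := by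
    intro h0
    apply hl
    rw [h0] at f1 f2
    have a1 : l.2.re = 0 := by
      have : l.2.re * (D1 ^ 2 + D2 ^ 2) = 0 := by linarith
      exact (mul_eq_zero.1 this).resolve_right hne.ne'
    have a2 : l.2.im = 0 := by
      have : l.2.im * (D1 ^ 2 + D2 ^ 2) = 0 := by linarith
      exact (mul_eq_zero.1 this).resolve_right hne.ne'
    rw [a1, a2] at hx
    exact Prod.ext (by simpa using hx) (Complex.ext a1 a2)
  have g1 : l'.2.re = s' / s * l.2.re := by
    apply mul_right_cancel₀ hne.ne'
    rw [f1', mul_assoc, f1]; field_simp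
  have g2 : l'.2.im = s' / s * l.2.im := by
    apply mul_right_cancel₀ hne.ne'
    rw [f2', mul_assoc, f2]; field_simp
  refine ⟨s' / s, Prod.ext ?_ (Complex.ext ?_ ?_)⟩
  · simp only [Prod.smul_fst, smul_eq_mul]
    rw [g1, g2] at hx'
    linear_combination hx' - s' / s * hx
  · simp [g1]
  · simp [g2]

/-- The hypothesis places the origin on the Euclidean segment from `x` to `y`. The claim is then the
addition formula for `sinh`, since `arsinh (t / √(1 - t²))` has `cosh` equal to `1 / √(1 - t²)`. -/
theorem hdist_add_of_opposite {x y : CDisc} (hx : x ∈ openDisc) (hy : y ∈ openDisc)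
    (h : ‖(x : ℂ) - y‖ = ‖(x : ℂ)‖ + ‖(y : ℂ)‖) :
    hdist x origin + hdist origin y = hdist x y := by
  rw [mem_openDisc_iff] at hx hy
  unfold hdist origin
  simp only [sub_zero, zero_sub, norm_neg, norm_zero]
  rw [h]
  set r := ‖(x : ℂ)‖
  set s := ‖(y : ℂ)‖
  rw [show (1 - r ^ 2) * (1 - 0 ^ 2) = 1 - r ^ 2 by ring, show (1 - 0 ^ 2) * (1 - s ^ 2) = 1 - s ^ 2 by ring,
    ← mul_add]
  congr 1
  apply Real.sinh_injective
  rw [Real.sinh_add, Real.sinh_arsinh, Real.sinh_arsinh, Real.sinh_arsinh, Real.cosh_arsinh,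
    Real.cosh_arsinh, Real.sqrt_mul hx.le]
  have hX := Real.sq_sqrt hx.le
  have hY := Real.sq_sqrt hy.le
  have hX0 := Real.sqrt_pos.2 hx
  have hY0 := Real.sqrt_pos.2 hy
  have c : ∀ t X : ℝ, 0 < X → X ^ 2 = 1 - t ^ 2 → √(1 + (t / X) ^ 2) = 1 / X := by
    intro t X h1 h2
    rw [show 1 + (t / X) ^ 2 = (1 / X) ^ 2 by field_simp; linarith, Real.sqrt_sq (by positivity)]
  rw [c _ _ hX0 hX, c _ _ hY0 hY]
  field_simp

/-- Points that lie on a geodesic segment in the Klein picture lie on it metrically. -/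
theorem hdist_add_of_btw {x z y : CDisc} (hx : x ∈ openDisc) (hz : z ∈ openDisc) (hy : y ∈ openDisc)
    {p q : ℝ} (hp : 0 ≤ p) (hq : 0 ≤ q) (h : ∀ l, ev l z = p * ev l x + q * ev l y) :
    hdist x z + hdist z y = hdist x y := by
  obtain ⟨g, hg, hc⟩ := exists_centre hz
  have hgz : g z = origin := Subtype.ext (by rw [hc, centre_self]; rfl)
  rw [← hg.hdist x z, ← hg.hdist z y, ← hg.hdist x y, hgz]
  apply hdist_add_of_opposite (hg.mem_openDisc.2 hx) (hg.mem_openDisc.2 hy)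
  obtain ⟨a, b, hab⟩ := hg.coef
  have hdz := norm_pos_iff.2 (den_ne hab.1 z)
  have hdx := norm_pos_iff.2 (den_ne hab.1 x)
  have hdy := norm_pos_iff.2 (den_ne hab.1 y)
  set dz := ‖star b * (z : ℂ) + star a‖
  set dx := ‖star b * (x : ℂ) + star a‖
  set dy := ‖star b * (y : ℂ) + star a‖
  have key : ∀ l, ev l (g z) * dz ^ 2 = (p * dx ^ 2) * ev l (g x) + (q * dy ^ 2) * ev l (g y) := by
    intro l
    rw [ev_coef hab, h, ← ev_coef hab, ← ev_coef hab]; ring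
  rw [hgz] at key
  set P := p * dx ^ 2
  set Q := q * dy ^ 2
  have hP : 0 ≤ P := by positivity
  have hQ : 0 ≤ Q := by positivity
  -- With `z` at the origin, the functionals `(0, 1)` and `(0, I)` read off coordinates: `P g(x) + Q
  -- g(y) = 0`. So the two images lie on opposite radii.
  have k1 := key (1, 0)
  have k2 := key (0, 1)
  have k3 := key (0, Complex.I)
  rw [ev_origin] at k1 k2 k3
  simp only [ev, Complex.one_re, Complex.one_im, Complex.I_re, Complex.I_im, Complex.zero_re,
    Complex.zero_im] at k1 k2 k3
  have hsum : (P : ℂ) * (g x : CDisc) = -((Q : ℂ) * (g y : CDisc)) := by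
    apply Complex.ext <;> simp <;> linarith
  have hnorm : P * ‖((g x : CDisc) : ℂ)‖ = Q * ‖((g y : CDisc) : ℂ)‖ := by
    have := congrArg norm hsum
    rwa [norm_neg, norm_mul, norm_mul, Complex.norm_real, Complex.norm_real, Real.norm_of_nonneg hP,
      Real.norm_of_nonneg hQ] at this
  by_cases hP0 : P = 0
  · rw [hP0, zero_mul] at hnorm
    have hQ0 : Q ≠ 0 := by
      intro h0
      rw [hP0, h0] at k1
      have : 0 < dz ^ 2 := by positivity
      linarith
    have hy0 : ‖((g y : CDisc) : ℂ)‖ = 0 := (mul_eq_zero.1 hnorm.symm).resolve_left hQ0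
    rw [hy0, add_zero, norm_eq_zero.1 hy0, sub_zero]
  · have hP' : 0 < P := lt_of_le_of_ne hP (Ne.symm hP0)
    have e : (P : ℂ) * ((g x : CDisc) - (g y : CDisc)) = -(((P + Q : ℝ) : ℂ) * (g y : CDisc)) := by
      push_cast; linear_combination hsum
    have e2 := congrArg norm e
    rw [norm_neg, norm_mul, norm_mul, Complex.norm_real, Complex.norm_real, Real.norm_of_nonneg hP,
      Real.norm_of_nonneg (by positivity)] at e2
    apply mul_left_cancel₀ hP'.ne'
    rw [e2]; linarith

/-- The point `s z` for `0 ≤ s ≤ 1`. -/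
def scl (s : ℝ) (z : CDisc) : CDisc :=
  ⟨((max 0 (min s 1) : ℝ) : ℂ) * z, by
    rw [mem_closedBall_zero_iff, norm_mul, Complex.norm_real, Real.norm_of_nonneg (le_max_left _ _)]
    exact mul_le_one₀ (max_le zero_le_one (min_le_right _ _)) (norm_nonneg _) (CDisc.norm_le z)⟩

theorem scl_coe {s : ℝ} (h0 : 0 ≤ s) (h1 : s ≤ 1) (z : CDisc) : (scl s z : ℂ) = s * z := by
  simp [scl, h0, h1]

theorem scl_zero (z : CDisc) : scl 0 z = origin := Subtype.ext (by simp [scl_coe, origin])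

theorem scl_one (z : CDisc) : scl 1 z = z := Subtype.ext (by simp [scl_coe])

theorem continuous_scl (z : CDisc) : Continuous fun s => scl s z := by
  unfold scl
  refine Continuous.subtype_mk ?_ _
  fun_prop

theorem norm_scl {s : ℝ} (h0 : 0 ≤ s) (h1 : s ≤ 1) (z : CDisc) : ‖(scl s z : ℂ)‖ = s * ‖(z : ℂ)‖ := by
  rw [scl_coe h0 h1, norm_mul, Complex.norm_real, Real.norm_of_nonneg h0]

theorem scl_mem {s : ℝ} (h0 : 0 ≤ s) (h1 : s < 1) (z : CDisc) : scl s z ∈ openDisc := by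
  change ‖_‖ < 1
  rw [norm_scl h0 h1.le]
  have := CDisc.norm_le z
  nlinarith [norm_nonneg (z : ℂ)]

theorem scl_mem' {s : ℝ} (h0 : 0 ≤ s) (h1 : s ≤ 1) {z : CDisc} (hz : z ∈ openDisc) :
    scl s z ∈ openDisc := by
  change ‖_‖ < 1
  rw [norm_scl h0 h1]
  have : ‖(z : ℂ)‖ < 1 := hz
  nlinarith [norm_nonneg (z : ℂ)]

theorem scl_div {r s : ℝ} (hr : 0 < r) (hrs : r ≤ s) (hs : s ≤ 1) (z : CDisc) :
    scl (r / s) (scl s z) = scl r z := by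
  have hs0 : 0 < s := hr.trans_le hrs
  apply Subtype.ext
  rw [scl_coe (by positivity) (by rwa [div_le_one hs0]), scl_coe hs0.le hs,
    scl_coe hr.le (hrs.trans hs), ← mul_assoc, ← Complex.ofReal_mul, div_mul_cancel₀ _ hs0.ne']

/-- The correction term has the sign of `ev l origin`. Hence a functional that is positive at the
origin and has become nonpositive on a radius is negative further out. -/
theorem ev_scl {s : ℝ} (h0 : 0 ≤ s) (h1 : s ≤ 1) (l : ℝ × ℂ) (z : CDisc) :
    ev l (scl s z) = s * ev l z + ev l origin * ((1 - s) * (1 - s * ‖(z : ℂ)‖ ^ 2)) := by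
  rw [ev_origin, norm_sq_eq, ev, ev, scl_coe h0 h1]
  simp only [Complex.mul_re, Complex.mul_im, Complex.ofReal_re, Complex.ofReal_im]
  ring

/-- Geodesics are chords in the Klein model, so Euclidean convexity results become available. The
weights `p` and `q` below are the affine weights corrected by the factors `1 + |·|²` that relate
`ev` to an affine function. -/
theorem HypConvex.convex_image {A : Set CDisc} (h : HypConvex A) (hA : A ⊆ openDisc) :
    Convex ℝ (kl '' A) := by
  rintro _ ⟨x, hx, rfl⟩ _ ⟨y, hy, rfl⟩ a b ha hb hab
  have hn : ∀ z ∈ openDisc, ‖kl z‖ < 1 := by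
    intro z hz
    have hz' : ‖(z : ℂ)‖ < 1 := hz
    rw [norm_kl, div_lt_one (by positivity)]
    nlinarith [norm_nonneg (z : ℂ)]
  have hball : a • kl x + b • kl y ∈ Metric.ball (0 : ℂ) 1 :=
    convex_ball (0 : ℂ) 1 (by simpa using hn x (hA hx)) (by simpa using hn y (hA hy)) ha hb hab
  obtain ⟨z, hz, hkz, -⟩ := exists_kl (by simpa using hball)
  refine ⟨z, h x hx y hy z hz ?_, hkz⟩
  have px : 0 < 1 + ‖(x : ℂ)‖ ^ 2 := by positivity
  have py : 0 < 1 + ‖(y : ℂ)‖ ^ 2 := by positivity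
  have pz : 0 < 1 + ‖(z : ℂ)‖ ^ 2 := by positivity
  refine hdist_add_of_btw (hA hx) hz (hA hy) (p := a * (1 + ‖(z : ℂ)‖ ^ 2) / (1 + ‖(x : ℂ)‖ ^ 2))
    (q := b * (1 + ‖(z : ℂ)‖ ^ 2) / (1 + ‖(y : ℂ)‖ ^ 2)) (by positivity) (by positivity) fun l => ?_
  rw [ev_eq_kl, ev_eq_kl l x, ev_eq_kl l y, hkz]
  field_simp
  simp only [Complex.add_re, Complex.add_im, Complex.mul_re, Complex.mul_im,
    Complex.ofReal_re, Complex.ofReal_im]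
  linear_combination (-l.1) * hab

theorem continuous_kl : Continuous kl := by
  unfold kl
  refine Continuous.mul (Complex.continuous_ofReal.comp ?_) continuous_subtype_val
  refine Continuous.div continuous_const (by fun_prop) (fun z => ?_)
  positivity

/-- A convex set is star shaped with respect to the origin, if this is an interior point. -/
theorem HypConvex.scl_mem_interior {A : Set CDisc} (h : HypConvex A) (hA : A ⊆ openDisc)
    (ho : origin ∈ interior A) {x : CDisc} (hx : x ∈ A) {s : ℝ} (h0 : 0 ≤ s) (h1 : s < 1) :
    scl s x ∈ interior A := by
  have hconv := h.convex_image hA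
  have hint : (0 : ℂ) ∈ interior (kl '' A) := by
    rw [mem_interior_iff_mem_nhds, Metric.mem_nhds_iff] at ho ⊢
    obtain ⟨ε, hε, hb⟩ := ho
    refine ⟨min ε 1, by positivity, fun w hw => ?_⟩
    rw [mem_ball_zero_iff, lt_min_iff] at hw
    obtain ⟨z, -, hkz, hle⟩ := exists_kl hw.2
    refine ⟨z, hb ?_, hkz⟩
    rw [Metric.mem_ball, Subtype.dist_eq]
    simpa [origin] using hle.trans_lt hw.1
  have hk : kl (scl s x) ∈ interior (kl '' A) := by
    set t := s * (1 + ‖(x : ℂ)‖ ^ 2) / (1 + (s * ‖(x : ℂ)‖) ^ 2) with ht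
    have e : kl (scl s x) = (1 - t) • (0 : ℂ) + t • kl x := by
      rw [smul_zero, zero_add, Complex.real_smul, kl, kl, norm_scl h0 h1.le, scl_coe h0 h1.le,
        ← mul_assoc, ← mul_assoc, ← Complex.ofReal_mul, ← Complex.ofReal_mul]
      congr 2
      rw [ht]
      field_simp
    have hx1 := CDisc.norm_le x
    have hx0 := norm_nonneg (x : ℂ)
    have ht0 : 0 ≤ t := by positivity
    have ht1 : t < 1 := by
      rw [ht, div_lt_one (by positivity)]
      have : s * ‖(x : ℂ)‖ ^ 2 < 1 := by
        have : ‖(x : ℂ)‖ ^ 2 ≤ 1 := by nlinarith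
        nlinarith
      nlinarith
    rw [e]
    exact hconv.combo_interior_self_mem_interior hint (mem_image_of_mem kl hx) (by linarith) ht0 (by ring)
  rw [mem_interior]
  refine ⟨kl ⁻¹' interior (kl '' A), fun y hy => ?_, isOpen_interior.preimage continuous_kl, hk⟩
  obtain ⟨z, hz, e⟩ := interior_subset hy
  rwa [← kl_injective e]

/-! ### Lines and their defining functionals. -/

theorem IsDiscMoebius.image_line {L : Set CDisc} (h : IsGeodesicLine L) {g : Equiv.Perm CDisc}
    (hg : IsDiscMoebius g) : IsGeodesicLine (g '' L) := by
  obtain ⟨γ, hγ, rfl⟩ := h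
  exact ⟨g ∘ γ, hγ.map hg, range_comp g γ⟩

/-- `l` is a functional that defines the line `L`. -/
def Defines (l : ℝ × ℂ) (L : Set CDisc) : Prop :=
  l ≠ 0 ∧ ∀ z ∈ openDisc, ev l z = 0 ↔ z ∈ L

theorem IsGeodesicLine.subset {L : Set CDisc} (h : IsGeodesicLine L) : L ⊆ openDisc := by
  obtain ⟨γ, hγ, rfl⟩ := h
  rintro _ ⟨t, rfl⟩
  exact hγ.1 t

theorem IsGeodesicLine.exists_defines {L : Set CDisc} (h : IsGeodesicLine L) : ∃ l, Defines l L := by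
  obtain ⟨γ, hγ, rfl⟩ := h
  obtain ⟨l, h0, h1, -⟩ := hγ.exists_functional
  exact ⟨l, h0, h1⟩

theorem Defines.neg {l : ℝ × ℂ} {L : Set CDisc} (h : Defines l L) : Defines (-l) L :=
  ⟨neg_ne_zero.2 h.1, fun z hz => by rw [ev_neg, neg_eq_zero]; exact h.2 z hz⟩

theorem IsGeodesicLine.eq_of_two {L L' : Set CDisc} (h : IsGeodesicLine L) (h' : IsGeodesicLine L')
    {x y : CDisc} (hxy : x ≠ y) (hx : x ∈ L) (hy : y ∈ L) (hx' : x ∈ L') (hy' : y ∈ L') : L = L' := by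
  obtain ⟨l, hl⟩ := h.exists_defines
  obtain ⟨l', hl'⟩ := h'.exists_defines
  have dx := h.subset hx
  have dy := h.subset hy
  obtain ⟨r, rfl⟩ := functional_unique hxy ((hl.2 x dx).2 hx) ((hl.2 y dy).2 hy)
    ((hl'.2 x dx).2 hx') ((hl'.2 y dy).2 hy') hl.1
  have hr : r ≠ 0 := by rintro rfl; exact hl'.1 (zero_smul _ _)
  ext z
  constructor
  · intro hz
    have dz := h.subset hz
    rw [← hl'.2 z dz, ev_smul, (hl.2 z dz).2 hz, mul_zero]
  · intro hz
    have dz := h'.subset hz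
    rw [← hl'.2 z dz, ev_smul, mul_eq_zero, or_iff_right hr, hl.2 z dz] at hz
    exact hz

theorem Defines.unique {l l' : ℝ × ℂ} {L : Set CDisc} (h : IsGeodesicLine L) (hl : Defines l L)
    (hl' : Defines l' L) : ∃ r : ℝ, r ≠ 0 ∧ l' = r • l := by
  obtain ⟨γ, hγ, rfl⟩ := h
  have h01 : γ 0 ≠ γ 1 := fun e => by simpa using hγ.injective e
  obtain ⟨r, rfl⟩ := functional_unique h01 ((hl.2 _ (hγ.1 0)).2 ⟨0, rfl⟩) ((hl.2 _ (hγ.1 1)).2 ⟨1, rfl⟩)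
    ((hl'.2 _ (hγ.1 0)).2 ⟨0, rfl⟩) ((hl'.2 _ (hγ.1 1)).2 ⟨1, rfl⟩) hl.1
  exact ⟨r, by rintro rfl; exact hl'.1 (zero_smul _ _), rfl⟩

theorem Defines.push {l : ℝ × ℂ} {L : Set CDisc} (hl : Defines l L) {g : Equiv.Perm CDisc}
    (hg : IsDiscMoebius g) :
    ∃ l', Defines l' (g '' L) ∧ ∀ z, ∃ m > 0, ev l' (g z) = m * ev l z := by
  obtain ⟨l', h'⟩ := hg.exists_push l
  refine ⟨l', ⟨?_, fun z hz => ?_⟩, h'⟩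
  · rintro rfl
    apply hl.1
    have hz : ∀ z, ev l z = 0 := by
      intro z
      obtain ⟨m, hm, e⟩ := h' z
      have : ev 0 (g z) = 0 := by simp [ev]
      rw [this] at e
      exact (mul_eq_zero.1 e.symm).resolve_left hm.ne'
    have e1 := hz origin
    have e2 := hz ⟨1, by simp⟩
    have e3 := hz ⟨Complex.I, by simp⟩
    rw [ev_origin] at e1
    simp only [ev, e1, Complex.one_re, Complex.one_im, Complex.I_re, Complex.I_im] at e2 e3
    exact Prod.ext e1 (Complex.ext (by simpa using e2) (by simpa using e3))
  · obtain ⟨y, rfl⟩ := g.surjective z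
    obtain ⟨m, hm, e⟩ := h' y
    rw [g.injective.mem_set_image, ← hl.2 y (hg.mem_openDisc.1 hz), e, mul_eq_zero, or_iff_right hm.ne']

/-! ### Walls and the walls between two tiles. -/

/-- A group with a convex fundamental domain with even corners. -/
structure Tiling (G : Subgroup (Equiv.Perm CDisc)) (R : Set CDisc) : Prop where
  moeb : ∀ g ∈ G, IsDiscMoebius g
  dom : IsFundamentalDomain G R
  even : HasEvenCorners G R

/-- The complete geodesics contained in `N`. -/
def walls (G : Subgroup (Equiv.Perm CDisc)) (R : Set CDisc) : Set (Set CDisc) :=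
  {L | IsGeodesicLine L ∧ L ⊆ net G R}

/-- The walls that separate the tiles `g R` and `h R`. -/
def sep (G : Subgroup (Equiv.Perm CDisc)) (R : Set CDisc) (g h : Equiv.Perm CDisc) :
    Set (Set CDisc) :=
  {L | L ∈ walls G R ∧ ∃ l, Defines l L ∧ ev l (g origin) < 0 ∧ 0 < ev l (h origin)}

theorem origin_mem_openDisc : origin ∈ openDisc := by
  change ‖(0 : ℂ)‖ < 1; simp

/-- The closed disc of Euclidean radius `r`. -/
def disc (r : ℝ) : Set CDisc := {z | ‖(z : ℂ)‖ ≤ r}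

theorem isCompact_disc (r : ℝ) : IsCompact (disc r) :=
  (isClosed_le (by fun_prop) continuous_const).isCompact

theorem disc_subset {r : ℝ} (hr : r < 1) : disc r ⊆ openDisc := fun _ hz => lt_of_le_of_lt hz hr

theorem isOpen_openDisc : IsOpen openDisc := isOpen_lt (by fun_prop) continuous_const

theorem exists_zero_scl {l : ℝ × ℂ} {z : CDisc} (h0 : 0 < ev l origin) (h1 : ev l z ≤ 0) :
    ∃ s, 0 < s ∧ s ≤ 1 ∧ ev l (scl s z) = 0 := by
  have hc : ContinuousOn (fun s => ev l (scl s z)) (Icc 0 1) :=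
    ((continuous_ev l).comp (continuous_scl z)).continuousOn
  have := intermediate_value_Icc' zero_le_one hc
  simp only [scl_one, scl_zero] at this
  obtain ⟨s, hs, e⟩ := this ⟨h1, h0.le⟩
  refine ⟨s, lt_of_le_of_ne hs.1 ?_, hs.2, e⟩
  rintro rfl
  simp only [scl_zero] at e
  exact h0.ne' e

theorem tendsto_scl_one (z : CDisc) : Tendsto (fun s => scl s z) (𝓝[<] 1) (𝓝 z) := by
  have := (continuous_scl z).tendsto 1
  rw [scl_one] at this
  exact this.mono_left nhdsWithin_le_nhds

namespace Tiling

theorem subset_closure_interior (T : Tiling G R) : R ⊆ closure (interior R) := by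
  intro x hx
  refine mem_closure_of_tendsto (tendsto_scl_one x) ?_
  filter_upwards [Ioo_mem_nhdsLT (show (0 : ℝ) < 1 by norm_num)] with s hs
  exact T.dom.convex.scl_mem_interior T.dom.subset_disc T.dom.origin_mem hx hs.1.le hs.2

theorem tile_subset (T : Tiling G R) {g : Equiv.Perm CDisc} (hg : g ∈ G) : g '' R ⊆ openDisc := by
  rintro _ ⟨x, hx, rfl⟩
  exact (T.moeb g hg).mem_openDisc.2 (T.dom.subset_disc hx)

theorem tile_closed (T : Tiling G R) {g : Equiv.Perm CDisc} (hg : g ∈ G) {z : CDisc}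
    (hz : z ∈ closure (g '' R)) (hz' : z ∈ openDisc) : z ∈ g '' R := by
  rw [← (T.moeb g hg).image_closure] at hz
  obtain ⟨y, hy, rfl⟩ := hz
  exact ⟨y, T.dom.isClosed ⟨hy, (T.moeb g hg).mem_openDisc.1 hz'⟩, rfl⟩

theorem centre_mem (T : Tiling G R) {g : Equiv.Perm CDisc} (hg : g ∈ G) :
    g origin ∈ interior (g '' R) := by
  rw [← (T.moeb g hg).image_interior]
  exact mem_image_of_mem g T.dom.origin_mem

theorem centre_mem_disc (T : Tiling G R) {g : Equiv.Perm CDisc} (hg : g ∈ G) :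
    g origin ∈ openDisc := (T.moeb g hg).mem_openDisc.2 origin_mem_openDisc

/-- The interior of one tile is open and `R` is contained in the closure of its interior, so an
interior point in a second tile would make the two interiors meet. -/
theorem not_mem_of_mem_interior (T : Tiling G R) {g h : Equiv.Perm CDisc} (hg : g ∈ G) (hh : h ∈ G)
    (hne : g ≠ h) {x : CDisc} (hx : x ∈ interior (g '' R)) : x ∉ h '' R := by
  rintro ⟨y, hy, rfl⟩
  have hk : h⁻¹ * g ∈ G := G.mul_mem (G.inv_mem hh) hg
  have hy2 : y ∈ (h⁻¹ * g) '' interior R := by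
    rw [← (T.moeb g hg).image_interior] at hx
    obtain ⟨w, hw, e⟩ := hx
    exact ⟨w, hw, by rw [Equiv.Perm.mul_apply, e, Equiv.Perm.inv_eq_iff_eq]⟩
  have hopen : IsOpen ((h⁻¹ * g) '' interior R) := by
    rw [(T.moeb _ hk).image_interior]; exact isOpen_interior
  obtain ⟨w, hw1, hw2⟩ := mem_closure_iff.1 (T.subset_closure_interior hy) _ hopen hy2
  refine disjoint_left.1 (T.dom.disjoint _ hk ?_) hw2 hw1
  intro e
  exact hne (inv_mul_eq_one.1 e).symm

theorem net_disjoint (T : Tiling G R) {g : Equiv.Perm CDisc} (hg : g ∈ G) {x : CDisc}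
    (hx : x ∈ interior (g '' R)) : x ∉ net G R := by
  rintro ⟨k, hk, y, ⟨hy, hy'⟩, rfl⟩
  by_cases e : g = k
  · subst e
    rw [← (T.moeb g hg).image_interior, g.injective.mem_set_image] at hx
    exact hy' hx
  · exact T.not_mem_of_mem_interior hg hk e hx (mem_image_of_mem k hy)

theorem ev_ne (T : Tiling G R) {L : Set CDisc} (hL : L ∈ walls G R) {l : ℝ × ℂ} (hl : Defines l L)
    {g : Equiv.Perm CDisc} (hg : g ∈ G) {x : CDisc} (hx : x ∈ interior (g '' R)) : ev l x ≠ 0 := by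
  intro e
  exact T.net_disjoint hg hx
    (hL.2 ((hl.2 x (T.tile_subset hg (interior_subset hx))).1 e))

theorem ev_centre_ne (T : Tiling G R) {L : Set CDisc} (hL : L ∈ walls G R) {l : ℝ × ℂ}
    (hl : Defines l L) {g : Equiv.Perm CDisc} (hg : g ∈ G) : ev l (g origin) ≠ 0 :=
  T.ev_ne hL hl hg (T.centre_mem hg)

theorem ev_origin_ne (T : Tiling G R) {L : Set CDisc} (hL : L ∈ walls G R) {l : ℝ × ℂ}
    (hl : Defines l L) : ev l origin ≠ 0 := T.ev_centre_ne hL hl G.one_mem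

/-- After moving the tile to `R`, star-shapedness applies: a change of sign on the radius to an
interior point would put a point of the wall in the interior of the tile, which `N` avoids. -/
theorem ev_pos (T : Tiling G R) {L : Set CDisc} (hL : L ∈ walls G R) {l : ℝ × ℂ} (hl : Defines l L)
    {g : Equiv.Perm CDisc} (hg : g ∈ G) (h0 : 0 < ev l (g origin)) {x : CDisc}
    (hx : x ∈ interior (g '' R)) : 0 < ev l x := by
  by_contra hneg
  push Not at hneg
  rw [← (T.moeb g hg).image_interior] at hx
  obtain ⟨y, hy, rfl⟩ := hx
  obtain ⟨l', hl'⟩ := (T.moeb g hg).exists_pull l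
  have k0 : 0 < ev l' origin := by
    obtain ⟨m, hm, e⟩ := hl' origin
    rw [e] at h0
    exact (mul_pos_iff_of_pos_left hm).1 h0
  have k1 : ev l' y ≤ 0 := by
    obtain ⟨m, hm, e⟩ := hl' y
    rw [e] at hneg
    nlinarith
  obtain ⟨s, hs0, hs1, e⟩ := exists_zero_scl k0 k1
  have hmem : scl s y ∈ interior R := by
    rcases hs1.lt_or_eq with h | h
    · exact T.dom.convex.scl_mem_interior T.dom.subset_disc T.dom.origin_mem
        (interior_subset hy) hs0.le h
    · rw [h, scl_one]; exact hy
  obtain ⟨m, hm, e'⟩ := hl' (scl s y)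
  rw [e, mul_zero] at e'
  refine T.ev_ne hL hl hg ?_ e'
  rw [← (T.moeb g hg).image_interior]
  exact mem_image_of_mem g hmem

theorem ev_nonneg (T : Tiling G R) {L : Set CDisc} (hL : L ∈ walls G R) {l : ℝ × ℂ}
    (hl : Defines l L) {g : Equiv.Perm CDisc} (hg : g ∈ G) (h0 : 0 < ev l (g origin)) {x : CDisc}
    (hx : x ∈ closure (g '' R)) : 0 ≤ ev l x := by
  have h1 : x ∈ closure (interior (g '' R)) := by
    have := image_mono (f := g) T.subset_closure_interior
    rw [(T.moeb g hg).image_closure, (T.moeb g hg).image_interior] at this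
    exact closure_minimal this isClosed_closure hx
  have hcl : IsClosed {x | 0 ≤ ev l x} := isClosed_le continuous_const (continuous_ev l)
  exact closure_minimal (fun y hy => (T.ev_pos hL hl hg h0 hy).le) hcl h1

theorem ev_nonpos (T : Tiling G R) {L : Set CDisc} (hL : L ∈ walls G R) {l : ℝ × ℂ}
    (hl : Defines l L) {g : Equiv.Perm CDisc} (hg : g ∈ G) (h0 : ev l (g origin) < 0) {x : CDisc}
    (hx : x ∈ closure (g '' R)) : ev l x ≤ 0 := by
  have := T.ev_nonneg hL hl.neg hg (by rw [ev_neg]; linarith) hx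
  rw [ev_neg] at this
  linarith

theorem image_wall (T : Tiling G R) {L : Set CDisc} (hL : L ∈ walls G R) {g : Equiv.Perm CDisc}
    (hg : g ∈ G) : g '' L ∈ walls G R := by
  refine ⟨(T.moeb g hg).image_line hL.1, ?_⟩
  rintro _ ⟨x, hx, rfl⟩
  obtain ⟨k, hk, y, hy, rfl⟩ := hL.2 hx
  exact ⟨g * k, G.mul_mem hg hk, y, hy, rfl⟩

/-- Take the last parameter at which the radius to `q` is in `R`. A wall through this boundary point
has `q` strictly behind it, by `ev_neg_of_scl_zero`. -/
theorem exit_point (T : Tiling G R) {q : CDisc} (hq : q ∈ openDisc) (hqR : q ∉ R) :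
    ∃ s, 0 < s ∧ s < 1 ∧ scl s q ∈ R ∧ scl s q ∉ interior R := by
  set A : Set ℝ := {s | s ∈ Icc (0 : ℝ) 1 ∧ scl s q ∈ closure R} with hA
  have hAR : ∀ s ∈ A, scl s q ∈ R := fun s hs => T.dom.isClosed ⟨hs.2, scl_mem' hs.1.1 hs.1.2 hq⟩
  have hAc : IsClosed A := isClosed_Icc.inter (isClosed_closure.preimage (continuous_scl q))
  have hA0 : (0 : ℝ) ∈ A :=
    ⟨by simp, by rw [scl_zero]; exact subset_closure (interior_subset T.dom.origin_mem)⟩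
  have hAb : BddAbove A := ⟨1, fun s hs => hs.1.2⟩
  have hs := hAc.csSup_mem ⟨0, hA0⟩ hAb
  set s := sSup A with hsdef
  have hs1 : s < 1 := by
    refine lt_of_le_of_ne hs.1.2 fun e => hqR ?_
    have := hAR s hs
    rwa [e, scl_one] at this
  have hp := hAR s hs
  have hpi : scl s q ∉ interior R := by
    intro hi
    have h1 : ∀ᶠ t in 𝓝[>] s, scl t q ∈ interior R :=
      ((continuous_scl q).tendsto s |>.eventually (isOpen_interior.mem_nhds hi)).filter_mono
        nhdsWithin_le_nhds
    have h2 : ∀ᶠ t in 𝓝[>] s, t ∈ Ioo s 1 := Ioo_mem_nhdsGT hs1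
    obtain ⟨t, ht1, ht2⟩ := (h1.and h2).exists
    have : t ∈ A := ⟨⟨hs.1.1.trans ht2.1.le, ht2.2.le⟩, subset_closure (interior_subset ht1)⟩
    exact absurd (le_csSup hAb this) (not_le.2 ht2.1)
  refine ⟨s, lt_of_le_of_ne hs.1.1 ?_, hs1, hp, hpi⟩
  intro e
  rw [← e, scl_zero] at hpi
  exact hpi T.dom.origin_mem

theorem ev_neg_of_scl_zero {l : ℝ × ℂ} {q : CDisc} {s : ℝ} (hs : 0 < s) (hs1 : s < 1)
    (h0 : 0 < ev l origin) (h : ev l (scl s q) ≤ 0) : ev l q < 0 := by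
  rw [ev_scl hs.le hs1.le] at h
  have hq' := CDisc.norm_le q
  have : s * ‖(q : ℂ)‖ ^ 2 < 1 := by
    have := norm_nonneg (q : ℂ)
    have : ‖(q : ℂ)‖ ^ 2 ≤ 1 := by nlinarith
    nlinarith
  have h3 : 0 < ev l origin * ((1 - s) * (1 - s * ‖(q : ℂ)‖ ^ 2)) :=
    mul_pos h0 (mul_pos (by linarith) (by linarith))
  by_contra hcon
  push Not at hcon
  have := mul_nonneg hs.le hcon
  linarith

/-- A point off `R` is separated from the origin by a wall. -/
theorem exists_wall_of_not_mem (T : Tiling G R) {q : CDisc} (hq : q ∈ openDisc) (hqR : q ∉ R) :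
    ∃ L ∈ walls G R, ∃ l, Defines l L ∧ 0 < ev l origin ∧ ev l q < 0 := by
  obtain ⟨s, hs0, hs1, hp, hpi⟩ := T.exit_point hq hqR
  obtain ⟨L, hL, hpL, hLN⟩ := T.even (scl s q) ⟨1, G.one_mem, scl s q, ⟨hp, hpi⟩, rfl⟩
  have hW : L ∈ walls G R := ⟨hL, hLN⟩
  have key : ∀ l, Defines l L → 0 < ev l origin → ev l q < 0 := fun l hl h0 =>
    ev_neg_of_scl_zero hs0 hs1 h0 ((hl.2 _ (T.dom.subset_disc hp)).2 hpL).le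
  obtain ⟨l, hl⟩ := hL.exists_defines
  rcases lt_or_gt_of_ne (T.ev_origin_ne hW hl) with h | h
  · have h' : 0 < ev (-l) origin := by rw [ev_neg]; linarith
    exact ⟨L, hW, -l, hl.neg, h', key _ hl.neg h'⟩
  · exact ⟨L, hW, l, hl, h, key _ hl h⟩

theorem exists_wall_of_not_mem_tile (T : Tiling G R) {g : Equiv.Perm CDisc} (hg : g ∈ G) {q : CDisc}
    (hq : q ∈ openDisc) (hqR : q ∉ g '' R) :
    ∃ L ∈ walls G R, ∃ l, Defines l L ∧ 0 < ev l (g origin) ∧ ev l q < 0 := by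
  obtain ⟨y, rfl⟩ := g.surjective q
  obtain ⟨L, hL, l, hl, h0, h1⟩ := T.exists_wall_of_not_mem ((T.moeb g hg).mem_openDisc.1 hq)
    (fun h => hqR (mem_image_of_mem g h))
  obtain ⟨l', hl', hs⟩ := hl.push (T.moeb g hg)
  obtain ⟨m, hm, e⟩ := hs origin
  obtain ⟨m', hm', e'⟩ := hs y
  exact ⟨_, T.image_wall hL hg, l', hl', by rw [e]; positivity, by rw [e']; exact mul_neg_of_pos_of_neg hm' h1⟩

theorem mem_sep_iff {L : Set CDisc} (hL : L ∈ walls G R) {l : ℝ × ℂ} (hl : Defines l L)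
    (g h : Equiv.Perm CDisc) : L ∈ sep G R g h ↔ ev l (g origin) * ev l (h origin) < 0 := by
  constructor
  · rintro ⟨-, l', hl', h1, h2⟩
    obtain ⟨r, hr, rfl⟩ := hl.unique hL.1 hl'
    rw [ev_smul] at h1 h2
    have h3 : r ^ 2 * (ev l (g origin) * ev l (h origin)) < 0 := by
      have := mul_neg_of_neg_of_pos h1 h2
      linarith
    have hr2 : 0 < r ^ 2 := by positivity
    exact (pos_iff_neg_of_mul_neg h3).1 hr2
  · intro h3
    rcases mul_neg_iff.1 h3 with ⟨h1, h2⟩ | ⟨h1, h2⟩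
    · exact ⟨hL, -l, hl.neg, by rw [ev_neg]; linarith, by rw [ev_neg]; linarith⟩
    · exact ⟨hL, l, hl, h1, h2⟩

theorem sep_comm (g h : Equiv.Perm CDisc) : sep G R g h = sep G R h g := by
  ext L
  constructor <;> rintro ⟨hL, l, hl, h1, h2⟩ <;>
    exact ⟨hL, -l, hl.neg, by rw [ev_neg]; linarith, by rw [ev_neg]; linarith⟩

theorem sep_self (g : Equiv.Perm CDisc) : sep G R g g = ∅ := by
  ext L
  simp only [mem_empty_iff_false, iff_false]
  rintro ⟨-, l, -, h1, h2⟩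
  linarith

/-- Tile centres lie on no wall. Together with `not_mem_sep` this makes `sep G R g k` the symmetric
difference of `sep G R g h` and `sep G R h k`. -/
theorem sep_trans (T : Tiling G R) {g h k : Equiv.Perm CDisc} (hh : h ∈ G) {L : Set CDisc}
    (hL : L ∈ sep G R g k) : L ∈ sep G R g h ∨ L ∈ sep G R h k := by
  obtain ⟨hL, l, hl, h1, h2⟩ := hL
  rcases lt_or_gt_of_ne (T.ev_centre_ne hL hl hh) with h | h
  · exact Or.inr ⟨hL, l, hl, h, h2⟩
  · exact Or.inl ⟨hL, l, hl, h1, h⟩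

theorem not_mem_sep {g h k : Equiv.Perm CDisc} {L : Set CDisc}
    (h1 : L ∈ sep G R g h) (h2 : L ∈ sep G R h k) : L ∉ sep G R g k := by
  obtain ⟨hL, l, hl, a1, a2⟩ := h1
  rw [mem_sep_iff hL hl] at h2 ⊢
  have : ev l (k origin) < 0 := by
    by_contra hc
    push Not at hc
    linarith [mul_nonneg a2.le hc]
  nlinarith

theorem sep_nonempty (T : Tiling G R) {g h : Equiv.Perm CDisc} (hg : g ∈ G) (hh : h ∈ G)
    (hne : g ≠ h) : (sep G R g h).Nonempty := by
  obtain ⟨L, hL, l, hl, h1, h2⟩ := T.exists_wall_of_not_mem_tile hg (T.centre_mem_disc hh)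
    (T.not_mem_of_mem_interior hh hg hne.symm (T.centre_mem hh))
  rw [sep_comm]
  exact ⟨L, hL, l, hl, h2, h1⟩

theorem inter_subset (T : Tiling G R) {g h : Equiv.Perm CDisc} (hg : g ∈ G) (hh : h ∈ G)
    {L : Set CDisc} (hL : L ∈ sep G R g h) : g '' R ∩ h '' R ⊆ L := by
  obtain ⟨hL, l, hl, h1, h2⟩ := hL
  rintro x ⟨hx, hx'⟩
  rw [← hl.2 x (T.tile_subset hg hx)]
  exact le_antisymm (T.ev_nonpos hL hl hg h1 (subset_closure hx))
    (T.ev_nonneg hL hl hh h2 (subset_closure hx'))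

theorem image_mem_sep_iff (T : Tiling G R) {k : Equiv.Perm CDisc} (hk : k ∈ G)
    {g h : Equiv.Perm CDisc} {L : Set CDisc} :
    k '' L ∈ sep G R (k * g) (k * h) ↔ L ∈ sep G R g h := by
  have key : ∀ {k : Equiv.Perm CDisc}, k ∈ G → ∀ {g h : Equiv.Perm CDisc} {L : Set CDisc},
      L ∈ sep G R g h → k '' L ∈ sep G R (k * g) (k * h) := by
    rintro k hk g h L ⟨hL, l, hl, h1, h2⟩
    obtain ⟨l', hl', hs⟩ := hl.push (T.moeb k hk)
    refine ⟨T.image_wall hL hk, l', hl', ?_, ?_⟩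
    · obtain ⟨m, hm, e⟩ := hs (g origin)
      rw [Equiv.Perm.mul_apply, e]; exact mul_neg_of_pos_of_neg hm h1
    · obtain ⟨m, hm, e⟩ := hs (h origin)
      rw [Equiv.Perm.mul_apply, e]; exact mul_pos hm h2
  refine ⟨fun h' => ?_, key hk⟩
  have := key (G.inv_mem hk) h'
  rwa [inv_mul_cancel_left, inv_mul_cancel_left, ← image_comp, ← Equiv.Perm.coe_mul, inv_mul_cancel,
    Equiv.Perm.coe_one, image_id] at this

theorem sep_mul_left (T : Tiling G R) {k : Equiv.Perm CDisc} (hk : k ∈ G)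
    (g h : Equiv.Perm CDisc) : sep G R (k * g) (k * h) = image k '' sep G R g h := by
  ext L
  constructor
  · intro hL
    refine ⟨⇑(k⁻¹) '' L, ?_, ?_⟩
    · rw [← T.image_mem_sep_iff hk, ← image_comp, ← Equiv.Perm.coe_mul, mul_inv_cancel,
        Equiv.Perm.coe_one, image_id]
      exact hL
    · rw [← image_comp, ← Equiv.Perm.coe_mul, mul_inv_cancel, Equiv.Perm.coe_one, image_id]
  · rintro ⟨L, hL, rfl⟩
    exact (T.image_mem_sep_iff hk).2 hL

/-! ### Local finiteness of tiles and walls. -/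

/-- The elements of `G` whose tiles meet a given disc. -/
def meeting (G : Subgroup (Equiv.Perm CDisc)) (R : Set CDisc) (r : ℝ) : Set (Equiv.Perm CDisc) :=
  {g | g ∈ G ∧ (g '' R ∩ disc r).Nonempty}

theorem finite_meeting (T : Tiling G R) {r : ℝ} (hr : r < 1) : (meeting G R r).Finite :=
  T.dom.locallyFinite _ (isCompact_disc r) (disc_subset hr)

theorem exists_between_norm {z : CDisc} (hz : z ∈ openDisc) : ∃ r, ‖(z : ℂ)‖ < r ∧ r < 1 :=
  exists_between hz

/-- Arbitrarily near a boundary point of a tile there are points of other tiles. Only finitely many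
tiles are involved and each is closed in the disc, so one of them contains the point itself. -/
theorem exists_two_tiles (T : Tiling G R) {z : CDisc} (hz : z ∈ net G R) :
    ∃ g ∈ G, ∃ h ∈ G, g ≠ h ∧ z ∈ g '' R ∧ z ∈ h '' R := by
  obtain ⟨k, hk, y, ⟨hy, hyi⟩, rfl⟩ := hz
  suffices ∃ h ∈ G, h ≠ 1 ∧ y ∈ h '' R by
    obtain ⟨h, hh, h1, x, hx, e⟩ := this
    exact ⟨k, hk, k * h, G.mul_mem hk hh, fun e => h1 (left_eq_mul.1 e), mem_image_of_mem k hy,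
      x, hx, by rw [Equiv.Perm.mul_apply, e]⟩
  have hyD := T.dom.subset_disc hy
  obtain ⟨r, hyr, hr⟩ := exists_between_norm hyD
  set U : Set CDisc := ⋃ h ∈ meeting G R r \ {1}, h '' R with hU
  have hcl : y ∈ closure U := by
    rw [mem_closure_iff]
    intro O hO hyO
    have hO' : IsOpen (O ∩ {z : CDisc | ‖(z : ℂ)‖ < r}) :=
      hO.inter (isOpen_lt (by fun_prop) continuous_const)
    have : ¬ (O ∩ {z : CDisc | ‖(z : ℂ)‖ < r}) ⊆ R := fun hs =>
      hyi (mem_interior.2 ⟨_, hs, hO', hyO, hyr⟩)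
    obtain ⟨w, ⟨hwO, hwr⟩, hwR⟩ := not_subset.1 this
    have hwr' : ‖(w : ℂ)‖ < r := hwr
    obtain ⟨g, hg, hwg⟩ := T.dom.covers w (lt_trans hwr' hr)
    refine ⟨w, hwO, mem_biUnion (x := g) ⟨⟨hg, w, hwg, hwr'.le⟩, ?_⟩ hwg⟩
    rintro rfl
    apply hwR
    simpa using hwg
  rw [hU, ((T.finite_meeting hr).subset sdiff_subset).closure_biUnion] at hcl
  obtain ⟨h, hh, hyh⟩ := mem_iUnion₂.1 hcl
  exact ⟨h, hh.1.1, hh.2, T.tile_closed hh.1.1 hyh hyD⟩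

/-- A line contained in `N` contains a nontrivial piece of the intersection of two tiles near each
of its points. -/
theorem exists_pair (T : Tiling G R) {L : Set CDisc} (hL : L ∈ walls G R) {z : CDisc} (hz : z ∈ L)
    {r : ℝ} (hzr : ‖(z : ℂ)‖ < r) (hr : r < 1) :
    ∃ g ∈ meeting G R r, ∃ h ∈ meeting G R r, g ≠ h ∧ ∃ x ∈ L, ∃ y ∈ L, x ≠ y ∧
      x ∈ g '' R ∩ h '' R ∧ y ∈ g '' R ∩ h '' R := by
  obtain ⟨⟨γ, hγ, rfl⟩, hN⟩ := hL
  obtain ⟨t₀, rfl⟩ := hz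
  have hopen : IsOpen {t | ‖(γ t : ℂ)‖ < r} := by
    have := hγ.continuous
    exact isOpen_lt (by fun_prop) continuous_const
  have hinf : {t | ‖(γ t : ℂ)‖ < r}.Infinite := infinite_of_mem_nhds t₀ (hopen.mem_nhds hzr)
  have hex : ∀ t, ∃ p : Equiv.Perm CDisc × Equiv.Perm CDisc, p.1 ∈ G ∧ p.2 ∈ G ∧ p.1 ≠ p.2 ∧
      γ t ∈ p.1 '' R ∧ γ t ∈ p.2 '' R := by
    intro t
    obtain ⟨g, hg, h, hh, h1, h2, h3⟩ := T.exists_two_tiles (hN ⟨t, rfl⟩)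
    exact ⟨(g, h), hg, hh, h1, h2, h3⟩
  choose f hf using hex
  have hmaps : MapsTo f {t | ‖(γ t : ℂ)‖ < r} (meeting G R r ×ˢ meeting G R r) := by
    intro t ht
    obtain ⟨h1, h2, -, h3, h4⟩ := hf t
    have ht' : ‖(γ t : ℂ)‖ < r := ht
    exact ⟨⟨h1, _, h3, ht'.le⟩, ⟨h2, _, h4, ht'.le⟩⟩
  -- Pigeonhole: infinitely many points of the line near `z`, finitely many pairs of tiles.
  obtain ⟨s, hs, t, ht, hst, e⟩ := hinf.exists_ne_map_eq_of_mapsTo hmaps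
    ((T.finite_meeting hr).prod (T.finite_meeting hr))
  have h2 := hf t
  rw [← e] at h2
  exact ⟨_, (hmaps hs).1, _, (hmaps hs).2, (hf s).2.2.1, γ s, ⟨s, rfl⟩, γ t, ⟨t, rfl⟩,
    fun e => hst (hγ.injective e), ⟨(hf s).2.2.2.1, (hf s).2.2.2.2⟩, ⟨h2.2.2.2.1, h2.2.2.2.2⟩⟩

/-- The walls that meet a given disc. -/
def wallsMeeting (G : Subgroup (Equiv.Perm CDisc)) (R : Set CDisc) (r : ℝ) : Set (Set CDisc) :=
  {L | L ∈ walls G R ∧ (L ∩ disc r).Nonempty}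

/-- A wall that meets the disc shares two points with the intersection of two tiles meeting a
slightly larger disc. That intersection lies in any wall separating the two tiles, so the pair of
tiles determines the wall, and there are finitely many pairs. -/
theorem finite_wallsMeeting (T : Tiling G R) {r : ℝ} (hr : r < 1) : (wallsMeeting G R r).Finite := by
  obtain ⟨r', hr', hr1⟩ := exists_between hr
  have hfin : (⋃ p ∈ {p : Equiv.Perm CDisc × Equiv.Perm CDisc |
      p ∈ meeting G R r' ×ˢ meeting G R r' ∧ p.1 ≠ p.2}, {L | L ∈ walls G R ∧
      ∃ x ∈ L, ∃ y ∈ L, x ≠ y ∧ x ∈ p.1 '' R ∩ p.2 '' R ∧ y ∈ p.1 '' R ∩ p.2 '' R}).Finite := by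
    refine Finite.biUnion (((T.finite_meeting hr1).prod (T.finite_meeting hr1)).subset
      (fun p hp => hp.1)) ?_
    rintro ⟨g, h⟩ ⟨⟨hg, hh⟩, hne⟩
    obtain ⟨M, hM⟩ := T.sep_nonempty hg.1 hh.1 hne
    have hsub := T.inter_subset hg.1 hh.1 hM
    apply (finite_singleton M).subset
    rintro L ⟨hL, x, hx, y, hy, hxy, hx', hy'⟩
    exact hL.1.eq_of_two hM.1.1 hxy hx hy (hsub hx') (hsub hy')
  refine hfin.subset ?_
  rintro L ⟨hL, z, hz, hzr⟩
  obtain ⟨g, hg, h, hh, hne, hxy⟩ := T.exists_pair hL hz (lt_of_le_of_lt hzr hr') hr1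
  exact mem_biUnion (x := (g, h)) ⟨⟨hg, hh⟩, hne⟩ ⟨hL, hxy⟩

theorem sep_one_subset {h : Equiv.Perm CDisc} :
    sep G R 1 h ⊆ wallsMeeting G R ‖((h origin : CDisc) : ℂ)‖ := by
  rintro L ⟨hL, l, hl, h1, h2⟩
  refine ⟨hL, ?_⟩
  rw [Equiv.Perm.one_apply] at h1
  obtain ⟨s, hs0, hs1, e⟩ := exists_zero_scl (l := -l) (z := h origin) (by rw [ev_neg]; linarith)
    (by rw [ev_neg]; linarith)
  have hn := norm_scl hs0.le hs1 (h origin)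
  have hD : scl s (h origin) ∈ openDisc := by
    change ‖_‖ < 1
    rcases hs1.lt_or_eq with h' | h'
    · exact scl_mem hs0.le h' _
    · exfalso
      rw [h', scl_one, ev_neg] at e
      linarith
  refine ⟨_, (hl.neg.2 _ hD).1 e, ?_⟩
  change ‖_‖ ≤ _
  rw [hn]
  exact mul_le_of_le_one_left (norm_nonneg _) hs1

theorem finite_sep_one (T : Tiling G R) {h : Equiv.Perm CDisc} (hh : h ∈ G) : (sep G R 1 h).Finite :=
  (T.finite_wallsMeeting (T.centre_mem_disc hh)).subset sep_one_subset

theorem finite_sep (T : Tiling G R) {g h : Equiv.Perm CDisc} (hg : g ∈ G) (hh : h ∈ G) :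
    (sep G R g h).Finite := by
  refine ((T.finite_sep_one hg).union (T.finite_sep_one hh)).subset fun L hL => ?_
  rcases T.sep_trans G.one_mem hL with h | h
  · left; rwa [sep_comm]
  · right; exact h

/-- Near a point `p` of `R` only the walls through `p` can separate points from the origin. -/
theorem eventually_pos (T : Tiling G R) {p : CDisc} (hp : p ∈ R) :
    ∃ δ > 0, ∀ x : CDisc, dist x p < δ → x ∈ openDisc ∧
      ∀ L ∈ walls G R, p ∉ L → ∀ l, Defines l L → 0 < ev l origin → 0 < ev l x := by
  have hpD := T.dom.subset_disc hp
  obtain ⟨r, hpr, hr⟩ := exists_between_norm hpD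
  have hF := T.finite_wallsMeeting hr
  have hev : ∀ᶠ x : CDisc in 𝓝 p, ‖(x : ℂ)‖ < r ∧ ∀ L ∈ wallsMeeting G R r, p ∉ L → x ∉ L := by
    refine Filter.Eventually.and ?_ ?_
    · exact (isOpen_lt (by fun_prop) continuous_const).mem_nhds hpr
    · rw [hF.eventually_all]
      intro L hL
      by_cases hpL : p ∈ L
      · exact Eventually.of_forall fun x h => absurd hpL h
      · obtain ⟨l, hl⟩ := hL.1.1.exists_defines
        have h0 : ev l p ≠ 0 := fun e => hpL ((hl.2 p hpD).1 e)
        have := (continuous_ev l).continuousAt.eventually_ne h0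
        filter_upwards [this] with x hx _ hxL
        exact hx ((hl.2 x (hL.1.1.subset hxL)).2 hxL)
  obtain ⟨δ, hδ, hb⟩ := Metric.eventually_nhds_iff.1 hev
  refine ⟨δ, hδ, fun x hx => ⟨lt_trans (hb hx).1 hr, fun L hL hpL l hl h0 => ?_⟩⟩
  by_contra hneg
  push Not at hneg
  have hp0 : 0 < ev l p := by
    have h1 : 0 ≤ ev l p := T.ev_nonneg hL hl G.one_mem h0 (by simpa using subset_closure hp)
    refine lt_of_le_of_ne h1 fun e => hpL ((hl.2 p hpD).1 e.symm)
  -- A change of sign between `p` and `x` would produce a point of `L` on the Euclidean segment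
  -- between them, still within `δ` of `p`, where walls that miss `p` are absent.
  have hcv : Convex ℝ (Metric.closedBall (0 : ℂ) 1) := convex_closedBall _ _
  set f : ℝ → ℂ := fun t => AffineMap.lineMap (p : ℂ) (x : ℂ) t with hf
  have hfc : Continuous f := AffineMap.lineMap_continuous
  have hmem : ∀ t ∈ Icc (0 : ℝ) 1, f t ∈ Metric.closedBall (0 : ℂ) 1 := fun t ht =>
    hcv.lineMap_mem p.2 x.2 ht
  have hcont : ContinuousOn (fun t : ℝ => l.1 * (1 + ((f t).re ^ 2 + (f t).im ^ 2))
      + 2 * (l.2.re * (f t).re + l.2.im * (f t).im)) (Icc 0 1) := by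
    have h1 : Continuous fun t => (f t).re := Complex.continuous_re.comp hfc
    have h2 : Continuous fun t => (f t).im := Complex.continuous_im.comp hfc
    exact Continuous.continuousOn (by fun_prop)
  have hivt := intermediate_value_Icc' zero_le_one hcont
  simp only [hf, AffineMap.lineMap_apply_zero, AffineMap.lineMap_apply_one] at hivt
  obtain ⟨t, ht, e⟩ := hivt ⟨hneg, hp0.le⟩
  set y : CDisc := ⟨f t, hmem t ht⟩ with hy
  have hy0 : ev l y = 0 := e
  have hyd : dist y p < δ := by
    refine lt_of_le_of_lt ?_ hx
    rw [Subtype.dist_eq, Subtype.dist_eq]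
    change dist (AffineMap.lineMap (p : ℂ) (x : ℂ) t) _ ≤ _
    rw [dist_lineMap_left, Real.norm_of_nonneg ht.1, dist_comm (p : ℂ)]
    exact mul_le_of_le_one_left dist_nonneg ht.2
  have hyr := (hb hyd).1
  have hyL : y ∈ L := (hl.2 y (lt_trans hyr hr)).1 hy0
  exact (hb hyd).2 L ⟨hL, y, hyL, hyr.le⟩ hpL hyL

/-! ### Sides, their walls, and generation of the group by side pairings. -/

/-- The wall that contains the side of `R` with exterior label `e`. -/
def sideWall (G : Subgroup (Equiv.Perm CDisc)) (R : Set CDisc) (e : Equiv.Perm CDisc) : Set CDisc :=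
  ⋃₀ sep G R 1 e

/-- Every wall between `R` and `e R` contains the side, and two points determine a line: crossing a
side crosses exactly one wall. -/
theorem sep_side (T : Tiling G R) {e : Equiv.Perm CDisc} (he : e ∈ sidePairings G R) :
    sep G R 1 e = {sideWall G R e} := by
  obtain ⟨heG, he1, x, hx, y, hy, hxy⟩ := he
  obtain ⟨L, hL⟩ := T.sep_nonempty G.one_mem heG he1.symm
  have hsub : ∀ M ∈ sep G R 1 e, side R e ⊆ M := fun M hM => by
    have := T.inter_subset G.one_mem heG hM
    simpa [side] using this
  have : sep G R 1 e = {L} := by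
    ext M
    constructor
    · intro hM
      exact hM.1.1.eq_of_two hL.1.1 hxy (hsub M hM hx) (hsub M hM hy) (hsub L hL hx) (hsub L hL hy)
    · rintro rfl; exact hL
  rw [sideWall, this, sUnion_singleton]

theorem sideWall_mem (T : Tiling G R) {e : Equiv.Perm CDisc} (he : e ∈ sidePairings G R) :
    sideWall G R e ∈ sep G R 1 e := by rw [T.sep_side he]; rfl

theorem sideWall_mem_walls (T : Tiling G R) {e : Equiv.Perm CDisc} (he : e ∈ sidePairings G R) :
    sideWall G R e ∈ walls G R := (T.sideWall_mem he).1

theorem side_subset (T : Tiling G R) {e : Equiv.Perm CDisc} (he : e ∈ sidePairings G R) :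
    side R e ⊆ sideWall G R e := by
  have := T.inter_subset G.one_mem he.1 (T.sideWall_mem he)
  simpa [side] using this

theorem sep_step (T : Tiling G R) {e : Equiv.Perm CDisc} (he : e ∈ sidePairings G R)
    {k : Equiv.Perm CDisc} (hk : k ∈ G) : sep G R k (k * e) = {k '' sideWall G R e} := by
  have := T.sep_mul_left hk 1 e
  rw [mul_one, T.sep_side he, image_singleton] at this
  exact this

theorem eq_of_sep_eq (T : Tiling G R) {g h k : Equiv.Perm CDisc} (hg : g ∈ G) (hh : h ∈ G)
    (hk : k ∈ G) (he : sep G R k g = sep G R k h) : g = h := by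
  by_contra hne
  obtain ⟨L, hL⟩ := T.sep_nonempty hg hh hne
  rcases T.sep_trans hk hL with h1 | h1
  · rw [sep_comm, he] at h1
    exact not_mem_sep (by rw [sep_comm, he]; exact h1) h1 hL
  · rw [← he] at h1
    exact not_mem_sep (by rw [sep_comm]; exact h1) (by rw [← he]; exact h1) hL

theorem sideWall_injOn (T : Tiling G R) : InjOn (sideWall G R) (sidePairings G R) := by
  intro e he e' he' h
  exact T.eq_of_sep_eq he.1 he'.1 G.one_mem (by rw [T.sep_side he, T.sep_side he', h])

/-- Two distinct lines that cross at `p` cut out four quadrants near `p`. -/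
theorem exists_quadrant_point {L M : Set CDisc} (hL : IsGeodesicLine L) (hM : IsGeodesicLine M)
    (hne : L ≠ M) {p : CDisc} (hpL : p ∈ L) (hpM : p ∈ M) {l m : ℝ × ℂ} (hl : Defines l L)
    (hm : Defines m M) (h0 : ev m origin ≠ 0) {δ : ℝ} (hδ : 0 < δ) :
    ∃ x : CDisc, dist x p < δ ∧ ev l x < 0 ∧ 0 < ev m x := by
  obtain ⟨γ, hγ, rfl⟩ := hM
  obtain ⟨t₀, ht₀⟩ := hpM
  subst ht₀
  obtain ⟨_, _, _, _, _, _, _, hs⟩ := hγ.sign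
  obtain ⟨P, Q, hPQ, -⟩ := hs l
  have hz : P * Real.exp (2 * t₀) + Q = 0 := by
    obtain ⟨c, hc, e⟩ := hPQ t₀
    rw [(hl.2 _ (hγ.1 t₀)).2 hpL] at e
    exact (mul_eq_zero.1 e.symm).resolve_left hc.ne'
  have hP : P ≠ 0 := by
    rintro rfl
    have hQ : Q = 0 := by linarith
    have hall : ∀ t, γ t ∈ L := by
      intro t
      obtain ⟨c, hc, e⟩ := hPQ t
      rw [← hl.2 _ (hγ.1 t), e, hQ]; ring
    exact hne (hL.eq_of_two ⟨γ, hγ, rfl⟩ (fun e => by simpa using hγ.injective e : γ 0 ≠ γ 1)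
      (hall 0) (hall 1) ⟨0, rfl⟩ ⟨1, rfl⟩)
  have hnear : ∀ᶠ t in 𝓝 t₀, dist (γ t) (γ t₀) < δ / 2 :=
    Metric.tendsto_nhds.1 (hγ.continuous.tendsto t₀) _ (by positivity)
  have hy : ∃ t, dist (γ t) (γ t₀) < δ / 2 ∧ ev l (γ t) < 0 := by
    rcases lt_or_gt_of_ne hP with hP | hP
    · obtain ⟨t, h1, h2⟩ := ((hnear.filter_mono nhdsWithin_le_nhds).and
        (self_mem_nhdsWithin : ∀ᶠ t in 𝓝[>] t₀, t ∈ Ioi t₀)).exists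
      refine ⟨t, h1, ?_⟩
      obtain ⟨c, hc, e⟩ := hPQ t
      have h3 : Real.exp (2 * t₀) < Real.exp (2 * t) := Real.exp_lt_exp.2 (by linarith)
      rw [e]
      exact mul_neg_of_pos_of_neg hc (by nlinarith)
    · obtain ⟨t, h1, h2⟩ := ((hnear.filter_mono nhdsWithin_le_nhds).and
        (self_mem_nhdsWithin : ∀ᶠ t in 𝓝[<] t₀, t ∈ Iio t₀)).exists
      refine ⟨t, h1, ?_⟩
      obtain ⟨c, hc, e⟩ := hPQ t
      have h3 : Real.exp (2 * t) < Real.exp (2 * t₀) := Real.exp_lt_exp.2 (by linarith)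
      rw [e]
      exact mul_neg_of_pos_of_neg hc (by nlinarith)
  obtain ⟨t, ht1, ht2⟩ := hy
  have hm0 : ev m (γ t) = 0 := (hm.2 _ (hγ.1 t)).2 ⟨t, rfl⟩
  have hlt : ∀ (w : CDisc) (s₀ : ℝ), scl s₀ w = γ t → ∀ F : Filter ℝ, F ≤ 𝓝 s₀ →
      ∀ᶠ s in F, dist (scl s w) (γ t₀) < δ ∧ ev l (scl s w) < 0 := by
    intro w s₀ hw F hF
    have hT : Tendsto (fun s => scl s w) F (𝓝 (γ t)) := by
      rw [← hw]; exact ((continuous_scl w).tendsto s₀).mono_left hF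
    refine Filter.Eventually.and ?_ ?_
    · filter_upwards [Metric.tendsto_nhds.1 hT _ (half_pos hδ)] with s hs
      have := dist_triangle (scl s w) (γ t) (γ t₀)
      linarith
    · exact (((continuous_ev l).tendsto _).comp hT).eventually (gt_mem_nhds ht2)
  have hn : ‖(γ t : ℂ)‖ < 1 := hγ.1 t
  -- The point `γ t` lies on `M` with `l` already negative. A small radial move makes `m` positive:
  -- outwards if `m` is negative at the origin, inwards otherwise.
  rcases lt_or_gt_of_ne h0 with h0 | h0
  · have hr : 0 < ‖(γ t : ℂ)‖ := by
      refine norm_pos_iff.2 fun e => h0.ne ?_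
      rw [← hm0]; congr 1; exact Subtype.ext e.symm
    set w : CDisc := ⟨(γ t : ℂ) / ‖(γ t : ℂ)‖, by
      rw [mem_closedBall_zero_iff, norm_div, Complex.norm_real, norm_norm, div_self hr.ne']⟩ with hw
    have hrc : (‖(γ t : ℂ)‖ : ℂ) ≠ 0 := by exact_mod_cast hr.ne'
    have hsw : scl ‖(γ t : ℂ)‖ w = γ t := by
      apply Subtype.ext
      rw [scl_coe hr.le hn.le, hw]
      field_simp
    obtain ⟨s, ⟨hs1, hs2⟩, hs3⟩ := ((hlt w _ hsw (𝓝[>] _) nhdsWithin_le_nhds).and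
      (Ioo_mem_nhdsGT hn)).exists
    have hs0 : 0 < s := hr.trans hs3.1
    refine ⟨scl s w, hs1, hs2, ?_⟩
    have e : scl (‖(γ t : ℂ)‖ / s) (scl s w) = γ t := (scl_div hr hs3.1.le hs3.2.le w).trans hsw
    have := ev_neg_of_scl_zero (l := -m) (div_pos hr hs0) (by rw [div_lt_one hs0]; exact hs3.1)
      (q := scl s w) (by rw [ev_neg]; linarith) (by rw [e, ev_neg, hm0, neg_zero])
    rw [ev_neg] at this
    linarith
  · obtain ⟨s, ⟨hs1, hs2⟩, hs3⟩ := ((hlt (γ t) 1 (scl_one _) (𝓝[<] 1) nhdsWithin_le_nhds).and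
      (Ioo_mem_nhdsLT (show (0 : ℝ) < 1 by norm_num))).exists
    refine ⟨scl s (γ t), hs1, hs2, ?_⟩
    rw [ev_scl hs3.1.le hs3.2.le, hm0, mul_zero, zero_add]
    have := norm_nonneg (γ t : ℂ)
    have : s * ‖(γ t : ℂ)‖ ^ 2 < 1 := by nlinarith [hs3.1, hs3.2]
    exact mul_pos h0 (mul_pos (by linarith [hs3.2]) (by linarith))

theorem exists_defines_pos (T : Tiling G R) {L : Set CDisc} (hL : L ∈ walls G R)
    {g : Equiv.Perm CDisc} (hg : g ∈ G) : ∃ l, Defines l L ∧ 0 < ev l (g origin) := by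
  obtain ⟨l, hl⟩ := hL.1.exists_defines
  rcases lt_or_gt_of_ne (T.ev_centre_ne hL hl hg) with h | h
  · exact ⟨-l, hl.neg, by rw [ev_neg]; linarith⟩
  · exact ⟨l, hl, h⟩

theorem mem_sep_one_iff {L : Set CDisc} (hL : L ∈ walls G R) {l : ℝ × ℂ} (hl : Defines l L)
    (h0 : 0 < ev l origin) (h : Equiv.Perm CDisc) : L ∈ sep G R 1 h ↔ ev l (h origin) < 0 := by
  rw [mem_sep_iff hL hl, Equiv.Perm.one_apply, mul_neg_iff]
  constructor
  · rintro (h | h)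
    · exact h.2
    · linarith [h.1]
  · exact fun h => Or.inl ⟨h0, h⟩

/-- The set of walls through `p` that separate a tile at a nearby point from `R`. -/
theorem sep_of_near (T : Tiling G R) {p : CDisc} {x : CDisc}
    (hx : ∀ L ∈ walls G R, p ∉ L → ∀ l, Defines l L → 0 < ev l origin → 0 < ev l x)
    {j : Equiv.Perm CDisc} (hj : j ∈ G) (hxj : x ∈ j '' R) {L : Set CDisc} (hL : L ∈ sep G R 1 j) :
    p ∈ L := by
  by_contra hpL
  obtain ⟨l, hl, h0⟩ := T.exists_defines_pos hL.1 G.one_mem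
  have h1 := (mem_sep_one_iff hL.1 hl h0 j).1 hL
  have h2 := T.ev_nonpos hL.1 hl hj h1 (subset_closure hxj)
  linarith [hx L hL.1 hpL l hl h0]

/-- Every tile other than `R` is separated from `R` by the wall of a side of `R`. -/
theorem exists_sideWall_mem_sep (T : Tiling G R) {h : Equiv.Perm CDisc} (hh : h ∈ G) (h1 : h ≠ 1) :
    ∃ e ∈ sidePairings G R, sideWall G R e ∈ sep G R 1 h := by
  set S : Set (Equiv.Perm CDisc) := {k | k ∈ G ∧ k ≠ 1 ∧ sep G R 1 k ⊆ sep G R 1 h} with hS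
  have hSne : S.Nonempty := ⟨h, hh, h1, subset_rfl⟩
  -- Choose a tile other than `R` behind as few walls as possible, all of them among the walls in
  -- front of `h`. The radius to its centre will leave `R` inside a side, not at a vertex.
  obtain ⟨k, hk, hmin⟩ : ∃ k ∈ S, ∀ j ∈ S, (sep G R 1 k).ncard ≤ (sep G R 1 j).ncard := by
    obtain ⟨k, hk, e⟩ := WellFounded.has_min (measure fun k => (sep G R 1 k).ncard).wf S hSne
    exact ⟨k, hk, fun j hj => not_lt.1 (e j hj)⟩
  set q := k origin with hqdef
  have hqD : q ∈ openDisc := T.centre_mem_disc hk.1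
  have hqR : q ∉ R := by
    have := T.not_mem_of_mem_interior hk.1 G.one_mem hk.2.1 (T.centre_mem hk.1)
    simpa using this
  obtain ⟨s, hs0, hs1, hp, hpi⟩ := T.exit_point hqD hqR
  set p := scl s q with hpdef
  have hpD := T.dom.subset_disc hp
  obtain ⟨M, hM, hpM, hMN⟩ := T.even p ⟨1, G.one_mem, p, ⟨hp, hpi⟩, rfl⟩
  have hMW : M ∈ walls G R := ⟨hM, hMN⟩
  have hthrough : ∀ L ∈ walls G R, p ∈ L → L ∈ sep G R 1 k := by
    intro L hL hpL
    obtain ⟨l, hl, h0⟩ := T.exists_defines_pos hL G.one_mem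
    rw [mem_sep_one_iff hL hl h0]
    exact ev_neg_of_scl_zero hs0 hs1 h0 ((hl.2 p hpD).2 hpL).le
  obtain ⟨δ, hδ, hnear⟩ := T.eventually_pos hp
  -- If two walls passed through the exit point, a tile near `p` behind `L` but not behind `M` would
  -- lie behind strictly fewer walls than `k`, against minimality.
  have honly : ∀ L ∈ walls G R, p ∈ L → L = M := by
    intro L hL hpL
    by_contra hne
    obtain ⟨l, hl, hl0⟩ := T.exists_defines_pos hL G.one_mem
    obtain ⟨m, hm, hm0⟩ := T.exists_defines_pos hMW G.one_mem
    obtain ⟨x, hxd, hxl, hxm⟩ := exists_quadrant_point hL.1 hM hne hpL hpM hl hm (ne_of_gt hm0) hδ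
    obtain ⟨hxD, hxw⟩ := hnear x hxd
    obtain ⟨j, hj, hxj⟩ := T.dom.covers x hxD
    have hLj : L ∈ sep G R 1 j := by
      rw [mem_sep_one_iff hL hl hl0]
      by_contra hc
      push Not at hc
      have := T.ev_nonneg hL hl hj (lt_of_le_of_ne hc (T.ev_centre_ne hL hl hj).symm)
        (subset_closure hxj)
      linarith
    have hMj : M ∉ sep G R 1 j := by
      rw [mem_sep_one_iff hMW hm hm0]
      intro hc
      have := T.ev_nonpos hMW hm hj hc (subset_closure hxj)
      linarith
    have hsub : sep G R 1 j ⊆ sep G R 1 k := fun L' hL' =>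
      hthrough L' hL'.1 (T.sep_of_near hxw hj hxj hL')
    have hjS : j ∈ S := by
      refine ⟨hj, ?_, hsub.trans hk.2.2⟩
      rintro rfl
      rw [sep_self] at hLj
      exact hLj
    have hlt : (sep G R 1 j).ncard < (sep G R 1 k).ncard :=
      ncard_lt_ncard (ssubset_iff_of_subset hsub |>.2 ⟨M, hthrough M hMW hpM, hMj⟩)
        (T.finite_sep_one hk.1)
    exact absurd (hmin j hjS) (not_le.2 hlt)
  obtain ⟨m, hm, hm0⟩ := T.exists_defines_pos hMW G.one_mem
  have hm00 : 0 < ev m origin := hm0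
  -- a tile just beyond `p`
  obtain ⟨x, hxd, hxm⟩ : ∃ x : CDisc, dist x p < δ ∧ ev m x < 0 := by
    have h1 : ∀ᶠ t in 𝓝[>] s, dist (scl t q) p < δ :=
      (Metric.tendsto_nhds.1 ((continuous_scl q).tendsto s) _ hδ).filter_mono nhdsWithin_le_nhds
    have h2 : ∀ᶠ t in 𝓝[>] s, t ∈ Ioo s 1 := Ioo_mem_nhdsGT hs1
    obtain ⟨t, ht1, ht2⟩ := (h1.and h2).exists
    refine ⟨_, ht1, ?_⟩
    have h0 := (hm.2 p hpD).2 hpM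
    have ht0 : 0 < t := hs0.trans ht2.1
    have e : scl (s / t) (scl t q) = p := scl_div hs0 ht2.1.le ht2.2.le q
    rw [← e] at h0
    exact ev_neg_of_scl_zero (div_pos hs0 ht0) (by rw [div_lt_one ht0]; exact ht2.1) hm00 h0.le
  obtain ⟨hxD, hxw⟩ := hnear x hxd
  obtain ⟨j, hj, hxj⟩ := T.dom.covers x hxD
  have hMj : M ∈ sep G R 1 j := by
    rw [mem_sep_one_iff hMW hm hm00]
    by_contra hc
    push Not at hc
    have := T.ev_nonneg hMW hm hj (lt_of_le_of_ne hc (T.ev_centre_ne hMW hm hj).symm)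
      (subset_closure hxj)
    linarith
  have hsep : sep G R 1 j = {M} := by
    ext L
    constructor
    · intro hL; exact honly L hL.1 (T.sep_of_near hxw hj hxj hL)
    · rintro rfl; exact hMj
  have hj1 : j ≠ 1 := by
    rintro rfl
    rw [sep_self] at hMj
    exact hMj
  -- Near `p` only `M` can separate points from `R` or from `j R`, so the piece of `M` around `p`
  -- lies in both tiles and `j` is a side pairing.
  have hmemR : ∀ y ∈ M, dist y p < δ → y ∈ side R j := by
    intro y hy hyd
    obtain ⟨hyD, hyw⟩ := hnear y hyd
    constructor
    · by_contra hyR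
      obtain ⟨L, hL, l, hl, h0, h2⟩ := T.exists_wall_of_not_mem hyD hyR
      by_cases hpL : p ∈ L
      · rw [honly L hL hpL] at hl
        exact h2.ne ((hl.2 y hyD).2 hy)
      · linarith [hyw L hL hpL l hl h0]
    · by_contra hyR
      obtain ⟨L, hL, l, hl, h0, h2⟩ := T.exists_wall_of_not_mem_tile hj hyD hyR
      by_cases hpL : p ∈ L
      · rw [honly L hL hpL] at hl
        exact h2.ne ((hl.2 y hyD).2 hy)
      · have hLj : L ∉ sep G R 1 j := by
          rw [hsep]
          rintro rfl
          exact hpL hpM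
        rw [mem_sep_iff hL hl, Equiv.Perm.one_apply] at hLj
        have h3 : 0 < ev l origin := by
          refine lt_of_le_of_ne ?_ (T.ev_origin_ne hL hl).symm
          by_contra hc
          push Not at hc
          exact hLj (mul_neg_of_neg_of_pos hc h0)
        linarith [hyw L hL hpL l hl h3]
  refine ⟨j, ⟨hj, hj1, ?_⟩, ?_⟩
  · obtain ⟨γ, hγ, rfl⟩ := hM
    obtain ⟨t₀, ht₀⟩ := hpM
    have hev : ∀ᶠ t in 𝓝[>] t₀, dist (γ t) (γ t₀) < δ :=
      (Metric.tendsto_nhds.1 (hγ.continuous.tendsto t₀) _ hδ).filter_mono nhdsWithin_le_nhds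
    obtain ⟨t, h1, h2⟩ := (hev.and self_mem_nhdsWithin).exists
    rw [ht₀] at h1
    refine ⟨γ t, hmemR _ ⟨t, rfl⟩ h1, γ t₀, hmemR _ ⟨t₀, rfl⟩ (by rw [ht₀, dist_self]; exact hδ), ?_⟩
    intro e
    exact (ne_of_gt h2) (hγ.injective e)
  · rw [sideWall, hsep, sUnion_singleton]
    exact hk.2.2 (hthrough M hMW hpM)

/-- `R` is the intersection of the half planes of its sides. -/
theorem exists_side_of_not_mem (T : Tiling G R) {q : CDisc} (hq : q ∈ openDisc) (hqR : q ∉ R) :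
    ∃ e ∈ sidePairings G R, ∃ l, Defines l (sideWall G R e) ∧ 0 < ev l origin ∧ ev l q < 0 := by
  -- A closed tile at `q` would give only a weak inequality. Using a tile at a point slightly closer
  -- to the origin, still off `R`, makes it strict at `q`.
  have hopen : IsOpen (openDisc ∩ (closure R)ᶜ) := isOpen_openDisc.inter isClosed_closure.isOpen_compl
  have hmem : q ∈ openDisc ∩ (closure R)ᶜ := ⟨hq, fun h => hqR (T.dom.isClosed ⟨h, hq⟩)⟩
  have h1 := (tendsto_scl_one q).eventually (hopen.mem_nhds hmem)
  have h3 : ∀ᶠ s in 𝓝[<] (1 : ℝ), s ∈ Ioo (0 : ℝ) 1 := Ioo_mem_nhdsLT (by norm_num)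
  obtain ⟨s, hs1, hs2⟩ := (h1.and h3).exists
  obtain ⟨h, hh, hsh⟩ := T.dom.covers _ hs1.1
  have hne : h ≠ 1 := by
    rintro rfl
    exact hs1.2 (subset_closure (by simpa using hsh))
  obtain ⟨e, he, hsep⟩ := T.exists_sideWall_mem_sep hh hne
  obtain ⟨l, hl, h0⟩ := T.exists_defines_pos hsep.1 G.one_mem
  rw [mem_sep_one_iff hsep.1 hl h0] at hsep
  refine ⟨e, he, l, hl, h0, ev_neg_of_scl_zero hs2.1 hs2.2 h0
    (T.ev_nonpos (T.sideWall_mem_walls he) hl hh hsep (subset_closure hsh))⟩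

/-- Translation by `e` identifies the walls in question with those between `e` and `h`. These are
the walls between `1` and `h` with the wall of the side removed. -/
theorem ncard_sep_lt (T : Tiling G R) {h e : Equiv.Perm CDisc} (hh : h ∈ G)
    (he : e ∈ sidePairings G R) (hs : sideWall G R e ∈ sep G R 1 h) :
    (sep G R 1 (e⁻¹ * h)).ncard < (sep G R 1 h).ncard := by
  have h1 : (sep G R 1 (e⁻¹ * h)).ncard = (sep G R e h).ncard := by
    have := T.sep_mul_left he.1 1 (e⁻¹ * h)
    rw [mul_one, mul_inv_cancel_left] at this
    rw [this, ncard_image_of_injective _ (image_injective.2 e.injective)]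
  rw [h1]
  refine ncard_lt_ncard ((ssubset_iff_of_subset fun L hL => ?_).2 ⟨_, hs, fun hc => ?_⟩)
    (T.finite_sep_one hh)
  · rcases T.sep_trans G.one_mem hL with h | h
    · exfalso
      rw [sep_comm, T.sep_side he] at h
      rw [h] at hL
      exact not_mem_sep (T.sideWall_mem he) hL hs
    · exact h
  · exact not_mem_sep (T.sideWall_mem he) hc hs

/-- The side pairings generate `G`. -/
theorem mem_closure_sidePairings (T : Tiling G R) {g : Equiv.Perm CDisc} (hg : g ∈ G) :
    g ∈ Subgroup.closure (sidePairings G R) := by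
  induction hn : (sep G R 1 g).ncard using Nat.strong_induction_on generalizing g with
  | _ n ih =>
    by_cases h1 : g = 1
    · rw [h1]; exact Subgroup.one_mem _
    · obtain ⟨e, he, hs⟩ := T.exists_sideWall_mem_sep hg h1
      have := ih _ (hn ▸ T.ncard_sep_lt hg he hs) (G.mul_mem (G.inv_mem he.1) hg) rfl
      have h2 := Subgroup.mul_mem _ (Subgroup.subset_closure he) this
      rwa [mul_inv_cancel_left] at h2

end Tiling

/-! ### Finite generation implies finitely many sides. -/

theorem exists_finite_subset_closure {A : Type*} [Group A] {E : Set A} {x : A}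
    (hx : x ∈ Subgroup.closure E) : ∃ S ⊆ E, S.Finite ∧ x ∈ Subgroup.closure S := by
  induction hx using Subgroup.closure_induction with
  | mem x hx => exact ⟨{x}, by simpa using hx, finite_singleton x, Subgroup.subset_closure rfl⟩
  | one => exact ⟨∅, empty_subset _, finite_empty, Subgroup.one_mem _⟩
  | mul x y _ _ hx hy =>
    obtain ⟨S, hS, hSf, hxS⟩ := hx
    obtain ⟨S', hS', hSf', hyS⟩ := hy
    exact ⟨S ∪ S', union_subset hS hS', hSf.union hSf', Subgroup.mul_mem _
      (Subgroup.closure_mono subset_union_left hxS) (Subgroup.closure_mono subset_union_right hyS)⟩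
  | inv x _ hx =>
    obtain ⟨S, hS, hSf, hxS⟩ := hx
    exact ⟨S, hS, hSf, Subgroup.inv_mem _ hxS⟩

/-- A set of elements of `G` that is neither empty nor everything has a boundary edge in the Cayley
graph of a generating set. -/
theorem exists_boundary_edge {A : Type*} [Group A] {G : Subgroup A} {S : Set A}
    (hS : Subgroup.closure S = G) (p : A → Prop) {g h : A} (hg : g ∈ G) (hh : h ∈ G)
    (hpg : p g) (hph : ¬ p h) :
    ∃ k ∈ G, ∃ s ∈ S, (p k ∧ ¬ p (k * s)) ∨ (p (k * s) ∧ ¬ p k) := by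
  by_contra hcon
  push Not at hcon
  have key : ∀ x ∈ Subgroup.closure S, ∀ k ∈ G, (p k ↔ p (k * x)) := by
    intro x hx
    induction hx using Subgroup.closure_induction with
    | mem x hx => exact fun k hk => ⟨(hcon k hk x hx).1, (hcon k hk x hx).2⟩
    | one => intro k _; rw [mul_one]
    | mul x y hx hy ihx ihy =>
      intro k hk
      rw [hS] at hx
      rw [ihx k hk, ihy (k * x) (G.mul_mem hk hx), mul_assoc]
    | inv x hx ih =>
      intro k hk
      rw [hS] at hx
      rw [ih (k * x⁻¹) (G.mul_mem hk (G.inv_mem hx)), inv_mul_cancel_right]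
  have := (key (g⁻¹ * h) (hS ▸ G.mul_mem (G.inv_mem hg) hh) g hg).1 hpg
  rw [mul_inv_cancel_left] at this
  exact hph this

namespace Tiling

theorem exists_finite_generators (T : Tiling G R) (hfg : G.FG) :
    ∃ S ⊆ sidePairings G R, S.Finite ∧ Subgroup.closure S = G := by
  obtain ⟨F, hF⟩ := hfg
  have h1 : ∀ f ∈ F, ∃ S ⊆ sidePairings G R, S.Finite ∧ f ∈ Subgroup.closure S := fun f hf =>
    exists_finite_subset_closure (T.mem_closure_sidePairings (hF ▸ Subgroup.subset_closure hf))
  choose! S hS using h1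
  refine ⟨⋃ f ∈ F, S f, iUnion₂_subset fun f hf => (hS f hf).1,
    F.finite_toSet.biUnion fun f hf => (hS f hf).2.1, le_antisymm ?_ ?_⟩
  · rw [Subgroup.closure_le]
    exact iUnion₂_subset fun f hf => (hS f hf).1.trans fun e he => he.1
  · have : Subgroup.closure (F : Set (Equiv.Perm CDisc)) ≤ Subgroup.closure (⋃ f ∈ F, S f) := by
      rw [Subgroup.closure_le]
      intro f hf
      exact Subgroup.closure_mono (subset_biUnion_of_mem (u := S) hf) (hS f hf).2.2
    rwa [hF] at this

open Classical in
/-- A point on the side with exterior label `e`. -/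
def sidePt (R : Set CDisc) (e : Equiv.Perm CDisc) : CDisc :=
  if h : (side R e).Nonempty then h.some else origin

theorem sidePt_mem {e : Equiv.Perm CDisc} (he : e ∈ sidePairings G R) : sidePt R e ∈ side R e := by
  have h : (side R e).Nonempty := he.2.2.nonempty
  rw [sidePt, dif_pos h]
  exact h.some_mem

/-- The images on `M` of the base points of the sides with labels in `S`. -/
def sidePts (G : Subgroup (Equiv.Perm CDisc)) (R : Set CDisc) (S : Set (Equiv.Perm CDisc))
    (M : Set CDisc) : Set CDisc :=
  {x | ∃ k ∈ G, ∃ s ∈ S, k '' sideWall G R s = M ∧ x = k (sidePt R s)}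

theorem sidePts_subset (T : Tiling G R) {S : Set (Equiv.Perm CDisc)} (hSE : S ⊆ sidePairings G R)
    (M : Set CDisc) : sidePts G R S M ⊆ M := by
  rintro _ ⟨k, hk, s, hs, rfl, rfl⟩
  exact mem_image_of_mem k (T.side_subset (hSE hs) (sidePt_mem (hSE hs)))

theorem image_sidePts {S : Set (Equiv.Perm CDisc)} {M : Set CDisc} {k : Equiv.Perm CDisc}
    (hk : k ∈ G) {x : CDisc} (hx : x ∈ sidePts G R S M) : k x ∈ sidePts G R S (k '' M) := by
  obtain ⟨j, hj, s, hs, rfl, rfl⟩ := hx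
  exact ⟨k * j, G.mul_mem hk hj, s, hs, by rw [Equiv.Perm.coe_mul, image_comp], rfl⟩

theorem finite_sidePts (T : Tiling G R) {S : Set (Equiv.Perm CDisc)} (hSE : S ⊆ sidePairings G R)
    (hSf : S.Finite) {r : ℝ} (hr : r < 1) (M : Set CDisc) : (sidePts G R S M ∩ disc r).Finite := by
  have h := ((T.finite_meeting hr).prod hSf).image
    (fun p : Equiv.Perm CDisc × Equiv.Perm CDisc => p.1 (sidePt R p.2))
  refine h.subset ?_
  rintro _ ⟨⟨k, hk, s, hs, rfl, rfl⟩, hd⟩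
  exact ⟨(k, s), ⟨⟨hk, _, mem_image_of_mem k (sidePt_mem (hSE hs)).1, hd⟩, hs⟩, rfl⟩

/-- If a boundary edge leaves a set of tiles cut out by walls, it crosses one of them. -/
theorem edge_pt_mem (T : Tiling G R) {S : Set (Equiv.Perm CDisc)} (hSE : S ⊆ sidePairings G R)
    {k s : Equiv.Perm CDisc} (hk : k ∈ G) (hs : s ∈ S) {M : Set CDisc} (hM : M ∈ sep G R k (k * s)) :
    k (sidePt R s) ∈ sidePts G R S M ∧ k (sidePt R s) ∈ k '' R ∧ k (sidePt R s) ∈ (k * s) '' R := by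
  have hM' := hM
  rw [T.sep_step (hSE hs) hk, mem_singleton_iff] at hM
  refine ⟨⟨k, hk, s, hs, hM.symm, rfl⟩, mem_image_of_mem k (sidePt_mem (hSE hs)).1, ?_⟩
  rw [Equiv.Perm.coe_mul, image_comp]
  exact mem_image_of_mem k (sidePt_mem (hSE hs)).2

theorem sidePts_nonempty (T : Tiling G R) {S : Set (Equiv.Perm CDisc)} (hSE : S ⊆ sidePairings G R)
    (hSG : Subgroup.closure S = G) {M : Set CDisc} {g h : Equiv.Perm CDisc} (hg : g ∈ G) (hh : h ∈ G)
    (hM : M ∈ sep G R g h) : (sidePts G R S M).Nonempty := by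
  obtain ⟨hMW, m, hm, h1, h2⟩ := hM
  obtain ⟨k, hk, s, hs, hks⟩ := exists_boundary_edge hSG (fun k => 0 < ev m (k origin)) hh hg h2
    (not_lt.2 h1.le)
  have hsep : M ∈ sep G R k (k * s) := by
    have hne1 := T.ev_centre_ne hMW hm hk
    have hne2 := T.ev_centre_ne hMW hm (G.mul_mem hk (hSE hs).1)
    rw [mem_sep_iff hMW hm]
    rcases hks with ⟨a, b⟩ | ⟨a, b⟩
    · exact mul_neg_of_pos_of_neg a (lt_of_le_of_ne (not_lt.1 b) hne2)
    · exact mul_neg_of_neg_of_pos (lt_of_le_of_ne (not_lt.1 b) hne1) a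
  exact ⟨_, (T.edge_pt_mem hSE hk hs hsep).1⟩

/-- One of the two sides of a quadrant between two walls contains a base point of a side whose label
lies in a given set of generators. -/
theorem exists_sidePt_quadrant (T : Tiling G R) {S : Set (Equiv.Perm CDisc)}
    (hSE : S ⊆ sidePairings G R) (hSG : Subgroup.closure S = G) {L M : Set CDisc}
    (hL : L ∈ walls G R) (hM : M ∈ walls G R) (hne : L ≠ M) {v : CDisc} (hvL : v ∈ L) (hvM : v ∈ M)
    {l m : ℝ × ℂ} (hl : Defines l L) (hm : Defines m M) :
    (∃ x ∈ sidePts G R S M, 0 ≤ ev l x) ∨ (∃ x ∈ sidePts G R S L, 0 ≤ ev m x) := by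
  have hvD := hL.1.subset hvL
  have hδ : 0 < 1 - ‖(v : ℂ)‖ := by
    have : ‖(v : ℂ)‖ < 1 := hvD
    linarith
  have htile : ∀ l' : ℝ × ℂ, Defines l' L → ∃ j ∈ G, 0 < ev m (j origin) ∧ ev l' (j origin) < 0 := by
    intro l' hl'
    obtain ⟨x, hxd, hxl, hxm⟩ := exists_quadrant_point hL.1 hM.1 hne hvL hvM hl' hm
      (T.ev_origin_ne hM hm) hδ
    have hxD : x ∈ openDisc := by
      change ‖_‖ < 1
      rw [Subtype.dist_eq] at hxd
      have h1 := norm_sub_norm_le (x : ℂ) v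
      rw [dist_eq_norm] at hxd
      linarith
    obtain ⟨j, hj, hxj⟩ := T.dom.covers x hxD
    refine ⟨j, hj, ?_, ?_⟩
    · by_contra hc
      have := T.ev_nonpos hM hm hj (lt_of_le_of_ne (not_lt.1 hc) (T.ev_centre_ne hM hm hj))
        (subset_closure hxj)
      linarith
    · by_contra hc
      have := T.ev_nonneg hL hl' hj (lt_of_le_of_ne (not_lt.1 hc) (T.ev_centre_ne hL hl' hj).symm)
        (subset_closure hxj)
      linarith
  obtain ⟨g, hg, hg1, hg2⟩ := htile (-l) hl.neg
  obtain ⟨h, hh, -, hh2⟩ := htile l hl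
  rw [ev_neg, neg_lt_zero] at hg2
  -- Some tiles lie in the quadrant `l > 0`, `m > 0` and some do not, so an edge of the Cayley graph
  -- of `S` leaves it. The edge crosses `L` or `M`, and its base point lies in the closed tile at
  -- its end inside the quadrant.
  obtain ⟨k, hk, s, hs, hks⟩ := exists_boundary_edge hSG
    (fun k => 0 < ev l (k origin) ∧ 0 < ev m (k origin)) hg hh ⟨hg2, hg1⟩ (fun h => by linarith [h.1])
  have hks' : k * s ∈ G := G.mul_mem hk (hSE hs).1
  have key : ∀ a ∈ G, ∀ b ∈ G, (∀ N ∈ sep G R a b, N ∈ sep G R k (k * s)) →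
      k (sidePt R s) ∈ a '' R → (0 < ev l (a origin) ∧ 0 < ev m (a origin)) →
      ¬ (0 < ev l (b origin) ∧ 0 < ev m (b origin)) →
      (∃ x ∈ sidePts G R S M, 0 ≤ ev l x) ∨ (∃ x ∈ sidePts G R S L, 0 ≤ ev m x) := by
    intro a ha b hb hab hx ⟨h1, h2⟩ h3
    rw [not_and_or] at h3
    rcases h3 with h3 | h3
    · right
      have hLs := hab L ((mem_sep_iff hL hl a b).2
        (mul_neg_of_pos_of_neg h1 (lt_of_le_of_ne (not_lt.1 h3) (T.ev_centre_ne hL hl hb))))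
      exact ⟨_, (T.edge_pt_mem hSE hk hs hLs).1, T.ev_nonneg hM hm ha h2 (subset_closure hx)⟩
    · left
      have hMs := hab M ((mem_sep_iff hM hm a b).2
        (mul_neg_of_pos_of_neg h2 (lt_of_le_of_ne (not_lt.1 h3) (T.ev_centre_ne hM hm hb))))
      exact ⟨_, (T.edge_pt_mem hSE hk hs hMs).1, T.ev_nonneg hL hl ha h1 (subset_closure hx)⟩
  have hmem := T.edge_pt_mem hSE hk hs (M := k '' sideWall G R s)
    (by rw [T.sep_step (hSE hs) hk]; rfl)
  rcases hks with ⟨a, b⟩ | ⟨a, b⟩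
  · exact key k hk _ hks' (fun N hN => hN) hmem.2.1 a b
  · exact key _ hks' k hk (fun N hN => by rwa [sep_comm] at hN) hmem.2.2 a b

/-- A crossing point of two walls lies, on one of them, between two base points. -/
theorem exists_sidePts_around (T : Tiling G R) {S : Set (Equiv.Perm CDisc)}
    (hSE : S ⊆ sidePairings G R) (hSG : Subgroup.closure S = G) {L M : Set CDisc}
    (hL : L ∈ walls G R) (hM : M ∈ walls G R) (hne : L ≠ M) {v : CDisc} (hvL : v ∈ L) (hvM : v ∈ M) :
    ∃ N ∈ walls G R, v ∈ N ∧ ∃ n, ev n v = 0 ∧ (∃ z ∈ N, ev n z ≠ 0) ∧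
      (∃ x ∈ sidePts G R S N, 0 ≤ ev n x) ∧ ∃ x ∈ sidePts G R S N, ev n x ≤ 0 := by
  obtain ⟨l, hl⟩ := hL.1.exists_defines
  obtain ⟨m, hm⟩ := hM.1.exists_defines
  have h1 := T.exists_sidePt_quadrant hSE hSG hL hM hne hvL hvM hl hm
  have h2 := T.exists_sidePt_quadrant hSE hSG hL hM hne hvL hvM hl.neg hm
  have h3 := T.exists_sidePt_quadrant hSE hSG hL hM hne hvL hvM hl hm.neg
  have h4 := T.exists_sidePt_quadrant hSE hSG hL hM hne hvL hvM hl.neg hm.neg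
  simp only [ev_neg, neg_nonneg] at h2 h3 h4
  have hvl := (hl.2 v (hL.1.subset hvL)).2 hvL
  have hvm := (hm.2 v (hM.1.subset hvM)).2 hvM
  have hoff : ∀ {A B : Set CDisc}, IsGeodesicLine A → IsGeodesicLine B → A ≠ B → ∀ {a}, Defines a A →
      ∃ z ∈ B, ev a z ≠ 0 := by
    intro A B hA hB hAB a ha
    by_contra hcon
    push Not at hcon
    obtain ⟨γ, hγ, rfl⟩ := hB
    have hall : ∀ t, γ t ∈ A := fun t => (ha.2 _ (hγ.1 t)).1 (hcon _ ⟨t, rfl⟩)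
    exact hAB (hA.eq_of_two ⟨γ, hγ, rfl⟩ (fun e => by simpa using hγ.injective e : γ 0 ≠ γ 1)
      (hall 0) (hall 1) ⟨0, rfl⟩ ⟨1, rfl⟩)
  have hA := hoff hL.1 hM.1 hne hl
  have hB := hoff hM.1 hL.1 hne.symm hm
  -- Each of the four quadrants has a base point on one of its two half lines. If one half of `M`
  -- has none, both quadrants adjacent to that half supply base points on the two halves of `L`.
  by_cases p1 : ∃ x ∈ sidePts G R S M, 0 ≤ ev l x
  · by_cases p2 : ∃ x ∈ sidePts G R S M, ev l x ≤ 0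
    · exact ⟨M, hM, hvM, l, hvl, hA, p1, p2⟩
    · exact ⟨L, hL, hvL, m, hvm, hB, h2.resolve_left p2, h4.resolve_left p2⟩
  · exact ⟨L, hL, hvL, m, hvm, hB, h1.resolve_left p1, h3.resolve_left p1⟩

theorem finite_crossings (T : Tiling G R) {r : ℝ} (hr : r < 1) :
    {v | v ∈ disc r ∧ ∃ L ∈ walls G R, ∃ M ∈ walls G R, L ≠ M ∧ v ∈ L ∧ v ∈ M}.Finite := by
  have hW := T.finite_wallsMeeting hr
  have : (⋃ p ∈ {p : Set CDisc × Set CDisc | p ∈ wallsMeeting G R r ×ˢ wallsMeeting G R r ∧ p.1 ≠ p.2},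
      p.1 ∩ p.2).Finite := by
    refine Finite.biUnion ((hW.prod hW).subset fun p hp => hp.1) ?_
    rintro ⟨L, M⟩ ⟨⟨hL, hM⟩, hne⟩
    apply Set.Subsingleton.finite
    rintro x ⟨hx, hx'⟩ y ⟨hy, hy'⟩
    by_contra hxy
    exact hne (hL.1.1.eq_of_two hM.1.1 hxy hx hy hx' hy')
  refine this.subset ?_
  rintro v ⟨hv, L, hL, M, hM, hne, hvL, hvM⟩
  exact mem_biUnion (x := (L, M)) ⟨⟨⟨hL, v, hvL, hv⟩, ⟨hM, v, hvM, hv⟩⟩, hne⟩ ⟨hvL, hvM⟩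

end Tiling

theorem exists_disc_of_geodesic {γ : ℝ → CDisc} (hγ : IsGeodesic γ) (a b : ℝ) :
    ∃ r < 1, ∀ t ∈ Icc a b, γ t ∈ disc r := by
  have hc : ContinuousOn (fun t => ‖(γ t : ℂ)‖) (Icc a b) := by
    have := hγ.continuous
    exact Continuous.continuousOn (by fun_prop)
  rcases (Icc a b).eq_empty_or_nonempty with h | h
  · exact ⟨0, by norm_num, by simp [h]⟩
  · obtain ⟨t, -, ht⟩ := isCompact_Icc.exists_isMaxOn h hc
    exact ⟨_, hγ.1 t, fun u hu => ht hu⟩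

namespace Tiling

/-- A crossing point of two walls, with a closest base point on one side and some base point on the
other side. -/
theorem exists_consecutive_sidePts (T : Tiling G R) {S : Set (Equiv.Perm CDisc)}
    (hSE : S ⊆ sidePairings G R) (hSf : S.Finite) (hSG : Subgroup.closure S = G) {L M : Set CDisc}
    (hL : L ∈ walls G R) (hM : M ∈ walls G R) (hne : L ≠ M) {v : CDisc} (hvL : v ∈ L) (hvM : v ∈ M) :
    ∃ γ, IsGeodesic γ ∧ ∃ t₁ t₀ t₂, t₁ ≤ t₀ ∧ t₀ ≤ t₂ ∧ γ t₀ = v ∧ γ t₁ ∈ sidePts G R S (range γ) ∧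
      γ t₂ ∈ sidePts G R S (range γ) ∧ ∀ t, t₁ < t → t ≤ t₀ → γ t ∉ sidePts G R S (range γ) := by
  obtain ⟨N, hN, hvN, n, hn0, ⟨z, hzN, hz⟩, ⟨x, hx, hnx⟩, ⟨y, hy, hny⟩⟩ :=
    T.exists_sidePts_around hSE hSG hL hM hne hvL hvM
  obtain ⟨⟨γ, hγ, rfl⟩, -⟩ := hN
  obtain ⟨t₀, rfl⟩ := hvN
  obtain ⟨_, _, _, _, _, _, _, hs⟩ := hγ.sign
  obtain ⟨P, Q, hPQ, -⟩ := hs n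
  have hz0 : P * Real.exp (2 * t₀) + Q = 0 := by
    obtain ⟨c, hc, e⟩ := hPQ t₀
    rw [hn0] at e
    exact (mul_eq_zero.1 e.symm).resolve_left hc.ne'
  have hP : P ≠ 0 := by
    rintro rfl
    obtain ⟨t, rfl⟩ := hzN
    obtain ⟨c, hc, e⟩ := hPQ t
    exact hz (by rw [e]; linear_combination c * hz0)
  obtain ⟨a, rfl⟩ := T.sidePts_subset hSE _ hx
  obtain ⟨b, rfl⟩ := T.sidePts_subset hSE _ hy
  have ha : 0 ≤ P * (Real.exp (2 * a) - Real.exp (2 * t₀)) := by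
    obtain ⟨c, hc, e⟩ := hPQ a
    rw [e] at hnx
    have := (mul_nonneg_iff_of_pos_left hc).1 hnx
    linarith
  have hb : P * (Real.exp (2 * b) - Real.exp (2 * t₀)) ≤ 0 := by
    obtain ⟨c, hc, e⟩ := hPQ b
    rw [e] at hny
    have : P * Real.exp (2 * b) + Q ≤ 0 := by
      by_contra h
      push Not at h
      linarith [mul_pos hc h]
    linarith
  obtain ⟨t₁, t₂, h1, h2, m1, m2⟩ : ∃ t₁ t₂, t₁ ≤ t₀ ∧ t₀ ≤ t₂ ∧ γ t₁ ∈ sidePts G R S (range γ) ∧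
      γ t₂ ∈ sidePts G R S (range γ) := by
    have hle : ∀ {s t : ℝ}, 0 ≤ Real.exp (2 * s) - Real.exp (2 * t) → t ≤ s := by
      intro s t h
      have := Real.exp_le_exp.1 (sub_nonneg.1 h)
      linarith
    rcases lt_or_gt_of_ne hP with hP | hP
    · exact ⟨a, b, hle (by nlinarith), hle (by nlinarith), hx, hy⟩
    · exact ⟨b, a, hle (by nlinarith), hle (by nlinarith), hy, hx⟩
  obtain ⟨r, hr, hdisc⟩ := exists_disc_of_geodesic hγ t₁ t₀
  have hfin : {t | t ∈ Icc t₁ t₀ ∧ γ t ∈ sidePts G R S (range γ)}.Finite := by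
    refine Finite.of_injOn (f := γ) (t := sidePts G R S (range γ) ∩ disc r) ?_ hγ.injective.injOn
      (T.finite_sidePts hSE hSf hr _)
    exact fun t ht => ⟨ht.2, hdisc t ht.1⟩
  obtain ⟨t, ⟨ht, htm⟩, hmax⟩ := hfin.exists_maximalFor id _ ⟨t₁, ⟨le_rfl, h1⟩, m1⟩
  refine ⟨γ, hγ, t, t₀, t₂, ht.2, h2, rfl, htm, m2, fun u hu hu0 hus => ?_⟩
  have := hmax (show u ∈ {t | t ∈ Icc t₁ t₀ ∧ γ t ∈ sidePts G R S (range γ)} from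
    ⟨⟨ht.1.trans hu.le, hu0⟩, hus⟩) hu.le
  exact absurd this (not_le.2 hu)

/-- There are finitely many crossing points of walls, up to the action of `G`. -/
theorem exists_finite_crossing_reps (T : Tiling G R) {S : Set (Equiv.Perm CDisc)}
    (hSE : S ⊆ sidePairings G R) (hSf : S.Finite) (hSG : Subgroup.closure S = G) :
    ∃ F : Set CDisc, F.Finite ∧ ∀ L ∈ walls G R, ∀ M ∈ walls G R, L ≠ M → ∀ v ∈ L, v ∈ M →
      ∃ k ∈ G, ∃ f ∈ F, v = k f := by
  have hex : ∀ s ∈ S, ∃ γ, IsGeodesic γ ∧ range γ = sideWall G R s ∧ γ 0 = sidePt R s := by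
    intro s hs
    obtain ⟨⟨γ, hγ, e⟩, -⟩ := T.sideWall_mem_walls (hSE hs)
    have := T.side_subset (hSE hs) (sidePt_mem (hSE hs))
    rw [← e] at this
    obtain ⟨c, hc⟩ := this
    refine ⟨fun t => γ (t + c), hγ.shift c, ?_, by simpa using hc⟩
    rw [← e]
    exact (Equiv.addRight c).surjective.range_comp γ
  choose! γ hγ hγr hγ0 using hex
  -- Parameters `τ` that lie between the base point at `0` and another one at `τ₂`, with no base
  -- point other than that at `0` between `0` and `τ`. Betweenness is written as equality in the
  -- triangle inequality because the translation used below may reverse the parametrization. On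
  -- either side of `0`, such parameters do not pass any base point there, and there are none if
  -- that side has no base point, so `V s` is bounded.
  set V : Equiv.Perm CDisc → Set ℝ := fun s => {τ | (∃ τ₂, γ s τ₂ ∈ sidePts G R S (sideWall G R s) ∧
    |τ| + |τ₂ - τ| = |τ₂|) ∧ ∀ τ', γ s τ' ∈ sidePts G R S (sideWall G R s) →
    |τ'| + |τ - τ'| = |τ| → τ' = 0} with hV
  have hVb : ∀ s ∈ S, ∃ r < 1, ∀ τ ∈ V s, γ s τ ∈ disc r := by
    intro s hs
    have hup : ∃ b, ∀ τ ∈ V s, τ ≤ b := by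
      by_cases h : ∃ a, 0 < a ∧ γ s a ∈ sidePts G R S (sideWall G R s)
      · obtain ⟨a, ha, hm⟩ := h
        refine ⟨a, fun τ hτ => ?_⟩
        by_contra hlt
        push Not at hlt
        have := hτ.2 a hm (by
          rw [abs_of_pos ha, abs_of_pos (sub_pos.2 hlt), abs_of_pos (ha.trans hlt)]; ring)
        linarith
      · push Not at h
        refine ⟨0, fun τ hτ => ?_⟩
        by_contra hlt
        push Not at hlt
        obtain ⟨τ₂, hm, e⟩ := hτ.1
        have h2 : ¬ 0 < τ₂ := fun h0 => h τ₂ h0 hm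
        rw [abs_of_pos hlt, abs_of_nonpos (not_lt.1 h2), abs_of_neg (by linarith)] at e
        linarith
    have hlo : ∃ b, ∀ τ ∈ V s, b ≤ τ := by
      by_cases h : ∃ a, a < 0 ∧ γ s a ∈ sidePts G R S (sideWall G R s)
      · obtain ⟨a, ha, hm⟩ := h
        refine ⟨a, fun τ hτ => ?_⟩
        by_contra hlt
        push Not at hlt
        have := hτ.2 a hm (by
          rw [abs_of_neg ha, abs_of_neg (sub_neg.2 hlt), abs_of_neg (hlt.trans ha)]; ring)
        linarith
      · push Not at h
        refine ⟨0, fun τ hτ => ?_⟩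
        by_contra hlt
        push Not at hlt
        obtain ⟨τ₂, hm, e⟩ := hτ.1
        have h2 : ¬ τ₂ < 0 := fun h0 => h τ₂ h0 hm
        rw [abs_of_neg hlt, abs_of_nonneg (not_lt.1 h2), abs_of_pos (by linarith)] at e
        linarith
    obtain ⟨b, hb⟩ := hup
    obtain ⟨a, ha⟩ := hlo
    obtain ⟨r, hr, hd⟩ := exists_disc_of_geodesic (hγ s hs) a b
    exact ⟨r, hr, fun τ hτ => hd τ ⟨ha τ hτ, hb τ hτ⟩⟩
  choose! r hr hrV using hVb
  refine ⟨⋃ s ∈ S, {v | v ∈ disc (r s) ∧ ∃ L ∈ walls G R, ∃ M ∈ walls G R, L ≠ M ∧ v ∈ L ∧ v ∈ M},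
    hSf.biUnion fun s hs => T.finite_crossings (hr s hs), ?_⟩
  intro L hL M hM hne v hvL hvM
  -- Translating the preceding base point to the chosen one on a side with label in `S` moves the
  -- crossing point into the bounded range `V s`.
  obtain ⟨δ, hδ, t₁, t₀, t₂, h10, h02, hδ0, m1, m2, hno⟩ :=
    T.exists_consecutive_sidePts hSE hSf hSG hL hM hne hvL hvM
  have m1' := m1
  obtain ⟨k, hk, s, hs, hks, hδ1⟩ := m1'
  have hk' := G.inv_mem hk
  have hf : ∀ t, ∃ τ, δ t = k (γ s τ) := by
    intro t
    have : δ t ∈ k '' sideWall G R s := by rw [hks]; exact ⟨t, rfl⟩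
    rw [← hγr s hs] at this
    obtain ⟨_, ⟨τ, rfl⟩, e⟩ := this
    exact ⟨τ, e.symm⟩
  choose f hf using hf
  have hfd : ∀ t u, |f t - f u| = |t - u| := by
    intro t u
    rw [← hδ.2 t u, hf t, hf u, (T.moeb k hk).hdist, (hγ s hs).2]
  have hf1 : f t₁ = 0 := by
    apply (hγ s hs).injective
    apply k.injective
    rw [← hf, hγ0 s hs, hδ1]
  have habs : ∀ t, |f t| = |t - t₁| := fun t => by rw [← hfd, hf1, sub_zero]
  have hpull : ∀ t, δ t ∈ sidePts G R S (range δ) ↔ γ s (f t) ∈ sidePts G R S (sideWall G R s) := by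
    intro t
    constructor
    · intro h
      have := image_sidePts hk' h
      rwa [hf t, ← hks, ← image_comp, ← Equiv.Perm.coe_mul, inv_mul_cancel, Equiv.Perm.coe_one,
        image_id, show k⁻¹ (k (γ s (f t))) = γ s (f t) from k.symm_apply_apply _] at this
    · intro h
      have := image_sidePts hk h
      rwa [← hf, hks] at this
  have hmemV : f t₀ ∈ V s := by
    refine ⟨⟨f t₂, (hpull t₂).1 m2, ?_⟩, fun τ' hτ' e => ?_⟩
    · rw [habs, habs, hfd, abs_of_nonneg (by linarith), abs_of_nonneg (by linarith),
        abs_of_nonneg (by linarith)]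
      ring
    · have : k (γ s τ') ∈ range δ := by
        rw [← hks, ← hγr s hs]; exact ⟨_, ⟨τ', rfl⟩, rfl⟩
      obtain ⟨t', ht'⟩ := this
      have hft : f t' = τ' := by
        apply (hγ s hs).injective
        apply k.injective
        rw [← hf, ht']
      rw [← hft] at hτ' e ⊢
      rw [habs, habs, hfd, abs_of_nonneg (show 0 ≤ t₀ - t₁ by linarith)] at e
      have a1 := le_abs_self (t' - t₁)
      have a2 := le_abs_self (t₀ - t')
      have a3 := abs_nonneg (t' - t₁)
      have a4 := abs_nonneg (t₀ - t')
      have a5 : t₁ ≤ t' := by linarith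
      have a6 : t' ≤ t₀ := by linarith
      have hnot : ¬ t₁ < t' := fun h => hno t' h a6 ((hpull t').2 hτ')
      rw [le_antisymm (not_lt.1 hnot) a5, hf1]
  have hv : k⁻¹ v = γ s (f t₀) := by rw [Equiv.Perm.inv_eq_iff_eq, ← hf, hδ0]
  refine ⟨k, hk, k⁻¹ v, ?_, (k.apply_symm_apply v).symm⟩
  refine mem_biUnion (x := s) hs ⟨?_, _, T.image_wall hL hk', _, T.image_wall hM hk', ?_,
    mem_image_of_mem _ hvL, mem_image_of_mem _ hvM⟩
  · rw [hv]; exact hrV s hs _ hmemV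
  · exact fun e => hne (image_injective.2 (k⁻¹).injective e)

/-- If `k f` lies in `R`, then the tile of `k⁻¹` contains `f`, and only finitely many tiles do. -/
theorem finite_orbit_inter (T : Tiling G R) {F : Set CDisc} (hF : F.Finite) :
    {p | p ∈ R ∧ ∃ k ∈ G, ∃ f ∈ F, p = k f}.Finite := by
  have : (⋃ f ∈ {f | f ∈ F ∧ f ∈ openDisc},
      (fun k : Equiv.Perm CDisc => k⁻¹ f) '' meeting G R ‖(f : ℂ)‖).Finite :=
    (hF.subset fun f hf => hf.1).biUnion fun f hf => (T.finite_meeting hf.2).image _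
  refine this.subset ?_
  rintro _ ⟨hp, k, hk, f, hf, rfl⟩
  have hfD : f ∈ openDisc := (T.moeb k hk).mem_openDisc.1 (T.dom.subset_disc hp)
  refine mem_biUnion (x := f) ⟨hf, hfD⟩ ⟨k⁻¹, ⟨G.inv_mem hk, f, ⟨k f, hp, k.symm_apply_apply f⟩, ?_⟩,
    by change k⁻¹⁻¹ f = k f; rw [inv_inv]⟩
  exact le_refl ‖(f : ℂ)‖

/-- If a wall of a side is not contained in `R`, then it leaves `R` at a crossing point. -/
theorem exists_crossing_of_not_subset (T : Tiling G R) {e : Equiv.Perm CDisc}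
    (he : e ∈ sidePairings G R) (h : ¬ sideWall G R e ⊆ R) :
    ∃ p ∈ R, p ∈ sideWall G R e ∧ ∃ M ∈ walls G R, sideWall G R e ≠ M ∧ p ∈ M := by
  have hW := T.sideWall_mem_walls he
  obtain ⟨γ, hγ, hγr, t₀, t₁, h01, hR0, hR1⟩ : ∃ γ, IsGeodesic γ ∧ range γ = sideWall G R e ∧
      ∃ t₀ t₁, t₀ ≤ t₁ ∧ γ t₀ ∈ R ∧ γ t₁ ∉ R := by
    obtain ⟨γ, hγ, hγr⟩ := hW.1
    have hm := T.side_subset he (sidePt_mem he)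
    have hmR := (sidePt_mem he).1
    rw [← hγr] at hm h
    obtain ⟨t₀, ht₀⟩ := hm
    obtain ⟨_, ⟨t₁, rfl⟩, h1⟩ := not_subset.1 h
    rw [← ht₀] at hmR
    rcases le_total t₀ t₁ with h01 | h01
    · exact ⟨γ, hγ, hγr, t₀, t₁, h01, hmR, h1⟩
    · refine ⟨_, hγ.reverse, ?_, -t₀, -t₁, by linarith, by simpa using hmR, by simpa using h1⟩
      rw [← hγr]
      exact (Equiv.neg ℝ).surjective.range_comp γ
  set A : Set ℝ := {t | t ∈ Icc t₀ t₁ ∧ γ t ∈ closure R} with hA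
  have hAR : ∀ t ∈ A, γ t ∈ R := fun t ht => T.dom.isClosed ⟨ht.2, hγ.1 t⟩
  have hAc : IsClosed A := isClosed_Icc.inter (isClosed_closure.preimage hγ.continuous)
  have hAb : BddAbove A := ⟨t₁, fun t ht => ht.1.2⟩
  have hs := hAc.csSup_mem ⟨t₀, ⟨le_rfl, h01⟩, subset_closure hR0⟩ hAb
  set s := sSup A
  have hs1 : s < t₁ := lt_of_le_of_ne hs.1.2 fun e => hR1 (e ▸ hAR s hs)
  obtain ⟨δ, hδ, hnear⟩ := T.eventually_pos (hAR s hs)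
  have h1 : ∀ᶠ t in 𝓝[>] s, dist (γ t) (γ s) < δ :=
    (Metric.tendsto_nhds.1 (hγ.continuous.tendsto s) _ hδ).filter_mono nhdsWithin_le_nhds
  obtain ⟨t, ht1, ht2⟩ := (h1.and (Ioo_mem_nhdsGT hs1)).exists
  have htR : γ t ∉ R := fun hR =>
    absurd (le_csSup hAb ⟨⟨hs.1.1.trans ht2.1.le, ht2.2.le⟩, subset_closure hR⟩) (not_le.2 ht2.1)
  obtain ⟨L, hL, l, hl, h0, hneg⟩ := T.exists_wall_of_not_mem (hγ.1 t) htR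
  refine ⟨γ s, hAR s hs, hγr ▸ ⟨s, rfl⟩, L, hL, ?_, ?_⟩
  · rintro rfl
    exact hneg.ne ((hl.2 _ (hγ.1 t)).2 (hγr ▸ ⟨t, rfl⟩))
  · by_contra hc
    linarith [(hnear _ ht1).2 L hL hc l hl h0]

/-- A finitely generated group has a fundamental domain with finitely many sides. -/
theorem finite_sidePairings (T : Tiling G R) (hfg : G.FG) : (sidePairings G R).Finite := by
  obtain ⟨S, hSE, hSf, hSG⟩ := T.exists_finite_generators hfg
  obtain ⟨F, hF, hFc⟩ := T.exists_finite_crossing_reps hSE hSf hSG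
  have hP := T.finite_orbit_inter (hF.union (hSf.image (sidePt R)))
  set P := {p | p ∈ R ∧ ∃ k ∈ G, ∃ f ∈ F ∪ sidePt R '' S, p = k f} with hPdef
  -- Finitely many walls pass through each point of the finite set `P`, and the wall of a side
  -- determines its label. It remains to find a point of `P` on each such wall: a base point if the
  -- whole wall lies in `R`, a crossing point otherwise.
  have hfin : (⋃ p ∈ P, {e | e ∈ sidePairings G R ∧ p ∈ sideWall G R e}).Finite := by
    refine hP.biUnion fun p hp => ?_
    refine Finite.of_injOn (f := sideWall G R) (t := wallsMeeting G R ‖(p : ℂ)‖) ?_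
      (T.sideWall_injOn.mono fun e he => he.1) (T.finite_wallsMeeting (T.dom.subset_disc hp.1))
    exact fun e he => ⟨T.sideWall_mem_walls he.1, p, he.2, le_refl ‖(p : ℂ)‖⟩
  refine hfin.subset fun e he => ?_
  by_cases hsub : sideWall G R e ⊆ R
  · obtain ⟨x, hx⟩ := T.sidePts_nonempty hSE hSG G.one_mem he.1 (T.sideWall_mem he)
    have hxw := T.sidePts_subset hSE _ hx
    obtain ⟨k, hk, s, hs, -, rfl⟩ := hx
    exact mem_biUnion (x := k (sidePt R s)) ⟨hsub hxw, k, hk, _, Or.inr ⟨s, hs, rfl⟩, rfl⟩ ⟨he, hxw⟩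
  · obtain ⟨p, hpR, hpw, M, hM, hne, hpM⟩ := T.exists_crossing_of_not_subset he hsub
    obtain ⟨k, hk, f, hf, e'⟩ := hFc _ (T.sideWall_mem_walls he) M hM hne p hpw hpM
    exact mem_biUnion (x := p) ⟨hpR, k, hk, f, Or.inl hf, e'⟩ ⟨he, hpw⟩

end Tiling

/-! ### Signs of functionals just after a point of the circle. -/

/-- The functional `l` is positive just after `ξ`, in anticlockwise direction. -/
def GermPos (l : ℝ × ℂ) (ξ : CDisc) : Prop := ∀ᶠ s in 𝓝[>] (0 : ℝ), 0 < ev l (rot s ξ)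

theorem rot_coe (s : ℝ) (ξ : CDisc) :
    ((rot s ξ : CDisc) : ℂ) = (ξ : ℂ) * Complex.exp (s * Complex.I) := rfl

theorem rot_zero (ξ : CDisc) : rot 0 ξ = ξ := Subtype.ext (by simp [rot_coe])

theorem rot_rot (s t : ℝ) (ξ : CDisc) : rot s (rot t ξ) = rot (t + s) ξ := by
  apply Subtype.ext
  rw [rot_coe, rot_coe, rot_coe, mul_assoc, ← Complex.exp_add]
  push_cast
  ring_nf

theorem norm_rot (s : ℝ) (ξ : CDisc) : ‖((rot s ξ : CDisc) : ℂ)‖ = ‖(ξ : ℂ)‖ := by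
  rw [rot_coe, norm_mul, Complex.norm_exp_ofReal_mul_I, mul_one]

theorem rot_mem {s : ℝ} {ξ : CDisc} (h : ξ ∈ unitCircle) : rot s ξ ∈ unitCircle := by
  change ‖((rot s ξ : CDisc) : ℂ)‖ = 1
  rw [norm_rot]; exact h

theorem continuous_rot (ξ : CDisc) : Continuous fun s => rot s ξ := by
  refine Continuous.subtype_mk ?_ _
  fun_prop

theorem rot_re_im (s : ℝ) (ξ : CDisc) :
    ((rot s ξ : CDisc) : ℂ).re = (ξ : ℂ).re * Real.cos s - (ξ : ℂ).im * Real.sin s ∧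
    ((rot s ξ : CDisc) : ℂ).im = (ξ : ℂ).re * Real.sin s + (ξ : ℂ).im * Real.cos s := by
  rw [rot_coe, Complex.exp_mul_I, ← Complex.ofReal_cos, ← Complex.ofReal_sin]
  constructor
  · simp [-Complex.ofReal_cos, -Complex.ofReal_sin]
  · simp [-Complex.ofReal_cos, -Complex.ofReal_sin]

theorem unitCircle_re_im {ξ : CDisc} (h : ξ ∈ unitCircle) :
    (ξ : ℂ).re ^ 2 + (ξ : ℂ).im ^ 2 = 1 := by
  have := norm_sq_eq (ξ : ℂ)
  rw [show ‖(ξ : ℂ)‖ = 1 from h] at this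
  linarith

theorem ev_rot (l : ℝ × ℂ) (s : ℝ) {ξ : CDisc} (h : ξ ∈ unitCircle) :
    ev l (rot s ξ) = 2 * (l.1 + (l.2.re * (ξ : ℂ).re + l.2.im * (ξ : ℂ).im) * Real.cos s
      + (l.2.im * (ξ : ℂ).re - l.2.re * (ξ : ℂ).im) * Real.sin s) := by
  have h1 := unitCircle_re_im (rot_mem (s := s) h)
  obtain ⟨h2, h3⟩ := rot_re_im s ξ
  unfold ev
  rw [h1, h2, h3]
  ring

theorem germPos_of_pos {l : ℝ × ℂ} {ξ : CDisc} (h : 0 < ev l ξ) : GermPos l ξ := by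
  have hc : Continuous fun s => ev l (rot s ξ) := (continuous_ev l).comp (continuous_rot ξ)
  have := hc.tendsto 0
  rw [rot_zero] at this
  exact (this.eventually (lt_mem_nhds h)).filter_mono nhdsWithin_le_nhds

theorem GermPos.not_neg {l : ℝ × ℂ} {ξ : CDisc} (h : GermPos l ξ) : ¬ GermPos (-l) ξ := by
  intro h'
  obtain ⟨s, h1, h2⟩ := (h.and h').exists
  rw [ev_neg] at h2
  linarith

theorem GermPos.nonneg {l : ℝ × ℂ} {ξ : CDisc} (h : GermPos l ξ) : 0 ≤ ev l ξ := by
  by_contra hn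
  refine h.not_neg (germPos_of_pos ?_)
  rw [ev_neg]; linarith

theorem GermPos.smul {l : ℝ × ℂ} {ξ : CDisc} (h : GermPos l ξ) {r : ℝ} (hr : 0 < r) :
    GermPos (r • l) ξ :=
  h.mono fun s hs => by rw [ev_smul]; positivity

/-- At a zero `ξ` the functional along the circle factors as `4 sin (s / 2) (q cos (s / 2) - p sin
(s / 2))`. For small `s > 0` its sign is that of `q`, or of `-p` if `q = 0`. -/
theorem germPos_or {l : ℝ × ℂ} (hl : l ≠ 0) {ξ : CDisc} (h : ξ ∈ unitCircle) :
    GermPos l ξ ∨ GermPos (-l) ξ := by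
  rcases lt_trichotomy (ev l ξ) 0 with h0 | h0 | h0
  · right; exact germPos_of_pos (by rw [ev_neg]; linarith)
  swap
  · left; exact germPos_of_pos h0
  set p := l.2.re * (ξ : ℂ).re + l.2.im * (ξ : ℂ).im with hp
  set q := l.2.im * (ξ : ℂ).re - l.2.re * (ξ : ℂ).im with hq
  have hA : l.1 = -p := by
    have := ev_rot l 0 h
    rw [rot_zero, h0] at this
    simp only [Real.cos_zero, Real.sin_zero] at this
    linarith
  have hev : ∀ s, ev l (rot s ξ) = 4 * (Real.sin (s / 2) *
      (q * Real.cos (s / 2) - p * Real.sin (s / 2))) := by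
    intro s
    rw [ev_rot l s h, ← hp, ← hq, hA]
    have h1 : Real.cos s = 1 - 2 * Real.sin (s / 2) ^ 2 := by
      have := Real.cos_sq' (s / 2)
      have h2 := Real.cos_two_mul (s / 2)
      rw [show 2 * (s / 2) = s by ring] at h2
      linarith
    have h2 : Real.sin s = 2 * Real.sin (s / 2) * Real.cos (s / 2) := by
      rw [← Real.sin_two_mul, show 2 * (s / 2) = s by ring]
    rw [h1, h2]; ring
  have hsin : ∀ᶠ s in 𝓝[>] (0 : ℝ), 0 < Real.sin (s / 2) := by
    filter_upwards [Ioo_mem_nhdsGT Real.pi_pos] with s hs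
    exact Real.sin_pos_of_pos_of_lt_pi (by linarith [hs.1]) (by linarith [hs.1, hs.2])
  have key : ∀ c : ℝ, (∀ᶠ s in 𝓝[>] (0 : ℝ),
      0 < c * (q * Real.cos (s / 2) - p * Real.sin (s / 2))) →
      ∀ᶠ s in 𝓝[>] (0 : ℝ), 0 < c * ev l (rot s ξ) := by
    intro c hc
    filter_upwards [hc, hsin] with s h1 h2
    rw [hev]
    have := mul_pos h2 h1
    linarith
  have fin : ((∀ᶠ s in 𝓝[>] (0 : ℝ), 0 < 1 * (q * Real.cos (s / 2) - p * Real.sin (s / 2))) ∨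
      ∀ᶠ s in 𝓝[>] (0 : ℝ), 0 < (-1) * (q * Real.cos (s / 2) - p * Real.sin (s / 2))) := by
    by_cases hq0 : q = 0
    · have hp0 : p ≠ 0 := by
        intro hp0
        apply hl
        have h1 := unitCircle_re_im h
        have h2 : l.2.re = 0 := by
          have : l.2.re = p * (ξ : ℂ).re - q * (ξ : ℂ).im := by
            rw [hp, hq]; linear_combination (-l.2.re) * h1
          rw [this, hp0, hq0]; ring
        have h3 : l.2.im = 0 := by
          have : l.2.im = p * (ξ : ℂ).im + q * (ξ : ℂ).re := by
            rw [hp, hq]; linear_combination (-l.2.im) * h1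
          rw [this, hp0, hq0]; ring
        exact Prod.ext (by rw [hA, hp0]; simp) (Complex.ext h2 h3)
      rcases lt_or_gt_of_ne hp0 with hp1 | hp1
      · left
        filter_upwards [hsin] with s hs
        rw [hq0]; nlinarith
      · right
        filter_upwards [hsin] with s hs
        rw [hq0]; nlinarith
    · have hc : Continuous fun s : ℝ => q * Real.cos (s / 2) - p * Real.sin (s / 2) := by fun_prop
      have ht := hc.tendsto 0
      simp only [zero_div, Real.cos_zero, Real.sin_zero, mul_one, mul_zero, sub_zero] at ht
      rcases lt_or_gt_of_ne hq0 with h1 | h1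
      · right
        filter_upwards [(ht.eventually (gt_mem_nhds h1)).filter_mono nhdsWithin_le_nhds] with s hs
        linarith
      · left
        filter_upwards [(ht.eventually (lt_mem_nhds h1)).filter_mono nhdsWithin_le_nhds] with s hs
        linarith
  rcases fin with h1 | h1
  · left
    filter_upwards [key _ h1] with s hs
    linarith
  · right
    filter_upwards [key _ h1] with s hs
    rw [ev_neg]; linarith

theorem den_star {a b : ℂ} {ξ : CDisc} (h : ξ ∈ unitCircle) :
    a * (ξ : ℂ) + b = (ξ : ℂ) * star (star b * (ξ : ℂ) + star a) := by
  have h1 : (ξ : ℂ) * star (ξ : ℂ) = 1 := by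
    have := Complex.mul_conj (ξ : ℂ)
    rw [Complex.normSq_eq_norm_sq, show ‖(ξ : ℂ)‖ = 1 from h] at this
    simpa using this
  simp only [star_add, star_mul', star_star]
  linear_combination -b * h1

/-- A Möbius transformation is increasing on the circle. -/
theorem IsDiscMoebius.exists_rot {k : Equiv.Perm CDisc} (hk : IsDiscMoebius k) {ξ : CDisc}
    (h : ξ ∈ unitCircle) : ∃ σ : ℝ → ℝ, Tendsto σ (𝓝[>] 0) (𝓝[>] 0) ∧
      ∀ s, k (rot s ξ) = rot (σ s) (k ξ) := by
  obtain ⟨a, b, hc⟩ := hk.coef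
  have hkξ : k ξ ∈ unitCircle := hk.mem_unitCircle.2 h
  set w : ℝ → ℂ := fun s => star b * ((rot s ξ : CDisc) : ℂ) + star a with hw
  have hwne : ∀ s, w s ≠ 0 := fun s => den_ne hc.1 _
  have hw0 : w 0 = star b * (ξ : ℂ) + star a := by simp [hw, rot_zero]
  have hkk : ((k ξ : CDisc) : ℂ) * star ((k ξ : CDisc) : ℂ) = 1 := by
    have := Complex.mul_conj ((k ξ : CDisc) : ℂ)
    rw [Complex.normSq_eq_norm_sq, show ‖((k ξ : CDisc) : ℂ)‖ = 1 from hkξ] at this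
    simpa using this
  have hξξ : (ξ : ℂ) * star (ξ : ℂ) = 1 := by
    have := Complex.mul_conj (ξ : ℂ)
    rw [Complex.normSq_eq_norm_sq, show ‖(ξ : ℂ)‖ = 1 from h] at this
    simpa using this
  -- `D s` is the quotient of `k (rot s ξ)` by `k ξ` on the circle, and `σ` is its argument. The
  -- formula for `D s - 1` shows that `D` starts at `1` in the direction of a positive multiple of
  -- `I`, so the argument is positive for small `s > 0`.
  set D : ℝ → ℂ := fun s => ((k (rot s ξ) : CDisc) : ℂ) * star ((k ξ : CDisc) : ℂ) with hD
  have hstar : star ((k ξ : CDisc) : ℂ) * star (w 0) = star (ξ : ℂ) * w 0 := by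
    have h1 := hc.2 ξ
    rw [den_star h, ← hw0, eq_div_iff (hwne 0)] at h1
    have := congrArg star h1
    simpa only [star_mul', star_star] using this
  have hcont : Continuous D := by
    have h1 : Continuous fun s => k (rot s ξ) := hk.continuous.comp (continuous_rot ξ)
    exact (continuous_subtype_val.comp h1).mul continuous_const
  have hD0 : D 0 = 1 := by simp only [hD]; rw [rot_zero]; exact hkk
  have hDn : ∀ s, ‖D s‖ = 1 := by
    intro s
    simp only [hD]
    rw [norm_mul, norm_star, show ‖((k (rot s ξ) : CDisc) : ℂ)‖ = 1 from
      hk.mem_unitCircle.2 (rot_mem h), show ‖((k ξ : CDisc) : ℂ)‖ = 1 from hkξ, mul_one]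
  have hDs : ∀ s : ℝ, D s - 1 = (2 * Real.sin (s / 2) : ℝ) *
      (Complex.I * Complex.exp ((s / 2 : ℝ) * Complex.I) / (w s * star (w 0))) := by
    intro s
    have hexp : Complex.exp (s * Complex.I) - 1
        = 2 * Real.sin (s / 2) * (Complex.I * Complex.exp ((s / 2 : ℝ) * Complex.I)) := by
      have h1 : Complex.exp (s * Complex.I) = Complex.exp ((s / 2 : ℝ) * Complex.I) ^ 2 := by
        rw [← Complex.exp_nat_mul]; push_cast; ring_nf
      have h2 : (Complex.cos ((s / 2 : ℝ)) : ℂ) ^ 2 = 1 - Complex.sin ((s / 2 : ℝ)) ^ 2 := by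
        have := Complex.sin_sq_add_cos_sq ((s / 2 : ℝ) : ℂ)
        linear_combination this
      rw [h1, Complex.exp_mul_I, Complex.ofReal_sin]
      linear_combination h2 + (Complex.sin ((s / 2 : ℝ)) ^ 2 - 2 * Complex.sin ((s / 2 : ℝ)) ^ 2) * Complex.I_sq
    have h1 : D s - 1 = (((k (rot s ξ) : CDisc) : ℂ) - ((k ξ : CDisc) : ℂ))
        * star ((k ξ : CDisc) : ℂ) := by
      simp only [hD]; linear_combination hkk
    have h2 := sub_coef hc (rot s ξ) ξ
    rw [h1, h2, ← hw0, rot_coe]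
    have hs0 : star (w 0) ≠ 0 := star_ne_zero.2 (hwne 0)
    have h3 : star ((k ξ : CDisc) : ℂ) = star (ξ : ℂ) * w 0 / star (w 0) := by
      rw [eq_div_iff hs0]; exact hstar
    rw [h3]
    change _ / (w s * w 0) * _ = _
    have e1 : (ξ : ℂ) * Complex.exp (s * Complex.I) - ξ
      = ξ * (Complex.exp (s * Complex.I) - 1) := by ring
    rw [e1, hexp, div_mul_div_comm, ← mul_div_assoc, div_eq_div_iff
      (mul_ne_zero (mul_ne_zero (hwne s) (hwne 0)) hs0) (mul_ne_zero (hwne s) hs0)]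
    push_cast
    linear_combination (2 * Complex.sin (s / 2) * (Complex.I *
      Complex.exp (s / 2 * Complex.I)) * w 0 * w s * star (w 0)) * hξξ
  have him : ∀ᶠ s in 𝓝[>] (0 : ℝ), 0 < (D s).im := by
    set B : ℝ → ℂ := fun s => Complex.I * Complex.exp ((s / 2 : ℝ) * Complex.I) / (w s * star (w 0))
    have hwc : Continuous w := by
      have := continuous_subtype_val.comp (continuous_rot ξ)
      exact (continuous_const.mul this).add continuous_const
    have hB : Continuous B := by
      refine Continuous.div ?_ ?_ fun s => mul_ne_zero (hwne s) (star_ne_zero.2 (hwne 0))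
      · fun_prop
      · fun_prop
    have hBi : Tendsto (fun s => (B s).im) (𝓝 0) (𝓝 (B 0).im) :=
      (Complex.continuous_im.comp hB).tendsto 0
    have hB0 : 0 < (B 0).im := by
      have h1 : w 0 * star (w 0) = ((‖w 0‖ ^ 2 : ℝ) : ℂ) := by
        have := Complex.mul_conj (w 0)
        rw [Complex.normSq_eq_norm_sq] at this
        exact this
      have h2 : B 0 = Complex.I / ((‖w 0‖ ^ 2 : ℝ) : ℂ) := by
        simp only [B]; rw [h1]; simp
      have h3 : 0 < ‖w 0‖ := norm_pos_iff.2 (hwne 0)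
      rw [h2, Complex.div_ofReal_im, Complex.I_im]
      positivity
    filter_upwards [(hBi.eventually (lt_mem_nhds hB0)).filter_mono nhdsWithin_le_nhds,
      Ioo_mem_nhdsGT Real.pi_pos] with s h1 h2
    have h3 : 0 < Real.sin (s / 2) :=
      Real.sin_pos_of_pos_of_lt_pi (by linarith [h2.1]) (by linarith [h2.1, h2.2])
    have h4 : D s = 1 + (2 * Real.sin (s / 2) : ℝ) * B s := by rw [← hDs]; ring
    rw [h4, Complex.add_im, Complex.im_ofReal_mul, Complex.one_im, zero_add]
    positivity
  refine ⟨fun s => Complex.arg (D s), ?_, ?_⟩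
  · refine tendsto_nhdsWithin_of_tendsto_nhds_of_eventually_within _ ?_ ?_
    · have h1 : ContinuousAt Complex.arg (D 0) := Complex.continuousAt_arg (by rw [hD0]; simp)
      have h2 : Tendsto (fun s => Complex.arg (D s)) (𝓝 0) (𝓝 (Complex.arg (D 0))) :=
        h1.tendsto.comp (hcont.tendsto 0)
      rw [hD0, Complex.arg_one] at h2
      exact h2.mono_left nhdsWithin_le_nhds
    · filter_upwards [him] with s hs
      have h1 : 0 ≤ Complex.arg (D s) := Complex.arg_nonneg_iff.2 hs.le
      refine lt_of_le_of_ne h1 fun h2 => ?_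
      have := (Complex.arg_eq_zero_iff.1 h2.symm).2
      linarith
  · intro s
    apply Subtype.ext
    rw [rot_coe]
    have h1 := Complex.norm_mul_exp_arg_mul_I (D s)
    rw [hDn, Complex.ofReal_one, one_mul] at h1
    rw [h1]
    simp only [hD]
    linear_combination (-((k (rot s ξ) : CDisc) : ℂ)) * hkk

theorem germPos_of_map {k : Equiv.Perm CDisc} (hk : IsDiscMoebius k) {ξ : CDisc}
    (h : ξ ∈ unitCircle) {l l' : ℝ × ℂ} (hl : ∀ z, ∃ m > 0, ev l' (k z) = m * ev l z)
    (hg : GermPos l' (k ξ)) : GermPos l ξ := by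
  obtain ⟨σ, hσ, hr⟩ := hk.exists_rot h
  filter_upwards [hσ.eventually hg] with s hs
  rw [← hr] at hs
  obtain ⟨m, hm, he⟩ := hl (rot s ξ)
  rw [he] at hs
  exact (mul_pos_iff_of_pos_left hm).1 hs

theorem germPos_map {k : Equiv.Perm CDisc} (hk : IsDiscMoebius k) {ξ : CDisc}
    (h : ξ ∈ unitCircle) {l l' : ℝ × ℂ} (hl : ∀ z, ∃ m > 0, ev l' (k z) = m * ev l z)
    (hg : GermPos l ξ) : GermPos l' (k ξ) := by
  refine germPos_of_map hk.inv (hk.mem_unitCircle.2 h) (l' := l) (fun z => ?_) ?_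
  · obtain ⟨m, hm, he⟩ := hl (k⁻¹ z)
    rw [show k (k⁻¹ z) = z from k.apply_symm_apply z] at he
    refine ⟨m⁻¹, by positivity, ?_⟩
    rw [he]
    field_simp
  · rwa [show k⁻¹ (k ξ) = ξ from k.symm_apply_apply ξ]

/-! ### Paths of tiles on the way to a point at infinity. -/

/-- All the walls that separate `1` from `g` have `g` and the germ of the circle after `ξ` on the
same side. -/
def Toward (G : Subgroup (Equiv.Perm CDisc)) (R : Set CDisc) (ξ : CDisc) (g : Equiv.Perm CDisc) :
    Prop :=
  g ∈ G ∧ ∀ L ∈ sep G R 1 g, ∀ l, Defines l L → 0 < ev l (g origin) → GermPos l ξ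

theorem toward_one (ξ : CDisc) : Toward G R ξ 1 :=
  ⟨G.one_mem, fun L hL => by rw [Tiling.sep_self] at hL; exact hL.elim⟩

namespace Tiling

theorem not_mem_sep_iff (T : Tiling G R) {L : Set CDisc} (hL : L ∈ walls G R) {l : ℝ × ℂ}
    (hl : Defines l L) {g h : Equiv.Perm CDisc} (hg : g ∈ G) (hs : L ∉ sep G R g h)
    (h0 : 0 < ev l (h origin)) : 0 < ev l (g origin) := by
  rw [mem_sep_iff hL hl] at hs
  have h1 := T.ev_centre_ne hL hl hg
  rcases lt_or_gt_of_ne h1 with h2 | h2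
  · exact absurd (by nlinarith) hs
  · exact h2

/-- The wall of the crossed side has the germ beyond it and `g R` in front of it. It cannot be among
the walls already crossed, since those have the germ on the side of `g R`. So exactly one wall is
added. -/
theorem toward_step (T : Tiling G R) {ξ : CDisc} {g e : Equiv.Perm CDisc} (hg : Toward G R ξ g)
    (he : e ∈ sidePairings G R) {l : ℝ × ℂ} (hl : Defines l (g '' sideWall G R e))
    (h0 : 0 < ev l ((g * e) origin)) (hξ : GermPos l ξ) :
    Toward G R ξ (g * e) ∧ (sep G R 1 (g * e)).ncard = (sep G R 1 g).ncard + 1 := by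
  have hge : g * e ∈ G := G.mul_mem hg.1 he.1
  set M := g '' sideWall G R e with hM
  have hMw : M ∈ walls G R := T.image_wall (T.sideWall_mem_walls he) hg.1
  have hstep : sep G R g (g * e) = {M} := T.sep_step he hg.1
  have hMs : M ∈ sep G R g (g * e) := by rw [hstep]; rfl
  have hgneg : ev l (g origin) < 0 := by
    rw [mem_sep_iff hMw hl] at hMs
    by_contra hc
    push Not at hc
    nlinarith
  have hMn : M ∉ sep G R 1 g := by
    intro hc
    refine hξ.not_neg (hg.2 M hc (-l) hl.neg ?_)
    rw [ev_neg]; linarith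
  have heq : sep G R 1 (g * e) = insert M (sep G R 1 g) := by
    ext L
    constructor
    · intro hL
      rcases T.sep_trans hg.1 hL with h | h
      · exact Or.inr h
      · rw [hstep] at h; exact Or.inl h
    · rintro (rfl | hL)
      · rcases T.sep_trans G.one_mem hMs with h | h
        · rw [sep_comm] at h; exact absurd h hMn
        · exact h
      · rcases T.sep_trans hge hL with h | h
        · exact h
        · rw [sep_comm, hstep] at h
          rw [h] at hL
          exact absurd hL hMn
  refine ⟨⟨hge, fun L hL m hm h1 => ?_⟩, ?_⟩
  · rw [heq] at hL
    rcases hL with rfl | hL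
    · obtain ⟨r, hr, rfl⟩ := hl.unique hMw.1 hm
      rw [ev_smul] at h1
      exact hξ.smul (pos_of_mul_pos_left h1 h0.le)
    · refine hg.2 L hL m hm (T.not_mem_sep_iff hL.1 hm hg.1 ?_ h1)
      rw [hstep]
      rintro rfl
      exact hMn hL
  · rw [heq, ncard_insert_of_notMem hMn (T.finite_sep_one hg.1)]

end Tiling

/-! ### Without parabolic elements, `R` has no points at infinity. -/

/-- On the circle the conjugate of `z` is `1 / z`, so after multiplication by `z` the equation
becomes polynomial of degree at most two. -/
theorem finite_zeros_circle {l : ℝ × ℂ} (hl : l ≠ 0) : {ξ | ξ ∈ unitCircle ∧ ev l ξ = 0}.Finite := by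
  open Polynomial in
  set p : ℂ[X] := C (star l.2) * X ^ 2 + C (2 * (l.1 : ℂ)) * X + C l.2 with hp
  have hp0 : p ≠ 0 := by
    intro h
    have h0 := congrArg (fun q => Polynomial.coeff q 0) h
    have h1 := congrArg (fun q => Polynomial.coeff q 1) h
    simp [hp, Polynomial.coeff_X, Polynomial.coeff_C] at h0 h1
    exact hl (Prod.ext h1 h0)
  refine ((Polynomial.finite_setOfPred_isRoot hp0).preimage
    (f := (Subtype.val : CDisc → ℂ)) Subtype.val_injective.injOn).subset ?_
  rintro ξ ⟨h, h0⟩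
  have h1 := unitCircle_re_im h
  have h2 : l.1 + (l.2.re * (ξ : ℂ).re + l.2.im * (ξ : ℂ).im) = 0 := by
    have := ev_rot l 0 h
    rw [rot_zero, h0] at this
    simp only [Real.cos_zero, Real.sin_zero] at this
    linarith
  change Polynomial.eval (ξ : ℂ) p = 0
  simp only [hp, Polynomial.eval_add, Polynomial.eval_mul, Polynomial.eval_C,
    Polynomial.eval_pow, Polynomial.eval_X]
  apply Complex.ext
  · simp [pow_two]
    linear_combination 2 * (ξ : ℂ).re * h2 - l.2.re * h1
  · simp [pow_two]
    linear_combination 2 * (ξ : ℂ).im * h2 - l.2.im * h1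

theorem coef_fixed {h : Equiv.Perm CDisc} {a b : ℂ} (hc : Coef h a b) {z : CDisc} (hz : h z = z) :
    a * (z : ℂ) + b = z * (star b * (z : ℂ) + star a) := by
  have := hc.2 z
  rw [hz, eq_div_iff (den_ne hc.1 z)] at this
  exact this.symm

/-- A non-trivial, non-parabolic Möbius transformation that fixes a point `ξ` of the circle is
hyperbolic. -/
theorem exists_hyperbolic {h : Equiv.Perm CDisc} (hh : IsDiscMoebius h) (h1 : h ≠ 1)
    (hpar : ¬ IsParabolic h) {ξ : CDisc} (hξ : ξ ∈ unitCircle) (hfix : h ξ = ξ) :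
    ∃ η ∈ unitCircle, ξ ≠ η ∧ ∃ κ : ℝ, 0 < κ ∧ κ ≠ 1 ∧
      (∀ z ∈ openDisc, ‖((h z : CDisc) : ℂ) - ξ‖ / ‖((h z : CDisc) : ℂ) - η‖
        = κ * (‖(z : ℂ) - ξ‖ / ‖(z : ℂ) - η‖)) ∧
      ∀ z ∈ openDisc, ‖((h z : CDisc) : ℂ) - ξ‖ * ‖((h z : CDisc) : ℂ) - η‖ / (1 - ‖((h z : CDisc) : ℂ)‖ ^ 2)
        = ‖(z : ℂ) - ξ‖ * ‖(z : ℂ) - η‖ / (1 - ‖(z : ℂ)‖ ^ 2) := by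
  obtain ⟨a, b, hc⟩ := hh.coef
  have hdet := det_eq hc.1
  obtain ⟨η, hη, hne⟩ : ∃ η, h η = η ∧ η ≠ ξ := by
    by_contra hcon
    push Not at hcon
    exact hpar ⟨ξ, hξ, fun z => ⟨hcon z, fun e => e ▸ hfix⟩⟩
  have hξ1 : ‖(ξ : ℂ)‖ = 1 := hξ
  have hξ0 : (ξ : ℂ) ≠ 0 := norm_pos_iff.1 (by rw [hξ1]; norm_num)
  have e1 := coef_fixed hc hfix
  have e2 := coef_fixed hc hη
  have hsub : (ξ : ℂ) - η ≠ 0 := sub_ne_zero.2 fun e => hne (Subtype.ext e.symm)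
  have hsum : star b * ((ξ : ℂ) + η) = a - star a := by
    apply mul_left_cancel₀ hsub
    linear_combination e2 - e1
  have hprod : star b * ((ξ : ℂ) * η) = -b := by
    linear_combination (ξ : ℂ) * hsum + e1
  have hb : b ≠ 0 := by
    rintro rfl
    apply h1
    have ha : a = star a := by
      rw [star_zero, zero_mul] at hsum
      linear_combination -hsum
    ext z
    have := hc.2 z
    rw [this, star_zero, zero_mul, zero_add, add_zero, ← ha]
    have : a ≠ 0 := by
      rintro rfl
      simp at hdet
    simp [this]
  have hηc : η ∈ unitCircle := by
    have := congrArg norm hprod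
    rw [norm_mul, norm_mul, norm_star, norm_neg, hξ1, one_mul] at this
    exact mul_left_cancel₀ (norm_ne_zero_iff.2 hb) (this.trans (mul_one _).symm)
  -- The denominators at the two fixed points are real with product `1`. If `|u| = 1`, then `u = v`
  -- and the fixed points coincide. The multiplier is `κ = |v| / |u|`.
  set u := star b * (ξ : ℂ) + star a with hu
  set v := star b * (η : ℂ) + star a with hv
  have huv : u * v = 1 := by
    rw [hu, hv]
    linear_combination star b * hprod + star a * hsum + hdet
  have hreal : ∀ {x : CDisc}, x ∈ unitCircle → h x = x →
      star (star b * (x : ℂ) + star a) = star b * (x : ℂ) + star a := by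
    intro x hx hfx
    have hx0 : (x : ℂ) ≠ 0 := norm_pos_iff.1 (by rw [show ‖(x : ℂ)‖ = 1 from hx]; norm_num)
    apply mul_left_cancel₀ hx0
    rw [← den_star hx, coef_fixed hc hfx]
  have hu0 : u ≠ 0 := left_ne_zero_of_mul_eq_one huv
  have hv0 : v ≠ 0 := right_ne_zero_of_mul_eq_one huv
  have hnuv : ‖u‖ * ‖v‖ = 1 := by rw [← norm_mul, huv, norm_one]
  have hun : 0 < ‖u‖ := norm_pos_iff.2 hu0
  have hvn : 0 < ‖v‖ := norm_pos_iff.2 hv0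
  have hu1 : ‖u‖ ≠ 1 := by
    intro hu1
    have h2 : u * star u = 1 := by
      have := Complex.mul_conj u
      rw [Complex.normSq_eq_norm_sq, hu1] at this
      simpa using this
    rw [hreal hξ hfix, ← hu] at h2
    have h3 : u = v := mul_left_cancel₀ hu0 (h2.trans huv.symm)
    apply hsub
    have h4 : star b * ((ξ : ℂ) - η) = 0 := by
      rw [hu, hv] at h3
      linear_combination h3
    exact (mul_eq_zero.1 h4).resolve_left (star_ne_zero.2 hb)
  have d1 : ∀ z : CDisc, ‖((h z : CDisc) : ℂ) - ξ‖ = ‖(z : ℂ) - ξ‖ / (‖star b * (z : ℂ) + star a‖ * ‖u‖) := by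
    intro z
    have := sub_coef hc z ξ
    rw [hfix] at this
    rw [this, norm_div, norm_mul]
  have d2 : ∀ z : CDisc, ‖((h z : CDisc) : ℂ) - η‖ = ‖(z : ℂ) - η‖ / (‖star b * (z : ℂ) + star a‖ * ‖v‖) := by
    intro z
    have := sub_coef hc z η
    rw [hη] at this
    rw [this, norm_div, norm_mul]
  refine ⟨η, hηc, hne.symm, ‖v‖ / ‖u‖, by positivity, ?_, fun z hz => ?_, fun z hz => ?_⟩
  · intro hk
    rw [div_eq_one_iff_eq hun.ne'] at hk
    rw [hk] at hnuv
    apply hu1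
    nlinarith
  · rw [d1, d2]
    have hw : 0 < ‖star b * (z : ℂ) + star a‖ := norm_pos_iff.2 (den_ne hc.1 z)
    have hzη : 0 < ‖(z : ℂ) - η‖ := by
      refine norm_pos_iff.2 (sub_ne_zero.2 fun e => ?_)
      have h3 : ‖(z : ℂ)‖ < 1 := hz
      rw [e, show ‖(η : ℂ)‖ = 1 from hηc] at h3
      exact lt_irrefl _ h3
    generalize ‖star b * (z : ℂ) + star a‖ = w at *
    field_simp
  · have hw : 0 < ‖star b * (z : ℂ) + star a‖ := norm_pos_iff.2 (den_ne hc.1 z)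
    have h3 := one_sub_norm_coef hc z
    have h4 := (mem_openDisc_iff z).1 hz
    have h5 := (mem_openDisc_iff _).1 (hh.mem_openDisc.2 hz)
    rw [d1, d2, ← h3]
    generalize ‖star b * (z : ℂ) + star a‖ = w at *
    generalize 1 - ‖((h z : CDisc) : ℂ)‖ ^ 2 = d at *
    generalize ‖u‖ = x at *
    generalize ‖v‖ = y at *
    field_simp
    linear_combination (-(‖(z : ℂ) - ξ‖ * ‖(z : ℂ) - η‖)) * hnuv

namespace Tiling

/-- A hyperbolic element cannot fix the endpoint of a ray in `R`. -/
theorem false_of_hyperbolic (T : Tiling G R) {h : Equiv.Perm CDisc} (hh : h ∈ G) {ξ η : CDisc}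
    (hξ : ξ ∈ unitCircle) (hη : η ∈ unitCircle) (hne : ξ ≠ η) {κ : ℝ} (hκ : 1 < κ)
    (hp : ∀ z ∈ openDisc, ‖((h z : CDisc) : ℂ) - ξ‖ / ‖((h z : CDisc) : ℂ) - η‖
        = κ * (‖(z : ℂ) - ξ‖ / ‖(z : ℂ) - η‖))
    (hq : ∀ z ∈ openDisc,
      ‖((h z : CDisc) : ℂ) - ξ‖ * ‖((h z : CDisc) : ℂ) - η‖ / (1 - ‖((h z : CDisc) : ℂ)‖ ^ 2)
        = ‖(z : ℂ) - ξ‖ * ‖(z : ℂ) - η‖ / (1 - ‖(z : ℂ)‖ ^ 2))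
    (hray : ∀ s, 0 ≤ s → s < 1 → scl s ξ ∈ R) : False := by
  have hξ1 : ‖(ξ : ℂ)‖ = 1 := hξ
  have hη1 : ‖(η : ℂ)‖ = 1 := hη
  have hκ0 : 0 < κ := by linarith
  have hmem : ∀ n z, z ∈ openDisc → (h ^ n) z ∈ openDisc := fun n z hz =>
    (T.moeb _ (G.pow_mem hh n)).mem_openDisc.2 hz
  have hpn : ∀ n : ℕ, ∀ z ∈ openDisc, ‖(((h ^ n) z : CDisc) : ℂ) - ξ‖ / ‖(((h ^ n) z : CDisc) : ℂ) - η‖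
        = κ ^ n * (‖(z : ℂ) - ξ‖ / ‖(z : ℂ) - η‖) := by
    intro n
    induction n with
    | zero => intro z _; simp
    | succ n ih =>
      intro z hz
      rw [pow_succ', Equiv.Perm.mul_apply, hp _ (hmem n z hz), ih z hz]
      ring
  have hqn : ∀ n : ℕ, ∀ z ∈ openDisc,
      ‖(((h ^ n) z : CDisc) : ℂ) - ξ‖ * ‖(((h ^ n) z : CDisc) : ℂ) - η‖ / (1 - ‖(((h ^ n) z : CDisc) : ℂ)‖ ^ 2)
        = ‖(z : ℂ) - ξ‖ * ‖(z : ℂ) - η‖ / (1 - ‖(z : ℂ)‖ ^ 2) := by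
    intro n
    induction n with
    | zero => intro z _; simp
    | succ n ih =>
      intro z hz
      rw [pow_succ', Equiv.Perm.mul_apply, hq _ (hmem n z hz), ih z hz]
  have hd : 0 < ‖(ξ : ℂ) - η‖ := norm_pos_iff.2 (sub_ne_zero.2 fun e => hne (Subtype.ext e))
  have hno : ∀ {z : CDisc}, z ∈ openDisc → 0 < ‖(z : ℂ) - η‖ := by
    intro z hz
    refine norm_pos_iff.2 (sub_ne_zero.2 fun e => ?_)
    have h3 : ‖(z : ℂ)‖ < 1 := hz
    rw [e, hη1] at h3
    exact lt_irrefl _ h3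
  -- A point `y` equidistant from `ξ` and `η` satisfies `|y - η| ≥ |ξ - η| / 2`. If also `|y - ξ| |y
  -- - η| ≤ 2 (1 - |y|²)`, then `|y| ≤ r`.
  set r := √(1 - ‖(ξ : ℂ) - η‖ ^ 2 / 8) with hr
  have hr1 : r < 1 := by
    rw [hr, Real.sqrt_lt' one_pos]
    have : 0 < ‖(ξ : ℂ) - η‖ ^ 2 := by positivity
    linarith
  -- On the ray in `R` there is a point whose distance ratio is `κ^(-n)`; its image under `h^n` is
  -- equidistant from `ξ` and `η`. The second quantity is invariant and at most `2` on the ray. So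
  -- infinitely many tiles would meet one compact disc.
  have hmeet : ∀ n : ℕ, h ^ n ∈ meeting G R r := by
    intro n
    obtain ⟨s, hs, hsp⟩ : ∃ s ∈ Icc (0 : ℝ) 1, ‖((scl s ξ : CDisc) : ℂ) - ξ‖
        - (κ ^ n)⁻¹ * ‖((scl s ξ : CDisc) : ℂ) - η‖ = 0 := by
      have hcont : Continuous fun s => ‖((scl s ξ : CDisc) : ℂ) - ξ‖
        - (κ ^ n)⁻¹ * ‖((scl s ξ : CDisc) : ℂ) - η‖ := by
        have := continuous_subtype_val.comp (continuous_scl ξ)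
        exact (this.sub continuous_const).norm.sub
          (continuous_const.mul (this.sub continuous_const).norm)
      have := intermediate_value_Icc' (zero_le_one' ℝ) hcont.continuousOn
      apply this
      constructor
      · simp only [scl_one, sub_self, norm_zero, zero_sub]
        have : 0 ≤ (κ ^ n)⁻¹ * ‖(ξ : ℂ) - η‖ := by positivity
        linarith
      · simp only [scl_zero, origin, zero_sub, norm_neg, hξ1, hη1, mul_one, sub_nonneg]
        exact inv_le_one_of_one_le₀ (one_le_pow₀ hκ.le)
    have hs1 : s < 1 := by
      refine lt_of_le_of_ne hs.2 ?_
      rintro rfl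
      rw [scl_one, sub_self, norm_zero, zero_sub, neg_eq_zero] at hsp
      exact (mul_pos (inv_pos.2 (pow_pos hκ0 n)) hd).ne' hsp
    set z := scl s ξ with hz
    have hzD : z ∈ openDisc := scl_mem hs.1 hs1 ξ
    set y := (h ^ n) z with hy
    have hyD : y ∈ openDisc := hmem n z hzD
    refine ⟨G.pow_mem hh n, y, mem_image_of_mem _ (hray s hs.1 hs1), ?_⟩
    have p1 := hpn n z hzD
    have hzη := hno hzD
    have hyη := hno hyD
    have p2 : ‖(z : ℂ) - ξ‖ / ‖(z : ℂ) - η‖ = (κ ^ n)⁻¹ := by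
      rw [div_eq_iff hzη.ne']; linarith
    rw [p2, mul_inv_cancel₀ (pow_pos hκ0 n).ne', ← hy, div_eq_one_iff_eq hyη.ne'] at p1
    have q1 := hqn n z hzD
    rw [← hy, p1] at q1
    have hzn : ‖(z : ℂ)‖ = s := by rw [hz, norm_scl hs.1 hs.2, hξ1, mul_one]
    have hzξ : ‖(z : ℂ) - ξ‖ = 1 - s := by
      rw [hz, scl_coe hs.1 hs.2, show (s : ℂ) * ξ - ξ = ((s - 1 : ℝ) : ℂ) * ξ by push_cast; ring,
        norm_mul, hξ1, mul_one, Complex.norm_real, Real.norm_eq_abs, abs_of_nonpos (by linarith)]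
      ring
    have hzη2 : ‖(z : ℂ) - η‖ ≤ 2 := by
      refine (norm_sub_le _ _).trans ?_
      rw [hzn, hη1]; linarith
    have hle : ‖(z : ℂ) - ξ‖ * ‖(z : ℂ) - η‖ / (1 - ‖(z : ℂ)‖ ^ 2) ≤ 2 := by
      rw [hzξ, hzn, div_le_iff₀ (by nlinarith [hs.1])]
      nlinarith [hs.1]
    have hyp := (mem_openDisc_iff y).1 hyD
    rw [← q1, div_le_iff₀ hyp] at hle
    have htri : ‖(ξ : ℂ) - η‖ ≤ 2 * ‖(y : ℂ) - η‖ := by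
      have : (ξ : ℂ) - η = ((y : ℂ) - η) - (y - ξ) := by ring
      rw [this]
      refine (norm_sub_le _ _).trans ?_
      rw [p1]; linarith
    change ‖(y : ℂ)‖ ≤ r
    rw [hr]
    apply Real.le_sqrt_of_sq_le
    nlinarith
  have hinj : Function.Injective fun n : ℕ => h ^ n := by
    intro m n hmn
    have h1 := hpn m origin origin_mem_openDisc
    have h2 := hpn n origin origin_mem_openDisc
    rw [show h ^ m = h ^ n from hmn, h2] at h1
    have : ‖(origin : ℂ) - ξ‖ / ‖(origin : ℂ) - η‖ = 1 := by simp [origin, hξ1, hη1]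
    rw [this, mul_one, mul_one] at h1
    exact (pow_right_injective₀ hκ0 hκ.ne' h1).symm
  exact infinite_of_injective_forall_mem hinj hmeet (T.finite_meeting hr1)

theorem false_of_fixed (T : Tiling G R) {h : Equiv.Perm CDisc} (hh : h ∈ G) (h1 : h ≠ 1)
    (hpar : ¬ IsParabolic h) {ξ : CDisc} (hξ : ξ ∈ unitCircle) (hfix : h ξ = ξ)
    (hray : ∀ s, 0 ≤ s → s < 1 → scl s ξ ∈ R) : False := by
  obtain ⟨η, hη, hne, κ, hκ, hκ1, hp, hq⟩ := exists_hyperbolic (T.moeb h hh) h1 hpar hξ hfix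
  rcases lt_or_gt_of_ne hκ1 with hlt | hgt
  · have hinv : ∀ z, h (h⁻¹ z) = z := fun z => h.apply_symm_apply z
    refine T.false_of_hyperbolic (G.inv_mem hh) hξ hη hne (κ := κ⁻¹) (one_lt_inv_iff₀.2 ⟨hκ, hlt⟩)
      (fun z hz => ?_) (fun z hz => ?_) hray
    · have := hp (h⁻¹ z) ((T.moeb _ (G.inv_mem hh)).mem_openDisc.2 hz)
      rw [hinv] at this
      rw [this, inv_mul_cancel_left₀ hκ.ne']
    · have := hq (h⁻¹ z) ((T.moeb _ (G.inv_mem hh)).mem_openDisc.2 hz)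
      rw [hinv] at this
      exact this.symm
  · exact T.false_of_hyperbolic hh hξ hη hne hgt hp hq hray

end Tiling

/-- The points at infinity that lie on the inner side of each side of `R`. -/
def ideal (G : Subgroup (Equiv.Perm CDisc)) (R : Set CDisc) : Set CDisc :=
  {ξ | ξ ∈ unitCircle ∧ ∀ e ∈ sidePairings G R, ∀ l, Defines l (Tiling.sideWall G R e) →
    0 < ev l origin → 0 ≤ ev l ξ}

theorem origin_notMem_unitCircle : origin ∉ unitCircle := by
  simp [unitCircle, origin]

namespace Tiling

theorem ray_of_ideal (T : Tiling G R) {ξ : CDisc} (hξ : ξ ∈ ideal G R) {s : ℝ} (h0 : 0 ≤ s)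
    (h1 : s < 1) : scl s ξ ∈ R := by
  by_contra hn
  obtain ⟨e, he, l, hl, hl0, hneg⟩ := T.exists_side_of_not_mem (scl_mem h0 h1 ξ) hn
  have h2 := hξ.2 e he l hl hl0
  have h3 := CDisc.norm_le ξ
  rw [ev_scl h0 h1.le] at hneg
  have h4 : 0 ≤ (1 - s) * (1 - s * ‖(ξ : ℂ)‖ ^ 2) := by
    apply mul_nonneg (by linarith)
    nlinarith [norm_nonneg (ξ : ℂ)]
  nlinarith [mul_nonneg h0 h2, mul_nonneg hl0.le h4]

theorem ideal_subset_closure (T : Tiling G R) {ξ : CDisc} (hξ : ξ ∈ ideal G R) : ξ ∈ closure R := by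
  refine mem_closure_of_tendsto (tendsto_scl_one ξ) ?_
  filter_upwards [Ioo_mem_nhdsLT (zero_lt_one' ℝ)] with s hs
  exact T.ray_of_ideal hξ hs.1.le hs.2

/-- Otherwise a whole neighbourhood of `ξ` would be strictly inside all of the finitely many sides.
But `ξ` is a limit of orbit points `g 0` with `g ≠ 1`, and each of them lies behind a side. -/
theorem exists_sideWall_nonpos (T : Tiling G R) (hE : (sidePairings G R).Finite)
    (hfirst : IsFirstKind G) {ξ : CDisc} (hξ : ξ ∈ unitCircle) :
    ∃ e ∈ sidePairings G R, ∃ l, Defines l (sideWall G R e) ∧ 0 < ev l origin ∧ ev l ξ ≤ 0 := by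
  by_contra hcon
  push Not at hcon
  have hex : ∀ e, ∃ l, e ∈ sidePairings G R → Defines l (sideWall G R e) ∧ 0 < ev l origin := by
    intro e
    by_cases he : e ∈ sidePairings G R
    · obtain ⟨l, h1, h2⟩ := T.exists_defines_pos (T.sideWall_mem_walls he) G.one_mem
      exact ⟨l, fun _ => ⟨h1, h2⟩⟩
    · exact ⟨0, fun h => absurd h he⟩
  choose l hl using hex
  have hopen : IsOpen ((⋂ e ∈ sidePairings G R, {z | 0 < ev (l e) z}) ∩ {origin}ᶜ) := by
    refine IsOpen.inter ?_ isOpen_compl_singleton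
    exact hE.isOpen_biInter fun e _ => isOpen_lt continuous_const (continuous_ev _)
  have hcl : ξ ∈ closure {z | ∃ g ∈ G, z = g origin} := by
    have : ξ ∈ limitSet G := by rw [hfirst]; exact hξ
    exact this.2
  obtain ⟨_, ⟨h1, h2⟩, g, hg, rfl⟩ := mem_closure_iff.1 hcl _ hopen
    ⟨mem_iInter₂.2 fun e he => hcon e he (l e) (hl e he).1 (hl e he).2,
      fun h => origin_notMem_unitCircle (by rw [mem_singleton_iff] at h; rwa [← h])⟩
  have hg1 : g ≠ 1 := by rintro rfl; exact h2 rfl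
  obtain ⟨e, he, hs⟩ := T.exists_sideWall_mem_sep hg hg1
  rw [mem_sep_one_iff (T.sideWall_mem_walls he) (hl e he).1 (hl e he).2] at hs
  have := mem_iInter₂.1 h1 e he
  exact lt_asymm hs this

theorem exists_sideWall_germ (T : Tiling G R) (hE : (sidePairings G R).Finite)
    (hfirst : IsFirstKind G) {ξ : CDisc} (hξ : ξ ∈ unitCircle) :
    ∃ e ∈ sidePairings G R, ∃ l, Defines l (sideWall G R e) ∧ 0 < ev l origin ∧
      GermPos (-l) ξ := by
  by_contra hcon
  push Not at hcon
  have h1 : ∀ e ∈ sidePairings G R, ∀ᶠ s in 𝓝[>] (0 : ℝ), ∀ l, Defines l (sideWall G R e) →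
      0 < ev l origin → 0 < ev l (rot s ξ) := by
    intro e he
    obtain ⟨l, hl, hl0⟩ := T.exists_defines_pos (T.sideWall_mem_walls he) G.one_mem
    filter_upwards [(germPos_or hl.1 hξ).resolve_right (hcon e he l hl hl0)] with s hs m hm hm0
    obtain ⟨r, hr, rfl⟩ := hl.unique (T.sideWall_mem_walls he).1 hm
    rw [ev_smul] at hm0 ⊢
    exact mul_pos (pos_of_mul_pos_left hm0 (le_of_lt hl0)) hs
  obtain ⟨s, hs⟩ := ((eventually_all_finite hE).2 h1).exists
  obtain ⟨e, he, l, hl, hl0, hle⟩ := T.exists_sideWall_nonpos hE hfirst (rot_mem (s := s) hξ)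
  exact absurd (hs e he l hl hl0) (not_lt.2 hle)

theorem finite_ideal (T : Tiling G R) (hE : (sidePairings G R).Finite)
    (hfirst : IsFirstKind G) : (ideal G R).Finite := by
  have hex : ∀ e, ∃ l, l ≠ 0 ∧ (e ∈ sidePairings G R → Defines l (sideWall G R e)) := by
    intro e
    by_cases he : e ∈ sidePairings G R
    · obtain ⟨l, h1, h2⟩ := T.exists_defines_pos (T.sideWall_mem_walls he) G.one_mem
      exact ⟨l, h1.1, fun _ => h1⟩
    · exact ⟨(1, 0), by simp, fun h => absurd h he⟩
  choose l hl0 hl using hex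
  refine (hE.biUnion fun e _ => finite_zeros_circle (hl0 e)).subset fun ξ hξ => ?_
  obtain ⟨e, he, m, hm, hm0, hle⟩ := T.exists_sideWall_nonpos hE hfirst hξ.1
  have h0 : ev m ξ = 0 := le_antisymm hle (hξ.2 e he m hm hm0)
  obtain ⟨r, hr, rfl⟩ := (hl e he).unique (T.sideWall_mem_walls he).1 hm
  rw [ev_smul] at h0
  exact mem_biUnion he ⟨hξ.1, (mul_eq_zero.1 h0).resolve_left hr⟩

/-- Crossing the side that ends at `ξ` leads to a tile which again has `ξ` at infinity: any wall of
a side of `e R` except the common one has `R` and `e R` on the same side, and `ξ` is in the closure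
of `R`. -/
theorem ideal_step (T : Tiling G R) {ξ : CDisc} (hξ : ξ ∈ ideal G R) {e : Equiv.Perm CDisc}
    (he : e ∈ sidePairings G R) {l : ℝ × ℂ} (hl : Defines l (sideWall G R e))
    (hl0 : 0 < ev l origin) (hg : GermPos (-l) ξ) : e⁻¹ ξ ∈ ideal G R := by
  have h0 : ev l ξ = 0 := by
    have h1 := hξ.2 e he l hl hl0
    have h2 := hg.nonneg
    rw [ev_neg] at h2
    linarith
  refine ⟨(T.moeb _ (G.inv_mem he.1)).mem_unitCircle.2 hξ.1, fun e' he' l' hl' hl'0 => ?_⟩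
  by_contra hn
  push Not at hn
  obtain ⟨m, hm, hmp⟩ := hl'.push (T.moeb e he.1)
  have hmw : e '' sideWall G R e' ∈ walls G R := T.image_wall (T.sideWall_mem_walls he') he.1
  have hme : 0 < ev m (e origin) := by
    obtain ⟨c, hc, h⟩ := hmp origin
    rw [h]; positivity
  have hmξ : ev m ξ < 0 := by
    obtain ⟨c, hc, h⟩ := hmp (e⁻¹ ξ)
    rw [show e (e⁻¹ ξ) = ξ from e.apply_symm_apply ξ] at h
    rw [h]; exact mul_neg_of_pos_of_neg hc hn
  have hns : e '' sideWall G R e' ∉ sep G R 1 e := by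
    rw [T.sep_side he]
    intro hmem
    rw [mem_singleton_iff] at hmem
    rw [hmem] at hm
    obtain ⟨r, hr, rfl⟩ := hl.unique (T.sideWall_mem_walls he).1 hm
    rw [ev_smul, h0, mul_zero] at hmξ
    exact lt_irrefl _ hmξ
  have hm0 := T.not_mem_sep_iff hmw hm G.one_mem hns hme
  have := T.ev_nonneg hmw hm G.one_mem hm0 (x := ξ) (by
    rw [show (⇑(1 : Equiv.Perm CDisc)) '' R = R from image_id R]
    exact T.ideal_subset_closure hξ)
  linarith

theorem toward_mul (T : Tiling G R) {ξ : CDisc} (hξ : ξ ∈ unitCircle) {g e : Equiv.Perm CDisc}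
    (hg : Toward G R ξ g) (he : e ∈ sidePairings G R) {l : ℝ × ℂ} (hl : Defines l (sideWall G R e))
    (h0 : 0 < ev l origin) (hpos : GermPos (-l) (g⁻¹ ξ)) :
    Toward G R ξ (g * e) ∧ (sep G R 1 (g * e)).ncard = (sep G R 1 g).ncard + 1 := by
  obtain ⟨m, hm, hmp⟩ := hl.neg.push (T.moeb g hg.1)
  refine T.toward_step hg he hm ?_ ?_
  · obtain ⟨c, hc, h⟩ := hmp (e origin)
    rw [Equiv.Perm.mul_apply, h, ev_neg]
    have := (mem_sep_one_iff (T.sideWall_mem_walls he) hl h0 e).1 (T.sideWall_mem he)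
    nlinarith
  · have := germPos_map (T.moeb g hg.1) ((T.moeb _ (G.inv_mem hg.1)).mem_unitCircle.2 hξ) hmp hpos
    rwa [show g (g⁻¹ ξ) = ξ from g.apply_symm_apply ξ] at this

/-- Turning around `ξ` from tile to tile yields infinitely many `g` with `g⁻¹ ξ` in the finite set
of ideal points. Two of these points agree, so a nontrivial element fixes `ξ`. It is not parabolic,
hence hyperbolic, and this is impossible because `R` contains a ray ending at `ξ`. -/
theorem ideal_eq_empty (T : Tiling G R) (hE : (sidePairings G R).Finite)
    (hfirst : IsFirstKind G) (hpar : ∀ g ∈ G, ¬ IsParabolic g) : ideal G R = ∅ := by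
  rw [eq_empty_iff_forall_notMem]
  intro ξ hξ
  have hseq : ∀ n : ℕ, ∃ g, Toward G R ξ g ∧ (sep G R 1 g).ncard = n ∧ g⁻¹ ξ ∈ ideal G R := by
    intro n
    induction n with
    | zero => exact ⟨1, toward_one ξ, by rw [sep_self, ncard_empty], hξ⟩
    | succ n ih =>
      obtain ⟨g, h1, h2, h3⟩ := ih
      obtain ⟨e, he, l, hl, hl0, hp⟩ := T.exists_sideWall_germ hE hfirst h3.1
      obtain ⟨h4, h5⟩ := T.toward_mul hξ.1 h1 he hl hl0 hp
      refine ⟨g * e, h4, by rw [h5, h2], ?_⟩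
      rw [mul_inv_rev]
      exact T.ideal_step h3 he hl hl0 hp
  choose k hk1 hk2 hk3 using hseq
  obtain ⟨i, _, j, _, hij, heq⟩ := infinite_univ.exists_ne_map_eq_of_mapsTo
    (f := fun n => (k n)⁻¹ ξ) (fun n _ => hk3 n) (T.finite_ideal hE hfirst)
  have hne : k i * (k j)⁻¹ ≠ 1 := by
    intro h
    rw [mul_inv_eq_one] at h
    apply hij
    rw [← hk2 i, ← hk2 j, h]
  have hmem : k i * (k j)⁻¹ ∈ G := G.mul_mem (hk1 i).1 (G.inv_mem (hk1 j).1)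
  refine T.false_of_fixed hmem hne (hpar _ hmem) hξ.1 ?_ fun s h0 h1 => T.ray_of_ideal hξ h0 h1
  have heq' : (k i)⁻¹ ξ = (k j)⁻¹ ξ := heq
  rw [Equiv.Perm.mul_apply, ← heq']
  exact (k i).apply_symm_apply ξ

/-- Each point at infinity is strictly cut off by a side. -/
theorem exists_sideWall_neg (T : Tiling G R) (hE : (sidePairings G R).Finite)
    (hfirst : IsFirstKind G) (hpar : ∀ g ∈ G, ¬ IsParabolic g) {ξ : CDisc} (hξ : ξ ∈ unitCircle) :
    ∃ e ∈ sidePairings G R, ∃ l, Defines l (sideWall G R e) ∧ 0 < ev l origin ∧ ev l ξ < 0 := by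
  by_contra hcon
  push Not at hcon
  have : ξ ∈ ideal G R := ⟨hξ, hcon⟩
  rw [T.ideal_eq_empty hE hfirst hpar] at this
  exact this.elim

end Tiling

/-! ### Displacement of the origin and derivative on the circle. -/

theorem Coef.norm_sub_pos {g : Equiv.Perm CDisc} {a b : ℂ} (h : Coef g a b) :
    (‖a‖ + ‖b‖) * (‖a‖ - ‖b‖) = 1 := by
  linear_combination h.1

theorem Coef.one_le {g : Equiv.Perm CDisc} {a b : ℂ} (h : Coef g a b) : 1 ≤ ‖a‖ := by
  have := h.1
  nlinarith [norm_nonneg a, sq_nonneg ‖b‖]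

theorem Coef.apply_origin {g : Equiv.Perm CDisc} {a b : ℂ} (h : Coef g a b) :
    ((g origin : CDisc) : ℂ) = b / star a := by
  rw [h.2]; simp [origin]

/-- Half the distance has hyperbolic sine `|b|` and hyperbolic cosine `|a|`. -/
theorem Coef.hdist_origin {g : Equiv.Perm CDisc} {a b : ℂ} (h : Coef g a b) :
    hdist origin (g origin) = 2 * Real.log (‖a‖ + ‖b‖) := by
  have ha : 0 < ‖a‖ := by linarith [h.one_le]
  have h1 : 1 - ‖((g origin : CDisc) : ℂ)‖ ^ 2 = (1 / ‖a‖) ^ 2 := by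
    rw [h.apply_origin, norm_div, norm_star]
    field_simp
    exact h.1
  have h2 : ‖((origin : CDisc) : ℂ) - (g origin : CDisc)‖ = ‖b‖ / ‖a‖ := by
    rw [h.apply_origin]
    simp [origin]
  unfold hdist
  rw [h1, h2]
  simp only [origin, norm_zero]
  rw [show (1 - (0 : ℝ) ^ 2) * (1 / ‖a‖) ^ 2 = (1 / ‖a‖) ^ 2 by ring, Real.sqrt_sq (by positivity),
    div_div_div_cancel_right₀ ha.ne', div_one, Real.arsinh,
    show 1 + ‖b‖ ^ 2 = ‖a‖ ^ 2 by linarith [h.1], Real.sqrt_sq ha.le, add_comm]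

/-- `|a| + |b|` is the operator norm of the coefficient matrix, hence submultiplicative. -/
theorem hdist_origin_mul_le {g h : Equiv.Perm CDisc} (hg : IsDiscMoebius g) (hh : IsDiscMoebius h) :
    hdist origin ((g * h) origin) ≤ hdist origin (g origin) + hdist origin (h origin) := by
  obtain ⟨a, b, hc⟩ := hg.coef
  obtain ⟨c, d, hd⟩ := hh.coef
  have hm := hc.mul hd
  rw [hc.hdist_origin, hd.hdist_origin, hm.hdist_origin, ← mul_add]
  have h1 := hc.one_le
  have h2 := hd.one_le
  have h3 := hm.one_le
  have hb := norm_nonneg b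
  have hd' := norm_nonneg d
  rw [← Real.log_mul (by positivity) (by positivity)]
  have e1 : ‖a * c + b * star d‖ ≤ ‖a‖ * ‖c‖ + ‖b‖ * ‖d‖ := by
    refine (norm_add_le _ _).trans ?_
    rw [norm_mul, norm_mul, norm_star]
  have e2 : ‖a * d + b * star c‖ ≤ ‖a‖ * ‖d‖ + ‖b‖ * ‖c‖ := by
    refine (norm_add_le _ _).trans ?_
    rw [norm_mul, norm_mul, norm_star]
  have : Real.log (‖a * c + b * star d‖ + ‖a * d + b * star c‖)
      ≤ Real.log ((‖a‖ + ‖b‖) * (‖c‖ + ‖d‖)) := by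
    apply Real.log_le_log
    · have := norm_nonneg (a * d + b * star c)
      linarith
    · linarith
  linarith

theorem hdist_origin_inv {g : Equiv.Perm CDisc} (hg : IsDiscMoebius g) :
    hdist origin (g⁻¹ origin) = hdist origin (g origin) := by
  obtain ⟨a, b, hc⟩ := hg.coef
  rw [hc.hdist_origin, hc.inv.hdist_origin, norm_star, norm_neg]

/-- The absolute value of the derivative of a Möbius transformation at a point. -/
def absDeriv (g : Equiv.Perm CDisc) (ξ : CDisc) : ℝ := ‖moebiusDeriv g ξ‖

theorem Coef.hasDerivAt {a b : ℂ} {g : Equiv.Perm CDisc} (h : Coef g a b) (ξ : CDisc) :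
    HasDerivAt (fun z : ℂ => (a * z + b) / (star b * z + star a))
      (1 / (star b * (ξ : ℂ) + star a) ^ 2) ξ := by
  have hd := den_ne h.1 ξ
  have h1 : HasDerivAt (fun z : ℂ => a * z + b) a ξ := by
    simpa using ((hasDerivAt_id (ξ : ℂ)).const_mul a).add_const b
  have h2 : HasDerivAt (fun z : ℂ => star b * z + star a) (star b) ξ := by
    simpa using ((hasDerivAt_id (ξ : ℂ)).const_mul (star b)).add_const (star a)
  refine (h1.div h2 hd).congr_deriv ?_
  congr 1
  linear_combination det_eq h.1

theorem Coef.moebiusDeriv {a b : ℂ} {g : Equiv.Perm CDisc} (h : Coef g a b) (ξ : CDisc) :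
    moebiusDeriv g ξ = 1 / (star b * (ξ : ℂ) + star a) ^ 2 := by
  have hu : UniqueDiffWithinAt ℂ (Metric.closedBall (0 : ℂ) 1) (ξ : ℂ) := by
    have : UniqueDiffOn ℝ (Metric.closedBall (0 : ℂ) 1) := by
      refine uniqueDiffOn_convex (convex_closedBall _ _) ?_
      rw [interior_closedBall _ one_ne_zero]
      exact ⟨0, by simp⟩
    exact (this ξ ξ.2).mono_field
  refine HasDerivWithinAt.derivWithin ?_ hu
  refine ((h.hasDerivAt ξ).hasDerivWithinAt (s := Metric.closedBall (0 : ℂ) 1)).congr ?_ ?_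
  · intro z hz
    rw [← h.2 ⟨z, hz⟩]
    exact Subtype.val_injective.extend_apply _ _ (⟨z, hz⟩ : CDisc)
  · rw [← h.2 ξ]
    exact Subtype.val_injective.extend_apply _ _ ξ

theorem Coef.absDeriv {a b : ℂ} {g : Equiv.Perm CDisc} (h : Coef g a b) (ξ : CDisc) :
    absDeriv g ξ = 1 / ‖star b * (ξ : ℂ) + star a‖ ^ 2 := by
  unfold HypDisc.absDeriv
  rw [h.moebiusDeriv, norm_div, norm_one, norm_pow]

theorem circleAbsDeriv_eq {F : CDisc → CDisc} {g : Equiv.Perm CDisc} (hg : IsDiscMoebius g)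
    {ξ : CDisc} (hξ : ξ ∈ unitCircle) (hF : ∀ᶠ s in 𝓝[≥] (0 : ℝ), F (rot s ξ) = g (rot s ξ)) :
    circleAbsDeriv F ξ = absDeriv g ξ := by
  obtain ⟨a, b, hc⟩ := hg.coef
  have h0 : F (rot 0 ξ) = g (rot 0 ξ) := hF.self_of_nhdsWithin self_mem_Ici
  have hrot : HasDerivAt (fun θ : ℝ => (ξ : ℂ) * Complex.exp (θ * Complex.I))
      ((ξ : ℂ) * Complex.I) 0 := by
    have h1 : HasDerivAt (fun θ : ℝ => (θ : ℂ) * Complex.I) Complex.I 0 := by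
      simpa using (Complex.ofRealCLM.hasDerivAt (x := (0 : ℝ))).mul_const Complex.I
    have h2 := h1.cexp.const_mul (ξ : ℂ)
    simpa using h2
  have hcomp : HasDerivAt (fun θ : ℝ => ((g (rot θ ξ) : CDisc) : ℂ))
      (1 / (star b * (ξ : ℂ) + star a) ^ 2 * ((ξ : ℂ) * Complex.I)) 0 := by
    have h3 : HasDerivAt (fun z : ℂ => (a * z + b) / (star b * z + star a))
      (1 / (star b * (ξ : ℂ) + star a) ^ 2) ((ξ : ℂ) * Complex.exp ((0 : ℝ) * Complex.I)) := by
      convert hc.hasDerivAt ξ using 1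
      simp
    have := h3.comp (0 : ℝ) hrot
    refine this.congr_of_eventuallyEq (Eventually.of_forall fun θ => ?_)
    simp only [Function.comp]
    rw [hc.2]; rfl
  have hd : HasDerivWithinAt (fun θ : ℝ => ((F (rot θ ξ) : CDisc) : ℂ))
      (1 / (star b * (ξ : ℂ) + star a) ^ 2 * ((ξ : ℂ) * Complex.I)) (Ici 0) 0 := by
    refine hcomp.hasDerivWithinAt.congr_of_eventuallyEq ?_ (by rw [h0])
    filter_upwards [hF] with s hs
    rw [hs]
  unfold circleAbsDeriv
  rw [hd.derivWithin (uniqueDiffWithinAt_Ici _), hc.absDeriv, norm_mul, norm_mul,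
    show ‖(ξ : ℂ)‖ = 1 from hξ, Complex.norm_I, norm_div, norm_one, norm_pow]
  ring

/-- The distance estimate for the derivative, in terms of the visual distance. -/
theorem abs_growth_sub_le {g : Equiv.Perm CDisc} (hg : IsDiscMoebius g) {ξ : CDisc}
    (hξ : ξ ∈ unitCircle) {δ : ℝ} (hδ : 0 < δ)
    (h : δ ≤ ‖((g⁻¹ origin : CDisc) : ℂ) - (g⁻¹ ξ : CDisc)‖) :
    |hdist origin (g origin) - Real.log (absDeriv g⁻¹ ξ)| ≤ 2 * Real.log (2 / δ) := by
  obtain ⟨a, b, hc⟩ := hg.inv.coef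
  have ha := hc.one_le
  have hb := norm_nonneg b
  have hw : 0 < ‖star b * (ξ : ℂ) + star a‖ := norm_pos_iff.2 (den_ne hc.1 ξ)
  rw [← hdist_origin_inv hg, hc.hdist_origin, hc.absDeriv]
  have hξ1 : ‖(ξ : ℂ)‖ = 1 := hξ
  have h1 := sub_coef hc origin ξ
  rw [h1] at h
  simp only [origin, mul_zero, zero_add, zero_sub, norm_div, norm_neg, norm_mul, norm_star,
    hξ1] at h
  have hlow : ‖a‖ - ‖b‖ ≤ ‖star b * (ξ : ℂ) + star a‖ := by
    have : ‖star a‖ ≤ ‖star b * (ξ : ℂ) + star a‖ + ‖star b * (ξ : ℂ)‖ := by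
      have e : star a = (star b * (ξ : ℂ) + star a) - star b * (ξ : ℂ) := by ring
      calc ‖star a‖ = ‖(star b * (ξ : ℂ) + star a) - star b * (ξ : ℂ)‖ := by rw [← e]
        _ ≤ _ := norm_sub_le _ _
    rw [norm_mul, norm_star, norm_star, hξ1, mul_one] at this
    linarith
  have hprod := hc.norm_sub_pos
  generalize ‖star b * (ξ : ℂ) + star a‖ = w at *
  have hs : 0 < ‖a‖ + ‖b‖ := by linarith
  have hba : ‖b‖ ≤ ‖a‖ := by nlinarith
  rw [le_div_iff₀ (by positivity)] at h
  rw [Real.log_div one_ne_zero (by positivity), Real.log_one, Real.log_pow, zero_sub, sub_neg_eq_add]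
  -- The difference to be bounded is `2 log ((|a| + |b|) w)`. From below, `w ≥ |a| - |b| = 1 / (|a|
  -- + |b|)`; from above, `δ |a| w ≤ 1` by the hypothesis on the visual distance, and `|b| ≤ |a|`.
  have hlog : 2 * Real.log (‖a‖ + ‖b‖) + (2 : ℕ) * Real.log w = 2 * Real.log ((‖a‖ + ‖b‖) * w) := by
    rw [Real.log_mul hs.ne' hw.ne']; push_cast; ring
  rw [hlog]
  have hge : 1 ≤ (‖a‖ + ‖b‖) * w := by nlinarith
  rw [abs_of_nonneg (by have := Real.log_nonneg hge; linarith)]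
  have hle : (‖a‖ + ‖b‖) * w ≤ 2 / δ := by
    rw [le_div_iff₀ hδ]
    nlinarith [mul_pos hw hδ]
  have := Real.log_le_log (by linarith) hle
  linarith

theorem exists_le_of_injective {X : Type*} [MetricSpace X] [CompactSpace X] {f : X → ℂ}
    (hf : Continuous f) (hinj : Function.Injective f) {δ : ℝ} (hδ : 0 < δ) :
    ∃ c > 0, ∀ x y, δ ≤ dist x y → c ≤ ‖f x - f y‖ := by
  have hcomp : IsCompact {p : X × X | δ ≤ dist p.1 p.2} :=
    (isClosed_le continuous_const (continuous_fst.dist continuous_snd)).isCompact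
  have hcont : Continuous fun p : X × X => ‖f p.1 - f p.2‖ := by fun_prop
  rcases {p : X × X | δ ≤ dist p.1 p.2}.eq_empty_or_nonempty with h | h
  · refine ⟨1, one_pos, fun x y hxy => ?_⟩
    have : (x, y) ∈ {p : X × X | δ ≤ dist p.1 p.2} := hxy
    rw [h] at this; exact this.elim
  · obtain ⟨p, hp, hmin⟩ := hcomp.exists_isMinOn h hcont.continuousOn
    refine ⟨‖f p.1 - f p.2‖, norm_pos_iff.2 (sub_ne_zero.2 fun e => ?_), fun x y hxy =>
      isMinOn_iff.1 hmin (x, y) hxy⟩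
    have h1 : δ ≤ dist p.1 p.2 := hp
    rw [hinj e, dist_self] at h1
    linarith

/-! ### Uniform estimates from compactness. -/

namespace Tiling

/-- The open outer half planes of the sides cover the compact circle; `δ` is a Lebesgue number of
this cover. -/
theorem exists_lebesgue (T : Tiling G R) (hE : (sidePairings G R).Finite)
    (hfirst : IsFirstKind G) (hpar : ∀ g ∈ G, ¬ IsParabolic g) :
    ∃ δ > 0, ∀ ξ ∈ unitCircle, ∃ e ∈ sidePairings G R, ∃ l, Defines l (sideWall G R e) ∧
      0 < ev l origin ∧ ∀ z, dist z ξ < δ → ev l z < 0 := by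
  have hc : IsCompact unitCircle := (isClosed_eq (by fun_prop) continuous_const).isCompact
  obtain ⟨δ, hδ, h⟩ := lebesgue_number_lemma_of_metric hc
    (ι := {l : ℝ × ℂ // ∃ e ∈ sidePairings G R, Defines l (sideWall G R e) ∧ 0 < ev l origin})
    (c := fun l => {z | ev l.1 z < 0}) (fun l => isOpen_lt (continuous_ev _) continuous_const) (by
      intro ξ hξ
      obtain ⟨e, he, l, hl, h0, h1⟩ := T.exists_sideWall_neg hE hfirst hpar hξ
      exact mem_iUnion.2 ⟨⟨l, e, he, hl, h0⟩, h1⟩)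
  refine ⟨δ, hδ, fun ξ hξ => ?_⟩
  obtain ⟨⟨l, e, he, hl, h0⟩, h1⟩ := h ξ hξ
  exact ⟨e, he, l, hl, h0, fun z hz => h1 hz⟩

/-- Seen from the centre of `g R`, the points `0` and `ξ` are not close to each other, if `g R` lies
on the way to `ξ`. -/
theorem exists_le_norm_of_toward (T : Tiling G R) (hE : (sidePairings G R).Finite)
    (hfirst : IsFirstKind G) (hpar : ∀ g ∈ G, ¬ IsParabolic g) :
    ∃ δ > 0, ∀ ξ ∈ unitCircle, ∀ g, Toward G R ξ g →
      δ ≤ ‖((g⁻¹ origin : CDisc) : ℂ) - (g⁻¹ ξ : CDisc)‖ := by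
  obtain ⟨δ, hδ, h⟩ := T.exists_lebesgue hE hfirst hpar
  refine ⟨δ, hδ, fun ξ hξ g hg => ?_⟩
  by_contra hlt
  push Not at hlt
  have hm := T.moeb g hg.1
  -- If the two points were closer than `δ`, a single side of `g R` would cut both the origin and
  -- `ξ` off from `g 0`. Its wall separates `1` from `g` with `ξ` on the wrong side.
  obtain ⟨e, he, l, hl, h0, hneg⟩ := h (g⁻¹ ξ) (hm.inv.mem_unitCircle.2 hξ)
  have h1 := hneg (g⁻¹ origin) (by rwa [Subtype.dist_eq, dist_eq_norm])
  have h2 := hneg (g⁻¹ ξ) (by rwa [dist_self])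
  obtain ⟨l', hl', hp⟩ := hl.push hm
  have hw : g '' sideWall G R e ∈ walls G R := T.image_wall (T.sideWall_mem_walls he) hg.1
  have e1 : 0 < ev l' (g origin) := by
    obtain ⟨m, hm, h⟩ := hp origin
    rw [h]; positivity
  have e2 : ev l' origin < 0 := by
    obtain ⟨m, hm, h⟩ := hp (g⁻¹ origin)
    rw [show g (g⁻¹ origin) = origin from g.apply_symm_apply _] at h
    rw [h]; exact mul_neg_of_pos_of_neg hm h1
  have e3 : ev l' ξ < 0 := by
    obtain ⟨m, hm, h⟩ := hp (g⁻¹ ξ)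
    rw [show g (g⁻¹ ξ) = ξ from g.apply_symm_apply _] at h
    rw [h]; exact mul_neg_of_pos_of_neg hm h2
  have hs : g '' sideWall G R e ∈ sep G R 1 g := by
    rw [mem_sep_iff hw hl']
    exact mul_neg_of_neg_of_pos e2 e1
  exact absurd (hg.2 _ hs l' hl' e1).nonneg (not_le.2 e3)

/-- Only boundedly many walls separate `0` from two points that are not close to each other. -/
theorem exists_walls_bound (T : Tiling G R) {δ : ℝ} (hδ : 0 < δ) :
    ∃ K : ℕ, ∀ x ∈ openDisc, ∀ y ∈ openDisc, δ ≤ dist x y → ∀ A : Set (Set CDisc), A ⊆ walls G R →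
      (∀ L ∈ A, ∃ l, Defines l L ∧ 0 < ev l origin ∧ ev l x < 0 ∧ ev l y < 0) → A.ncard ≤ K := by
  obtain ⟨c, hc, hkl⟩ := exists_le_of_injective continuous_kl kl_injective hδ
  -- By the parallelogram law this bounds the midpoint of two Klein points at distance at least `c`.
  -- A functional negative at both points is negative at their midpoint, so each wall of `A` crosses
  -- the radius to it.
  set r := √(1 - c ^ 2 / 4) with hr
  have hr1 : r < 1 := by
    rw [hr, Real.sqrt_lt' one_pos]
    have : 0 < c ^ 2 := by positivity
    linarith
  refine ⟨(wallsMeeting G R r).ncard, fun x hx y hy hxy A hA hsep => ?_⟩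
  refine ncard_le_ncard (fun L hL => ?_) (T.finite_wallsMeeting hr1)
  have hklx : ∀ {z : CDisc}, z ∈ openDisc → ‖kl z‖ ^ 2 ≤ 1 := by
    intro z hz
    rw [norm_kl, div_pow, div_le_one (by positivity)]
    nlinarith [sq_nonneg (1 - ‖(z : ℂ)‖ ^ 2)]
  have hmid : ‖(kl x + kl y) / 2‖ ≤ r := by
    rw [hr]
    apply Real.le_sqrt_of_sq_le
    have hpar := parallelogram_law_with_norm ℝ (kl x) (kl y)
    have h1 := hkl x y hxy
    have h2 := hklx hx
    have h3 := hklx hy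
    rw [norm_div, Complex.norm_two, div_pow]
    nlinarith
  obtain ⟨z, hz, hkz, hzn⟩ := exists_kl (hmid.trans_lt hr1)
  obtain ⟨l, hl, h0, h1, h2⟩ := hsep L hL
  rw [ev_eq_kl] at h1 h2
  have h1' := neg_of_mul_neg_right h1 (by positivity)
  have h2' := neg_of_mul_neg_right h2 (by positivity)
  have h3 : ev l z < 0 := by
    rw [ev_eq_kl, hkz]
    have e1 : ((kl x + kl y) / 2).re = ((kl x).re + (kl y).re) / 2 := by simp
    have e2 : ((kl x + kl y) / 2).im = ((kl x).im + (kl y).im) / 2 := by simp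
    rw [e1, e2]
    apply mul_neg_of_pos_of_neg (by positivity)
    linarith
  obtain ⟨s, hs0, hs1, hs⟩ := exists_zero_scl h0 h3.le
  refine ⟨hA hL, scl s z, (hl.2 _ (scl_mem' hs0.le hs1 hz)).1 hs, ?_⟩
  change ‖(scl s z : ℂ)‖ ≤ r
  rw [norm_scl hs0.le hs1]
  nlinarith [norm_nonneg (z : ℂ)]

theorem finite_ncard_sep_le (T : Tiling G R) (hE : (sidePairings G R).Finite) (n : ℕ) :
    {k | k ∈ G ∧ (sep G R 1 k).ncard ≤ n}.Finite := by
  induction n with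
  | zero =>
    refine (finite_singleton 1).subset ?_
    rintro k ⟨hk, h0⟩
    by_contra h1
    have := (ncard_pos (T.finite_sep_one hk)).2 (T.sep_nonempty G.one_mem hk (Ne.symm h1))
    omega
  | succ n ih =>
    refine ((finite_singleton 1).union (hE.image2 (fun e k => e * k) ih)).subset ?_
    rintro k ⟨hk, h0⟩
    by_cases h1 : k = 1
    · exact Or.inl h1
    · obtain ⟨e, he, hs⟩ := T.exists_sideWall_mem_sep hk h1
      have := T.ncard_sep_lt hk he hs
      exact Or.inr ⟨e, he, e⁻¹ * k, ⟨G.mul_mem (G.inv_mem he.1) hk, by omega⟩, by simp⟩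

/-- In fact `|g⁻¹ 0 - g⁻¹ ξ| = (1 - |g 0|²) / |ξ - g 0|`, because the denominator of `g⁻¹` at `ξ`
has modulus `|α| |ξ - g 0|` and `1 - |g 0|² = 1 / |α|²`. -/
theorem norm_sub_le_of_toward {g : Equiv.Perm CDisc} {α β : ℂ} (hc : Coef g α β) {ξ : CDisc}
    (hξ : ξ ∈ unitCircle) {δ : ℝ} (hδ : 0 < δ)
    (h : δ ≤ ‖((g⁻¹ origin : CDisc) : ℂ) - (g⁻¹ ξ : CDisc)‖) :
    ‖(ξ : ℂ) - (g origin : CDisc)‖ ≤ (1 - ‖((g origin : CDisc) : ℂ)‖ ^ 2) / δ := by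
  have h1 := sub_coef hc (g⁻¹ origin) (g⁻¹ ξ)
  rw [show g (g⁻¹ origin) = origin from g.apply_symm_apply _,
    show g (g⁻¹ ξ) = ξ from g.apply_symm_apply _] at h1
  have h2 := sub_coef hc.inv origin ξ
  have ha := hc.one_le
  have ha0 : (star α) ≠ 0 := star_ne_zero.2 (norm_pos_iff.1 (by linarith))
  have hξ1 : ‖(ξ : ℂ)‖ = 1 := hξ
  have e1 : star (-β) * (ξ : ℂ) + star (star α) = (ξ : ℂ) * star (star α * ((ξ : ℂ) - (g origin : CDisc))) := by
    rw [hc.apply_origin, mul_sub, mul_div_cancel₀ _ ha0]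
    have hξξ : (ξ : ℂ) * star (ξ : ℂ) = 1 := by
      have := Complex.mul_conj (ξ : ℂ)
      rw [Complex.normSq_eq_norm_sq, hξ1] at this
      simpa using this
    simp only [star_neg, star_star, star_sub, star_mul']
    linear_combination -α * hξξ
  rw [h2, e1] at h
  have h3 : 1 - ‖((g origin : CDisc) : ℂ)‖ ^ 2 = 1 / ‖α‖ ^ 2 := by
    rw [hc.apply_origin, norm_div, norm_star]
    have : 0 < ‖α‖ := by linarith
    field_simp
    exact hc.1
  simp only [origin, mul_zero, zero_add, zero_sub, norm_div, norm_neg, norm_mul, norm_star,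
    star_star, hξ1, one_mul] at h
  rw [h3, le_div_iff₀ hδ]
  have hne : 0 < ‖(ξ : ℂ) - (g origin : CDisc)‖ := by
    refine norm_pos_iff.2 (sub_ne_zero.2 fun e => ?_)
    have : ‖((g origin : CDisc) : ℂ)‖ < 1 := hc.moeb.mem_openDisc.2 origin_mem_openDisc
    rw [← e, hξ1] at this
    exact lt_irrefl _ this
  change δ ≤ 1 / (‖α‖ * (‖α‖ * ‖(ξ : ℂ) - (g origin : CDisc)‖)) at h
  rw [le_div_iff₀ (by positivity)] at h
  rw [le_div_iff₀ (by positivity)]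
  linarith

theorem exists_norm_bound (T : Tiling G R) :
    ∃ c > 0, ∀ h ∈ G, h ≠ 1 → c ≤ ‖((h origin : CDisc) : ℂ)‖ := by
  obtain ⟨c, hc, hsub⟩ := Metric.isOpen_iff.1 (isOpen_interior (s := R)) origin T.dom.origin_mem
  refine ⟨c, hc, fun h hh h1 => ?_⟩
  by_contra hlt
  push Not at hlt
  have h2 : h origin ∈ interior R := hsub (by
    rw [Metric.mem_ball, Subtype.dist_eq, dist_eq_norm]
    simpa [origin] using hlt)
  have h3 := T.not_mem_of_mem_interior hh G.one_mem h1 (T.centre_mem hh)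
  apply h3
  rw [show (⇑(1 : Equiv.Perm CDisc)) '' R = R from image_id R]
  exact interior_subset h2

/-- Two tiles on the way to `ξ`, at the same combinatorial distance from `R`, have comparable
hyperbolic distance from `0`. -/
theorem exists_growth_bound (T : Tiling G R) (hE : (sidePairings G R).Finite)
    (hfirst : IsFirstKind G) (hpar : ∀ g ∈ G, ¬ IsParabolic g) :
    ∃ C, ∀ ξ ∈ unitCircle, ∀ g h, Toward G R ξ g → Toward G R ξ h →
      (sep G R 1 g).ncard = (sep G R 1 h).ncard →
      |hdist origin (g origin) - hdist origin (h origin)| ≤ C := by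
  obtain ⟨δ, hδ, hD⟩ := T.exists_le_norm_of_toward hE hfirst hpar
  obtain ⟨c, hc, hcb⟩ := T.exists_norm_bound
  -- With `p = g 0` and `q = h 0`, the distance from `g⁻¹ 0` to `g⁻¹ h 0` is `|q| / (|α|² |1 - p̄
  -- q|)`. Here `|q| ≥ c`, and `|1 - p̄ q| ≤ |ξ - p| + |ξ - q| ≤ 2 / (|α|² δ)` when `|p| ≤ |q|`.
  obtain ⟨K, hK⟩ := T.exists_walls_bound (δ := c * δ / 2) (by positivity)
  obtain ⟨C, hC⟩ := ((T.finite_ncard_sep_le hE (2 * K)).image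
    fun k => hdist origin (k origin)).bddAbove
  have main : ∀ ξ ∈ unitCircle, ∀ g h, Toward G R ξ g → Toward G R ξ h →
      (sep G R 1 g).ncard = (sep G R 1 h).ncard →
      ‖((g origin : CDisc) : ℂ)‖ ≤ ‖((h origin : CDisc) : ℂ)‖ →
      |hdist origin (g origin) - hdist origin (h origin)| ≤ C := by
    intro ξ hξ g h hg hh hcard hle
    have hgG := hg.1
    have hhG := hh.1
    have hkG : g⁻¹ * h ∈ G := G.mul_mem (G.inv_mem hgG) hhG
    suffices hk : (sep G R 1 (g⁻¹ * h)).ncard ≤ 2 * K by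
      have hkC : hdist origin ((g⁻¹ * h) origin) ≤ C := hC ⟨_, ⟨hkG, hk⟩, rfl⟩
      have h1 := hdist_origin_mul_le (T.moeb g hgG) (T.moeb _ hkG)
      have h2 := hdist_origin_mul_le (T.moeb h hhG) (T.moeb _ (G.inv_mem hkG))
      rw [hdist_origin_inv (T.moeb _ hkG)] at h2
      rw [mul_inv_cancel_left] at h1
      rw [mul_inv_rev, inv_inv, mul_inv_cancel_left] at h2
      rw [abs_le]
      constructor <;> linarith
    by_cases hh1 : h = 1
    · subst hh1
      have : g = 1 := by
        by_contra h1
        have := (ncard_pos (T.finite_sep_one hgG)).2 (T.sep_nonempty G.one_mem hgG (Ne.symm h1))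
        rw [hcard, sep_self, ncard_empty] at this
        exact lt_irrefl _ this
      rw [this, inv_one, one_mul, sep_self, ncard_empty]
      exact Nat.zero_le _
    -- Moved by `g⁻¹`, these walls separate the origin from both `g⁻¹ 0` and `g⁻¹ h 0`.
    set B := sep G R 1 g \ sep G R 1 h with hB
    have hfg := T.finite_sep_one hgG
    have hfh := T.finite_sep_one hhG
    have hBK : B.ncard ≤ K := by
      have hm := T.moeb g hgG
      have hinj : Function.Injective (image (⇑(g⁻¹))) := Function.Injective.image_injective (g⁻¹).injective
      rw [← ncard_image_of_injective B hinj]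
      refine hK (g⁻¹ origin) (hm.inv.mem_openDisc.2 origin_mem_openDisc) (g⁻¹ (h origin))
        (hm.inv.mem_openDisc.2 (T.centre_mem_disc hhG)) ?_ _ ?_ ?_
      · obtain ⟨α, β, hcf⟩ := hm.coef
        have a1 := norm_sub_le_of_toward hcf hξ hδ (hD ξ hξ g hg)
        obtain ⟨α', β', hcf'⟩ := (T.moeb h hhG).coef
        have a2 := norm_sub_le_of_toward hcf' hξ hδ (hD ξ hξ h hh)
        have a3 := hcb h hhG hh1
        have hα := hcf.one_le
        have hα0 : star α ≠ 0 := star_ne_zero.2 (norm_pos_iff.1 (by linarith))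
        have hα0' : 0 < ‖α‖ := by linarith
        have hξ1 : ‖(ξ : ℂ)‖ = 1 := hξ
        have h3 : 1 - ‖((g origin : CDisc) : ℂ)‖ ^ 2 = 1 / ‖α‖ ^ 2 := by
          rw [hcf.apply_origin, norm_div, norm_star]
          field_simp
          exact hcf.1
        have hple : ‖((g origin : CDisc) : ℂ)‖ ≤ 1 := CDisc.norm_le _
        have hsq : ‖((g origin : CDisc) : ℂ)‖ ^ 2 ≤ ‖((h origin : CDisc) : ℂ)‖ ^ 2 := by
          gcongr
        have a4 := sub_coef hcf.inv origin (h origin)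
        have hβ : β = star α * ((g origin : CDisc) : ℂ) := by
          rw [hcf.apply_origin, mul_div_cancel₀ _ hα0]
        set p : ℂ := ((g origin : CDisc) : ℂ) with hp
        set q : ℂ := ((h origin : CDisc) : ℂ) with hq
        have hden : star (-β) * q + star (star α) = α * (1 - star p * q) := by
          rw [hβ]
          simp only [star_neg, star_star, star_mul']
          ring
        have hξξ : star (ξ : ℂ) * (ξ : ℂ) = 1 := by
          have := Complex.conj_mul' (ξ : ℂ)
          rw [hξ1] at this
          simpa using this
        have hbd : ‖1 - star p * q‖ ≤ 2 * (1 / ‖α‖ ^ 2) / δ := by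
          have e : 1 - star p * q = star ((ξ : ℂ) - p) * ξ + star p * ((ξ : ℂ) - q) := by
            rw [star_sub]
            linear_combination -hξξ
          rw [e]
          refine (norm_add_le _ _).trans ?_
          rw [norm_mul, norm_mul, norm_star, norm_star, hξ1, mul_one]
          have b1 : ‖p‖ * ‖(ξ : ℂ) - q‖ ≤ ‖(ξ : ℂ) - q‖ := by
            nlinarith [norm_nonneg ((ξ : ℂ) - q)]
          have b2 : (1 - ‖q‖ ^ 2) / δ ≤ (1 - ‖p‖ ^ 2) / δ := by gcongr
          rw [h3] at a1 b2
          rw [mul_div_assoc]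
          linarith
        have hne : 0 < ‖1 - star p * q‖ := by
          refine norm_pos_iff.2 fun e => den_ne hcf.inv.1 (h origin) ?_
          change star (-β) * q + star (star α) = 0
          rw [hden, e, mul_zero]
        rw [Subtype.dist_eq, dist_eq_norm, a4]
        simp only [origin, mul_zero, zero_add, zero_sub, norm_div, norm_neg, norm_mul]
        change c * δ / 2 ≤ ‖q‖ / (‖star (star α)‖ * ‖star (-β) * q + star (star α)‖)
        rw [hden, star_star, norm_mul, le_div_iff₀ (by positivity)]
        have b3 : ‖α‖ * (‖α‖ * ‖1 - star p * q‖) ≤ 2 / δ := by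
          calc ‖α‖ * (‖α‖ * ‖1 - star p * q‖) = ‖α‖ ^ 2 * ‖1 - star p * q‖ := by ring
            _ ≤ ‖α‖ ^ 2 * (2 * (1 / ‖α‖ ^ 2) / δ) := by gcongr
            _ = 2 / δ := by field_simp
        calc c * δ / 2 * (‖α‖ * (‖α‖ * ‖1 - star p * q‖)) ≤ c * δ / 2 * (2 / δ) := by gcongr
          _ = c := by field_simp
          _ ≤ ‖q‖ := a3
      · rintro _ ⟨L, hL, rfl⟩
        exact T.image_wall hL.1.1 (G.inv_mem hgG)
      · rintro _ ⟨L, hL, rfl⟩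
        obtain ⟨l, hl, h0⟩ := T.exists_defines_pos hL.1.1 hgG
        have n1 : ev l origin < 0 := by
          have := (mem_sep_iff hL.1.1 hl 1 g).1 hL.1
          exact neg_of_mul_neg_left this h0.le
        have n2 : ev l (h origin) < 0 := by
          by_contra hcon
          push Not at hcon
          have := lt_of_le_of_ne hcon (T.ev_centre_ne hL.1.1 hl hhG).symm
          exact hL.2 ((mem_sep_iff hL.1.1 hl 1 h).2 (mul_neg_of_neg_of_pos n1 this))
        obtain ⟨l', hl', hpush⟩ := hl.push hm.inv
        refine ⟨l', hl', ?_, ?_, ?_⟩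
        · obtain ⟨m, hm, e⟩ := hpush (g origin)
          rw [show g⁻¹ (g origin) = origin from g.symm_apply_apply _] at e
          rw [e]; positivity
        · obtain ⟨m, hm, e⟩ := hpush origin
          rw [e]; exact mul_neg_of_pos_of_neg hm n1
        · obtain ⟨m, hm, e⟩ := hpush (h origin)
          rw [e]; exact mul_neg_of_pos_of_neg hm n2
    have hsub : sep G R g h ⊆ (sep G R 1 h \ sep G R 1 g) ∪ B := by
      intro L hL
      by_cases hg1 : L ∈ sep G R 1 g
      · exact Or.inr ⟨hg1, not_mem_sep hg1 hL⟩
      · rcases T.sep_trans G.one_mem hL with h1 | h1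
        · rw [sep_comm] at h1; exact absurd h1 hg1
        · exact Or.inl ⟨h1, hg1⟩
    -- Two finite sets of equal size have differences of equal size, so a bound in one direction
    -- suffices.
    have hdiff : (sep G R 1 h \ sep G R 1 g).ncard = B.ncard := by
      have e1 := ncard_inter_add_ncard_sdiff_eq_ncard (sep G R 1 h) (sep G R 1 g) hfh
      have e2 := ncard_inter_add_ncard_sdiff_eq_ncard (sep G R 1 g) (sep G R 1 h) hfg
      rw [inter_comm] at e2
      rw [hB]
      omega
    have hmul := T.sep_mul_left (G.inv_mem hgG) g h
    rw [inv_mul_cancel] at hmul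
    rw [hmul]
    refine (ncard_image_le (T.finite_sep hgG hhG)).trans ?_
    refine (ncard_le_ncard hsub ((hfh.sdiff).union hfg.sdiff)).trans ?_
    refine (ncard_union_le _ _).trans ?_
    rw [hdiff]
    omega
  refine ⟨C, fun ξ hξ g h hg hh hcard => ?_⟩
  rcases le_total ‖((g origin : CDisc) : ℂ)‖ ‖((h origin : CDisc) : ℂ)‖ with hle | hle
  · exact main ξ hξ g h hg hh hcard hle
  · rw [abs_sub_comm]
    exact main ξ hξ h g hh hg hcard.symm hle

end Tiling

/-! ### Cutting sequences. -/

theorem ev_add (l m : ℝ × ℂ) (z : CDisc) : ev (l + m) z = ev l z + ev m z := by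
  simp only [ev, Prod.fst_add, Prod.snd_add, Complex.add_re, Complex.add_im]
  ring

theorem prefixProd_mem {g : ℕ → Equiv.Perm CDisc} (hg : ∀ n, g n ∈ G) (n : ℕ) :
    prefixProd g n ∈ G := by
  induction n with
  | zero => exact G.one_mem
  | succ n ih => exact G.mul_mem ih (hg n)

namespace Tiling

/-- Crossing the same wall twice in succession leads back to the tile one came from, as tiles are
determined by their separating walls. This is where the absence of backtracking enters. -/
theorem sideWall_inv (T : Tiling G R) {e : Equiv.Perm CDisc} (he : e ∈ sidePairings G R)
    {e' : Equiv.Perm CDisc} (he' : e' ∈ sidePairings G R) {k : Equiv.Perm CDisc} (hk : k ∈ G)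
    (h : k '' sideWall G R e = (k * e) '' sideWall G R e') : e' = e⁻¹ := by
  have h1 := T.sep_step he hk
  have h2 := T.sep_step he' (G.mul_mem hk he.1)
  rw [← h, ← h1] at h2
  have h3 := T.eq_of_sep_eq hk (G.mul_mem (G.mul_mem hk he.1) he'.1) (G.mul_mem hk he.1)
    (h2.trans (sep_comm _ _)).symm
  rw [mul_assoc, left_eq_mul] at h3
  exact eq_inv_of_mul_eq_one_right h3

/-- Two consecutive crossings at a vertex: the second one is also made in the direction of `ξ`. -/
theorem crossing_at_vertex {ρ l m : ℝ × ℂ} (hρ : ρ ≠ 0) {v ξ a b : CDisc} (hvξ : v ≠ ξ)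
    (hρv : ev ρ v = 0) (hlv : ev l v = 0) (hmv : ev m v = 0) (hρξ : ev ρ ξ = 0) (hlξ : 0 < ev l ξ)
    (hmξ : ev m ξ ≠ 0) (hla : ev l a = 0) (hρa : ev ρ a < 0) (hma : ev m a ≤ 0)
    (hmb : ev m b = 0) (hρb : ev ρ b < 0) (hlb : 0 < ev l b) : 0 < ev m ξ := by
  by_contra hcon
  have hneg : ev m ξ < 0 := lt_of_le_of_ne (not_lt.1 hcon) hmξ
  -- `m - y l` vanishes at `v` and `ξ`, hence is a multiple `x ρ`. Evaluation at `b` forces `x < 0`,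
  -- and then `m` would be positive at `a`.
  set y := ev m ξ / ev l ξ with hy
  have hy0 : y < 0 := div_neg_of_neg_of_pos hneg hlξ
  obtain ⟨x, hx⟩ := functional_unique (l := ρ) (l' := m + (-y) • l) hvξ hρv hρξ
    (by rw [ev_add, ev_smul, hlv, hmv]; ring)
    (by rw [ev_add, ev_smul, hy, neg_mul, div_mul_cancel₀ _ hlξ.ne']; ring) hρ
  have hrel : ∀ z, ev m z = y * ev l z + x * ev ρ z := by
    intro z
    have := congrArg (fun k => ev k z) hx
    simp only [ev_add, ev_smul] at this
    linarith
  have h1 := hrel b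
  have h2 := hrel a
  rw [hmb] at h1
  rw [hla, mul_zero, zero_add] at h2
  have hx0 : x < 0 := by nlinarith
  nlinarith

/-- The geodesic crosses the walls of its cutting sequence in the direction of its positive
endpoint. -/
theorem crossing_pos (T : Tiling G R) {γ : ℝ → CDisc} (hγ : γ ∈ geodesicsThrough R) {ξ : CDisc}
    (hξ : Tendsto γ atTop (𝓝 ξ)) {g : ℕ → Equiv.Perm CDisc} (hc : IsCuttingSequence G R γ g)
    (n : ℕ) : ∀ l, Defines l (prefixProd g n '' sideWall G R (g n)) →
      0 < ev l (prefixProd g (n + 1) origin) → 0 < ev l ξ := by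
  obtain ⟨hgeo, τ, hτ⟩ := hγ
  obtain ⟨hside, hback, t, hstart, hcross, hstep⟩ := hc
  obtain ⟨ξ', hξ', η, hη, hne, htop, hbot, hsign⟩ := hgeo.sign
  have hξeq : ξ' = ξ := tendsto_nhds_unique htop hξ
  subst hξeq
  have hmem : ∀ n, prefixProd g n ∈ G := prefixProd_mem fun n => (hside n).1
  have hwall : ∀ n, prefixProd g n '' sideWall G R (g n) ∈ walls G R := fun n =>
    T.image_wall (T.sideWall_mem_walls (hside n)) (hmem n)
  have hsep : ∀ n, prefixProd g n '' sideWall G R (g n) ∈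
      sep G R (prefixProd g n) (prefixProd g (n + 1)) := by
    intro n
    change _ ∈ sep G R (prefixProd g n) (prefixProd g n * g n)
    rw [T.sep_step (hside n) (hmem n)]; rfl
  have hneg : ∀ n l, Defines l (prefixProd g n '' sideWall G R (g n)) →
      0 < ev l (prefixProd g (n + 1) origin) → ev l (prefixProd g n origin) < 0 := by
    intro n l hl h0
    have := (mem_sep_iff (hwall n) hl _ _).1 (hsep n)
    exact neg_of_mul_neg_left this h0.le
  have hzero : ∀ n l, Defines l (prefixProd g n '' sideWall G R (g n)) → ev l (γ (t n)) = 0 := by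
    intro n l hl
    exact (hl.2 _ (hgeo.1 _)).2 (T.inter_subset (hmem n) (hmem (n + 1)) (hsep n) (hcross n))
  -- The sign along `γ` is that of `P exp (2 u) + Q`. It vanishes at the crossing time and is
  -- negative earlier, so `P > 0`, which is the sign at `ξ'`.
  have hbefore : ∀ n l, Defines l (prefixProd g n '' sideWall G R (g n)) → ∀ u < t n,
      ev l (γ u) < 0 → 0 < ev l ξ' := by
    intro n l hl u hu hlu
    obtain ⟨P, Q, h1, ⟨m, hm, h2⟩, -⟩ := hsign l
    obtain ⟨m', hm', h3⟩ := h1 (t n)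
    obtain ⟨m'', hm'', h4⟩ := h1 u
    have h5 : P * Real.exp (2 * t n) + Q = 0 := by
      rw [hzero n l hl] at h3
      exact (mul_eq_zero.1 h3.symm).resolve_left hm'.ne'
    have h6 : P * Real.exp (2 * u) + Q < 0 := by
      rw [h4] at hlu
      exact neg_of_mul_neg_right hlu hm''.le
    have h7 : Real.exp (2 * u) < Real.exp (2 * t n) := Real.exp_lt_exp.2 (by linarith)
    have h8 : 0 < P := by nlinarith
    rw [h2]; positivity
  -- Zeros at the crossing and at infinity would put all of `γ` in the wall, although `γ` meets the
  -- interior of `R`.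
  have hξne : ∀ n l, Defines l (prefixProd g n '' sideWall G R (g n)) → ev l ξ' ≠ 0 := by
    intro n l hl h0
    obtain ⟨P, Q, h1, ⟨m, hm, h2⟩, -⟩ := hsign l
    obtain ⟨m', hm', h3⟩ := h1 (t n)
    obtain ⟨m'', hm'', h4⟩ := h1 τ
    rw [h0] at h2
    have hP : P = 0 := (mul_eq_zero.1 h2.symm).resolve_left hm.ne'
    rw [hzero n l hl, hP, zero_mul, zero_add] at h3
    have hQ : Q = 0 := (mul_eq_zero.1 h3.symm).resolve_left hm'.ne'
    refine T.ev_ne (hwall n) hl G.one_mem (x := γ τ) ?_ ?_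
    · rwa [show (⇑(1 : Equiv.Perm CDisc)) '' R = R from image_id R]
    · rw [h4, hP, hQ]; ring
  induction n with
  | zero =>
    intro l hl h0
    obtain ⟨s, hs, hin⟩ := hstart
    refine hbefore 0 l hl ((s + t 0) / 2) (by linarith) ?_
    have h1 := hin ((s + t 0) / 2) ⟨by linarith, by linarith⟩
    have h2 := hneg 0 l hl h0
    have := T.ev_pos (hwall 0) hl.neg G.one_mem (by rw [ev_neg]; exact neg_pos.2 h2) (x := γ ((s + t 0) / 2))
      (by rwa [show (⇑(1 : Equiv.Perm CDisc)) '' R = R from image_id R])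
    rw [ev_neg] at this
    linarith
  | succ n ih =>
    intro m hm h0
    have hmneg := hneg (n + 1) m hm h0
    rcases hstep n with ⟨hlt, hin⟩ | ⟨heq, hright⟩
    · refine hbefore (n + 1) m hm ((t n + t (n + 1)) / 2) (by linarith) ?_
      have h1 := hin ((t n + t (n + 1)) / 2) ⟨by linarith, by linarith⟩
      have := T.ev_pos (hwall (n + 1)) hm.neg (hmem (n + 1)) (by rw [ev_neg]; exact neg_pos.2 hmneg) h1
      rw [ev_neg] at this
      linarith
    · obtain ⟨l, hl, hl0⟩ := T.exists_defines_pos (hwall n) (hmem (n + 1))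
      have hlξ := ih l hl hl0
      obtain ⟨ρ, hρ, hρL, hρr⟩ := hgeo.exists_functional
      have hv : γ (t n) ∈ openDisc := hgeo.1 _
      have hvξ : γ (t n) ≠ ξ' := by
        intro h
        have h1 : ‖(γ (t n) : ℂ)‖ < 1 := hv
        rw [h, show ‖(ξ' : ℂ)‖ = 1 from hξ'] at h1
        exact lt_irrefl _ h1
      have hργ : ∀ u, ev ρ (γ u) = 0 := fun u => (hρL _ (hgeo.1 u)).2 (mem_range_self u)
      have hρξ : ev ρ ξ' = 0 := by
        have := ((continuous_ev ρ).tendsto ξ').comp htop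
        refine tendsto_nhds_unique this ?_
        simp only [Function.comp_def, hργ]
        exact tendsto_const_nhds
      have hlv := hzero n l hl
      have hmv := hzero (n + 1) m hm
      rw [← heq] at hmv
      have hρtile : ∀ x ∈ prefixProd g (n + 1) '' R, ev ρ x ≤ 0 := by
        intro x hx
        have hcl : x ∈ closure (interior (prefixProd g (n + 1) '' R)) := by
          rw [← (T.moeb _ (hmem (n + 1))).image_interior, ← (T.moeb _ (hmem (n + 1))).image_closure]
          exact image_mono T.subset_closure_interior hx
        have hclosed : IsClosed {z | ev ρ z ≤ 0} := isClosed_le (continuous_ev ρ) continuous_const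
        exact closure_minimal (fun z hz => ((hρr z).1 (hright hz)).2.le) hclosed hcl
      -- Second points on the two consecutive sides at the vertex. Both lie in the intermediate
      -- tile, hence on the right of `γ`, and strictly so because the walls of these sides are not
      -- `γ` itself.
      have hexa : ∀ k, ∃ a, a ≠ γ (t n) ∧ a ∈ prefixProd g k '' R ∧ a ∈ prefixProd g (k + 1) '' R := by
        intro k
        obtain ⟨x, hx, hxne⟩ := (hside k).2.2.exists_ne ((prefixProd g k)⁻¹ (γ (t n)))
        refine ⟨prefixProd g k x, fun h => hxne ?_, mem_image_of_mem _ hx.1, ?_⟩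
        · rw [← h]; exact ((prefixProd g k).symm_apply_apply x).symm
        · obtain ⟨y, hy, rfl⟩ := hx.2
          exact ⟨y, hy, rfl⟩
      obtain ⟨a, hav, ha1, ha2⟩ := hexa n
      obtain ⟨b, hbv, hb1, hb2⟩ := hexa (n + 1)
      have haL := T.inter_subset (hmem n) (hmem (n + 1)) (hsep n) ⟨ha1, ha2⟩
      have hbM := T.inter_subset (hmem (n + 1)) (hmem (n + 2)) (hsep (n + 1)) ⟨hb1, hb2⟩
      have haD := T.tile_subset (hmem n) ha1
      have hbD := T.tile_subset (hmem (n + 1)) hb1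
      have hla := (hl.2 a haD).2 haL
      have hmb := (hm.2 b hbD).2 hbM
      have hρne : ∀ {k : ℝ × ℂ} {x : CDisc}, ev k ξ' ≠ 0 → ev k (γ (t n)) = 0 → ev k x = 0 →
          x ≠ γ (t n) → ev ρ x ≠ 0 := by
        intro k x hk hkv hkx hx h
        obtain ⟨r, rfl⟩ := functional_unique (l := ρ) (l' := k) hx h (hργ _) hkx hkv hρ
        rw [ev_smul, hρξ, mul_zero] at hk
        exact hk rfl
      have hmξ := hξne (n + 1) m hm
      refine crossing_at_vertex hρ hvξ (hργ _) hlv hmv hρξ hlξ hmξ hla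
        (lt_of_le_of_ne (hρtile a ha2) (hρne hlξ.ne' hlv hla hav)) ?_ hmb
        (lt_of_le_of_ne (hρtile b hb1) (hρne hmξ hmv hmb hbv)) ?_
      · exact T.ev_nonpos (hwall (n + 1)) hm (hmem (n + 1)) hmneg (subset_closure ha2)
      · refine lt_of_le_of_ne (T.ev_nonneg (hwall n) hl (hmem (n + 1)) hl0 (subset_closure hb1)) ?_
        intro hlb
        have hbL := (hl.2 b hbD).1 hlb.symm
        have hvL := (hl.2 _ hv).1 hlv
        have hvM := (hm.2 _ hv).1 hmv
        have := IsGeodesicLine.eq_of_two (hwall n).1 (hwall (n + 1)).1 hbv hbL hvL hbM hvM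
        exact hback n (T.sideWall_inv (hside n) (hside (n + 1)) (hmem n) this)

theorem toward_prefixProd (T : Tiling G R) {γ : ℝ → CDisc} (hγ : γ ∈ geodesicsThrough R) {ξ : CDisc}
    (hξ : Tendsto γ atTop (𝓝 ξ)) {g : ℕ → Equiv.Perm CDisc} (hc : IsCuttingSequence G R γ g)
    (n : ℕ) : Toward G R ξ (prefixProd g n) ∧ (sep G R 1 (prefixProd g n)).ncard = n := by
  induction n with
  | zero =>
    refine ⟨toward_one ξ, ?_⟩
    change (sep G R 1 1).ncard = 0
    rw [sep_self, ncard_empty]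
  | succ n ih =>
    have he := hc.mem_sidePairings n
    obtain ⟨l, hl, h0⟩ := T.exists_defines_pos (T.image_wall (T.sideWall_mem_walls he) ih.1.1)
      (G.mul_mem ih.1.1 he.1)
    have := T.toward_step ih.1 he hl h0 (germPos_of_pos (T.crossing_pos hγ hξ hc n l hl h0))
    exact ⟨this.1, this.2.trans (by rw [ih.2])⟩

end Tiling

/-! ### The arcs cut off by the sides and the Bowen–Series map. -/

theorem star_mul_self_of_mem {ξ : CDisc} (h : ξ ∈ unitCircle) : (ξ : ℂ) * star (ξ : ℂ) = 1 := by
  have := Complex.mul_conj (ξ : ℂ)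
  rw [Complex.normSq_eq_norm_sq, show ‖(ξ : ℂ)‖ = 1 from h] at this
  simpa using this

theorem rot_arg {P x : CDisc} (hP : P ∈ unitCircle) (hx : x ∈ unitCircle) :
    rot (Complex.arg (star (P : ℂ) * x)) P = x := by
  apply Subtype.ext
  rw [rot_coe]
  have h1 := Complex.norm_mul_exp_arg_mul_I (star (P : ℂ) * x)
  rw [norm_mul, norm_star, show ‖(P : ℂ)‖ = 1 from hP, show ‖(x : ℂ)‖ = 1 from hx, mul_one,
    Complex.ofReal_one, one_mul] at h1
  rw [h1, ← mul_assoc, star_mul_self_of_mem hP, one_mul]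

theorem rot_add_two_pi (s : ℝ) (P : CDisc) : rot (s + 2 * Real.pi) P = rot s P := by
  apply Subtype.ext
  rw [rot_coe, rot_coe]
  congr 1
  push_cast
  rw [add_mul, Complex.exp_add, Complex.exp_two_pi_mul_I, mul_one]

theorem exists_rot_eq {P x : CDisc} (hP : P ∈ unitCircle) (hx : x ∈ unitCircle) :
    ∃ θ, 0 ≤ θ ∧ θ < 2 * Real.pi ∧ x = rot θ P := by
  have h1 := Complex.neg_pi_lt_arg (star (P : ℂ) * x)
  have h2 := Complex.arg_le_pi (star (P : ℂ) * x)
  have h3 := rot_arg hP hx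
  have hpi := Real.pi_pos
  by_cases h : 0 ≤ Complex.arg (star (P : ℂ) * x)
  · exact ⟨_, h, by linarith, h3.symm⟩
  · push Not at h
    exact ⟨_ + 2 * Real.pi, by linarith, by linarith, by rw [rot_add_two_pi, h3]⟩

theorem rot_inj {P : CDisc} (hP : P ∈ unitCircle) {s t : ℝ} (hst : |s - t| < 2 * Real.pi)
    (h : rot s P = rot t P) : s = t := by
  have h1 := congrArg (Subtype.val) h
  rw [rot_coe, rot_coe] at h1
  have hP0 : (P : ℂ) ≠ 0 := norm_pos_iff.1 (by rw [show ‖(P : ℂ)‖ = 1 from hP]; norm_num)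
  obtain ⟨n, hn⟩ := Complex.exp_eq_exp_iff_exists_int.1 (mul_left_cancel₀ hP0 h1)
  have h2 : (s : ℂ) = t + n * (2 * Real.pi) := by
    apply mul_right_cancel₀ Complex.I_ne_zero
    linear_combination hn
  have h3 : s = t + n * (2 * Real.pi) := by exact_mod_cast h2
  have hpi := Real.pi_pos
  rw [h3, add_sub_cancel_left, abs_mul, abs_of_pos (by linarith : 0 < 2 * Real.pi)] at hst
  have h4 : |(n : ℝ)| < 1 := by nlinarith
  have h5 : |n| < 1 := by exact_mod_cast h4
  rw [Int.abs_lt_one_iff] at h5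
  rw [h3, h5]; simp

theorem eventually_nhdsGE_iff {p : ℝ → Prop} :
    (∀ᶠ s in 𝓝[≥] (0 : ℝ), p s) ↔ p 0 ∧ ∀ᶠ s in 𝓝[>] (0 : ℝ), p s := by
  rw [← Ioi_insert, nhdsWithin_insert, eventually_sup, eventually_pure]

/-- The arc that the side `e` cuts off from `0` has first endpoint `P` and length `φ`. -/
structure IsArc (G : Subgroup (Equiv.Perm CDisc)) (R : Set CDisc) (e : Equiv.Perm CDisc)
    (P : CDisc) (φ : ℝ) : Prop where
  mem : P ∈ unitCircle
  pos : 0 < φ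
  lt_pi : φ < Real.pi
  formula : ∀ l, Defines l (Tiling.sideWall G R e) → 0 < ev l origin → ∀ s,
    ev l (rot s P) * Real.cos (φ / 2) = 4 * l.1 * (Real.sin (s / 2) * Real.sin ((s - φ) / 2))
  eq_of_nonpos : ∀ e' ∈ sidePairings G R, ∀ l, Defines l (Tiling.sideWall G R e') → 0 < ev l origin →
    ev l P ≤ 0 → ev l (rot φ P) ≤ 0 → e' = e

namespace IsArc

variable {e : Equiv.Perm CDisc} {P : CDisc} {φ : ℝ}

theorem cos_pos (h : IsArc G R e P φ) : 0 < Real.cos (φ / 2) :=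
  Real.cos_pos_of_mem_Ioo ⟨by linarith [h.pos, Real.pi_pos], by linarith [h.lt_pi]⟩

theorem ev_nonpos (h : IsArc G R e P φ) {l : ℝ × ℂ} (hl : Defines l (Tiling.sideWall G R e))
    (h0 : 0 < ev l origin) {s : ℝ} (hs : 0 ≤ s) (hs' : s ≤ φ) : ev l (rot s P) ≤ 0 := by
  have h1 := h.formula l hl h0 s
  rw [ev_origin] at h0
  have h2 : 0 ≤ Real.sin (s / 2) :=
    Real.sin_nonneg_of_nonneg_of_le_pi (by linarith) (by linarith [h.lt_pi])
  have h3 : Real.sin ((s - φ) / 2) ≤ 0 :=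
    Real.sin_nonpos_of_nonpos_of_neg_pi_le (by linarith) (by linarith [h.lt_pi])
  have h4 : ev l (rot s P) * Real.cos (φ / 2) ≤ 0 := by
    rw [h1]
    exact mul_nonpos_of_nonneg_of_nonpos (by linarith) (mul_nonpos_of_nonneg_of_nonpos h2 h3)
  exact nonpos_of_mul_nonpos_left h4 h.cos_pos

theorem ev_neg (h : IsArc G R e P φ) {l : ℝ × ℂ} (hl : Defines l (Tiling.sideWall G R e))
    (h0 : 0 < ev l origin) {s : ℝ} (hs : 0 < s) (hs' : s < φ) : ev l (rot s P) < 0 := by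
  have h1 := h.formula l hl h0 s
  rw [ev_origin] at h0
  have h2 : 0 < Real.sin (s / 2) :=
    Real.sin_pos_of_pos_of_lt_pi (by linarith) (by linarith [h.lt_pi])
  have h3 : Real.sin ((s - φ) / 2) < 0 :=
    Real.sin_neg_of_neg_of_neg_pi_lt (by linarith) (by linarith [h.lt_pi])
  have h4 : ev l (rot s P) * Real.cos (φ / 2) < 0 := by
    rw [h1]
    exact mul_neg_of_pos_of_neg (by linarith) (mul_neg_of_pos_of_neg h2 h3)
  exact neg_of_mul_neg_left h4 h.cos_pos.le

theorem lt_of_ev_neg (h : IsArc G R e P φ) {l : ℝ × ℂ} (hl : Defines l (Tiling.sideWall G R e))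
    (h0 : 0 < ev l origin) {s : ℝ} (hs : 0 ≤ s) (hs' : s < 2 * Real.pi) (hneg : ev l (rot s P) < 0) :
    s < φ := by
  by_contra hc
  push Not at hc
  have h1 := h.formula l hl h0 s
  rw [ev_origin] at h0
  have h2 : 0 ≤ Real.sin (s / 2) := Real.sin_nonneg_of_nonneg_of_le_pi (by linarith) (by linarith)
  have h3 : 0 ≤ Real.sin ((s - φ) / 2) :=
    Real.sin_nonneg_of_nonneg_of_le_pi (by linarith) (by linarith [h.pos])
  have h4 : 0 ≤ ev l (rot s P) * Real.cos (φ / 2) := by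
    rw [h1]
    exact mul_nonneg (by linarith) (mul_nonneg h2 h3)
  have := mul_neg_of_neg_of_pos hneg h.cos_pos
  linarith

theorem eq_of_same (T : Tiling G R) {e' : Equiv.Perm CDisc} {φ' : ℝ} (he : e ∈ sidePairings G R)
    (he' : e' ∈ sidePairings G R) (h : IsArc G R e P φ) (h' : IsArc G R e' P φ') : e = e' := by
  wlog hle : φ ≤ φ' generalizing e e' φ φ'
  · exact (this he' he h' h (le_of_not_ge hle)).symm
  obtain ⟨l, hl, h0⟩ := T.exists_defines_pos (T.sideWall_mem_walls he') G.one_mem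
  refine (h.eq_of_nonpos e' he' l hl h0 ?_ (h'.ev_nonpos hl h0 h.pos.le hle)).symm
  have := h'.ev_nonpos hl h0 le_rfl h'.pos.le
  rwa [rot_zero] at this

end IsArc

/-- Half-angle form of the fact that a trigonometric polynomial of degree one with zeros at the
angles `0` and `φ` is a multiple of `sin (s / 2) sin ((s - φ) / 2)`. Here `c, d` stand for the
cosine and sine of `φ / 2`, and `C, S` for those of `s / 2`. -/
theorem half_angle {A q c d C S : ℝ} (hd : d ≠ 0) (hcd : c ^ 2 + d ^ 2 = 1) (hCS : C ^ 2 + S ^ 2 = 1)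
    (h : A + -A * (2 * c ^ 2 - 1) + q * (2 * d * c) = 0) :
    2 * (A + -A * (2 * C ^ 2 - 1) + q * (2 * S * C)) * c = 4 * A * (S * (S * c - C * d)) := by
  have h1 : A * d + q * c = 0 := by
    apply mul_left_cancel₀ hd
    linear_combination h / 2 + A * hcd
  linear_combination 4 * S * C * h1 - 4 * A * c * hCS

namespace Tiling

theorem isArc_of_isFirstEndpoint (T : Tiling G R) {e : Equiv.Perm CDisc}
    (he : e ∈ sidePairings G R) {P : CDisc} (h : IsFirstEndpoint R e P) :
    ∃ φ, IsArc G R e P φ := by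
  obtain ⟨γ, Q, hγ, hside, hbot, htop, him⟩ := h
  obtain ⟨Q', hQ, P', hP, hne, htop', hbot', hsign⟩ := hγ.sign
  obtain rfl := tendsto_nhds_unique htop' htop
  obtain rfl := tendsto_nhds_unique hbot' hbot
  obtain ⟨x, hx, y, hy, hxy⟩ := he.2.2
  have hL := (T.sideWall_mem_walls he).1
  have hrange : range γ = sideWall G R e :=
    IsGeodesicLine.eq_of_two ⟨γ, hγ, rfl⟩ hL hxy (hside hx) (hside hy) (T.side_subset he hx)
      (T.side_subset he hy)
  set φ := Complex.arg (star (P' : ℂ) * Q') with hφ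
  have hrot : rot φ P' = Q' := rot_arg hP hQ
  have hφ0 : 0 ≤ φ := Complex.arg_nonneg_iff.2 him.le
  have hφne : φ ≠ 0 := fun h => him.ne' (Complex.arg_eq_zero_iff.1 h).2
  have hφpi : φ ≠ Real.pi := fun h => him.ne' (Complex.arg_eq_pi_iff.1 h).2
  have hφpos : 0 < φ := lt_of_le_of_ne hφ0 hφne.symm
  have hφlt : φ < Real.pi := lt_of_le_of_ne (Complex.arg_le_pi _) hφpi
  refine ⟨φ, hP, hφpos, hφlt, fun l hl h0 s => ?_, fun e' he' l hl h0 h1 h2 => ?_⟩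
  · have hzero : ∀ t, ev l (γ t) = 0 := fun t => (hl.2 _ (hγ.1 t)).2 (hrange ▸ mem_range_self t)
    have hlim : ∀ {F : Filter ℝ} [F.NeBot] {x : CDisc}, Tendsto γ F (𝓝 x) → ev l x = 0 := by
      intro F _ x hx
      have := ((continuous_ev l).tendsto x).comp hx
      refine tendsto_nhds_unique this ?_
      simp only [Function.comp_def, hzero]
      exact tendsto_const_nhds
    have e1 := hlim hbot
    have e2 := hlim htop
    rw [← rot_zero P', ev_rot l 0 hP, Real.cos_zero, Real.sin_zero] at e1
    rw [← hrot, ev_rot l φ hP] at e2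
    rw [ev_rot l s hP]
    set p := l.2.re * (P' : ℂ).re + l.2.im * (P' : ℂ).im
    set q := l.2.im * (P' : ℂ).re - l.2.re * (P' : ℂ).im
    have hp : p = -l.1 := by linarith
    rw [hp, show φ = 2 * (φ / 2) by ring, Real.cos_two_mul, Real.sin_two_mul] at e2
    rw [hp, sub_div, Real.sin_sub, show Real.cos s = 2 * Real.cos (s / 2) ^ 2 - 1 by
      rw [← Real.cos_two_mul]; ring_nf, show Real.sin s = 2 * Real.sin (s / 2) * Real.cos (s / 2) by
      rw [← Real.sin_two_mul]; ring_nf]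
    have hd : 0 < Real.sin (φ / 2) := Real.sin_pos_of_pos_of_lt_pi (by linarith) (by linarith)
    refine half_angle hd.ne' ?_ ?_ ?_
    · linarith [Real.sin_sq_add_cos_sq (φ / 2)]
    · linarith [Real.sin_sq_add_cos_sq (s / 2)]
    · linarith
  -- A functional that is nonpositive at both endpoints is nonpositive along the whole geodesic.
  -- Being nonnegative on `R`, it vanishes on the side, so the two walls coincide.
  · rw [hrot] at h2
    obtain ⟨p, q, c1, ⟨m1, hm1, c2⟩, ⟨m2, hm2, c3⟩⟩ := hsign l
    have hp : p ≤ 0 := by rw [c2] at h2; exact nonpos_of_mul_nonpos_right h2 hm1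
    have hq : q ≤ 0 := by rw [c3] at h1; exact nonpos_of_mul_nonpos_right h1 hm2
    have hw := T.sideWall_mem_walls he'
    have key : ∀ z ∈ side R e, z ∈ sideWall G R e' := by
      intro z hz
      obtain ⟨t, rfl⟩ := hside hz
      refine (hl.2 _ (hγ.1 t)).1 (le_antisymm ?_ ?_)
      · obtain ⟨m, hm, h⟩ := c1 t
        rw [h]
        have := Real.exp_pos (2 * t)
        exact mul_nonpos_of_nonneg_of_nonpos hm.le (by nlinarith)
      · refine T.ev_nonneg hw hl G.one_mem h0 (subset_closure ?_)
        rw [show (⇑(1 : Equiv.Perm CDisc)) '' R = R from image_id R]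
        exact hz.1
    have := IsGeodesicLine.eq_of_two hw.1 hL hxy (key x hx) (key y hy) (T.side_subset he hx)
      (T.side_subset he hy)
    exact T.sideWall_injOn he' he this

/-- One of the two orientations of the wall is right, unless the endpoints are equal or antipodal.
Antipodal endpoints would make the functional vanish at the origin. -/
theorem exists_isFirstEndpoint (T : Tiling G R) {e : Equiv.Perm CDisc}
    (he : e ∈ sidePairings G R) : ∃ P, IsFirstEndpoint R e P := by
  obtain ⟨γ, hγ, hrange⟩ := (T.sideWall_mem_walls he).1
  obtain ⟨Q, hQ, P, hP, hne, htop, hbot, hsign⟩ := hγ.sign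
  have hside : side R e ⊆ range γ := by rw [hrange]; exact T.side_subset he
  rcases lt_trichotomy (star (P : ℂ) * (Q : ℂ)).im 0 with h | h | h
  · refine ⟨Q, fun t => γ (-t), P, hγ.reverse, ?_, htop.comp tendsto_neg_atBot_atTop,
      hbot.comp tendsto_neg_atTop_atBot, ?_⟩
    · intro z hz
      obtain ⟨t, rfl⟩ := hside hz
      exact ⟨-t, by simp⟩
    · have : star (Q : ℂ) * (P : ℂ) = star (star (P : ℂ) * (Q : ℂ)) := by
        simp only [star_mul', star_star, mul_comm]
      rw [this]
      change 0 < ((starRingEnd ℂ) (star (P : ℂ) * (Q : ℂ))).im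
      rw [Complex.conj_im]; linarith
  · exfalso
    have hn : ‖star (P : ℂ) * (Q : ℂ)‖ ^ 2 = 1 := by
      rw [norm_mul, norm_star, show ‖(P : ℂ)‖ = 1 from hP, show ‖(Q : ℂ)‖ = 1 from hQ]; norm_num
    rw [norm_sq_eq, h] at hn
    have hre : ((star (P : ℂ) * (Q : ℂ)).re - 1) * ((star (P : ℂ) * (Q : ℂ)).re + 1) = 0 := by
      linarith
    have hQP : ∀ r : ℝ, (star (P : ℂ) * (Q : ℂ)).re = r → (Q : ℂ) = r * P := by
      intro r hr
      have h1 : star (P : ℂ) * (Q : ℂ) = r := Complex.ext (by simpa using hr) (by simpa using h)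
      linear_combination (P : ℂ) * h1 - (Q : ℂ) * star_mul_self_of_mem hP
    rcases mul_eq_zero.1 hre with h1 | h1
    · refine hne (Subtype.ext ?_)
      rw [hQP 1 (by linarith)]; simp
    · have h2 := hQP (-1) (by linarith)
      obtain ⟨l, hl, h0⟩ := T.exists_defines_pos (T.sideWall_mem_walls he) G.one_mem
      have hzero : ∀ t, ev l (γ t) = 0 := fun t => (hl.2 _ (hγ.1 t)).2 (hrange ▸ mem_range_self t)
      have hlim : ∀ {F : Filter ℝ} [F.NeBot] {x : CDisc}, Tendsto γ F (𝓝 x) → ev l x = 0 := by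
        intro F _ x hx
        have := ((continuous_ev l).tendsto x).comp hx
        refine tendsto_nhds_unique this ?_
        simp only [Function.comp_def, hzero]
        exact tendsto_const_nhds
      have e1 := hlim hbot
      have e2 := hlim htop
      change 0 < ev l origin at h0
      rw [ev_origin] at h0
      have h3 := unitCircle_re_im hP
      have hre : (Q : ℂ).re = -(P : ℂ).re := by rw [h2]; simp
      have him : (Q : ℂ).im = -(P : ℂ).im := by rw [h2]; simp
      unfold ev at e1 e2
      rw [hre, him, neg_sq, neg_sq, h3] at e2
      rw [h3] at e1
      linarith
  · exact ⟨P, γ, Q, hγ, hside, hbot, htop, h⟩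

/-- Of two different first endpoints behind `x`, the further one is excluded by the nearer one. A
common first endpoint determines the side, since otherwise the longer arc would contain the shorter
one. -/
theorem inArc_unique (T : Tiling G R) {e e' : Equiv.Perm CDisc} {x : CDisc} (h : InArc G R e x)
    (h' : InArc G R e' x) : e = e' := by
  obtain ⟨he, P, θ, hP, h0, h1, hx, hno⟩ := h
  obtain ⟨he', P', θ', hP', h0', h1', hx', hno'⟩ := h'
  have hPP : ∀ {P P' : CDisc} {θ θ' : ℝ}, rot θ P = rot θ' P' → P' = rot (θ - θ') P := by
    intro P P' θ θ' h
    have := congrArg (rot (-θ')) h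
    rw [rot_rot, rot_rot, add_neg_cancel, rot_zero] at this
    rw [← this, sub_eq_add_neg]
  rcases lt_trichotomy θ θ' with hlt | heq | hlt
  · have := hPP (hx'.symm.trans hx)
    exact absurd (this ▸ hP) (hno' e he (θ' - θ) (by linarith) (by linarith))
  · subst heq
    have := hPP (hx.symm.trans hx')
    rw [sub_self, rot_zero] at this
    subst this
    obtain ⟨φ, hφ⟩ := T.isArc_of_isFirstEndpoint he hP
    obtain ⟨φ', hφ'⟩ := T.isArc_of_isFirstEndpoint he' hP'
    exact IsArc.eq_of_same T he he' hφ hφ'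
  · have := hPP (hx.symm.trans hx')
    exact absurd (this ▸ hP') (hno e' he' (θ - θ') (by linarith) (by linarith))

theorem bowenSeries_eq (T : Tiling G R) {e : Equiv.Perm CDisc} {x : CDisc} (h : InArc G R e x) :
    bowenSeries G R x = e⁻¹ x := by
  have hex : ∃ e, InArc G R e x := ⟨e, h⟩
  unfold bowenSeries
  rw [dif_pos hex, T.inArc_unique hex.choose_spec h]

theorem finite_firstEndpoints (T : Tiling G R) (hE : (sidePairings G R).Finite) :
    {P | ∃ e ∈ sidePairings G R, IsFirstEndpoint R e P}.Finite := by
  have hex : ∀ e, ∃ l, e ∈ sidePairings G R → Defines l (sideWall G R e) ∧ 0 < ev l origin := by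
    intro e
    by_cases he : e ∈ sidePairings G R
    · obtain ⟨l, h1, h2⟩ := T.exists_defines_pos (T.sideWall_mem_walls he) G.one_mem
      exact ⟨l, fun _ => ⟨h1, h2⟩⟩
    · exact ⟨0, fun h => absurd h he⟩
  choose l hl using hex
  refine (hE.biUnion (t := fun e => {ξ | ξ ∈ unitCircle ∧ ev (l e) ξ = 0}) fun e he =>
    finite_zeros_circle (hl e he).1.1).subset ?_
  rintro P ⟨e, he, hP⟩
  obtain ⟨φ, hφ⟩ := T.isArc_of_isFirstEndpoint he hP
  refine mem_biUnion he ⟨hφ.mem, ?_⟩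
  have := hφ.formula _ (hl e he).1 (hl e he).2 0
  rw [rot_zero, zero_div, Real.sin_zero, zero_mul, mul_zero] at this
  exact (mul_eq_zero.1 this).resolve_right hφ.cos_pos.ne'

/-- Just after `ξ` the Bowen–Series map is given by a single side pairing, whose side cuts off an
interval just after `ξ`. -/
theorem exists_bowenSeries_germ (T : Tiling G R) (hE : (sidePairings G R).Finite)
    (hfirst : IsFirstKind G) (hpar : ∀ g ∈ G, ¬ IsParabolic g) {ξ : CDisc} (hξ : ξ ∈ unitCircle) :
    ∃ e ∈ sidePairings G R, ∃ l, Defines l (sideWall G R e) ∧ 0 < ev l origin ∧ GermPos (-l) ξ ∧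
      ∀ᶠ s in 𝓝[≥] (0 : ℝ), bowenSeries G R (rot s ξ) = e⁻¹ (rot s ξ) := by
  have hpi := Real.pi_pos
  set Pts := {P | ∃ e ∈ sidePairings G R, IsFirstEndpoint R e P} with hPts
  have hfin : Pts.Finite := T.finite_firstEndpoints hE
  have hcirc : ∀ P ∈ Pts, P ∈ unitCircle := by
    rintro P ⟨e, he, hP⟩
    exact (T.isArc_of_isFirstEndpoint he hP).choose_spec.mem
  have hangle : ∀ P, ∃ θ, P ∈ Pts → 0 ≤ θ ∧ θ < 2 * Real.pi ∧ ξ = rot θ P := by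
    intro P
    by_cases hP : P ∈ Pts
    · obtain ⟨θ, h⟩ := exists_rot_eq (hcirc P hP) hξ
      exact ⟨θ, fun _ => h⟩
    · exact ⟨0, fun h => absurd h hP⟩
  choose θ hθ using hangle
  obtain ⟨e₀, he₀, -⟩ := T.exists_sideWall_neg hE hfirst hpar hξ
  obtain ⟨P₀, hP₀⟩ := T.exists_isFirstEndpoint he₀
  -- `P` is the last first endpoint met before or at `ξ`.
  obtain ⟨P, hPPts, hmin⟩ := exists_min_image Pts θ hfin ⟨P₀, e₀, he₀, hP₀⟩
  obtain ⟨e, he, hP⟩ := id hPPts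
  obtain ⟨φ, hφ⟩ := T.isArc_of_isFirstEndpoint he hP
  obtain ⟨h0, h1, hx⟩ := hθ P hPPts
  have hno : ∀ e' ∈ sidePairings G R, ∀ ψ, 0 < ψ → ψ ≤ θ P → ¬ IsFirstEndpoint R e' (rot ψ P) := by
    intro e' he' ψ hψ0 hψ hfe
    have hmem : rot ψ P ∈ Pts := ⟨e', he', hfe⟩
    obtain ⟨a0, a1, ax⟩ := hθ _ hmem
    have := hmin _ hmem
    rw [rot_rot] at ax
    have heq : θ P = ψ + θ (rot ψ P) := by
      apply rot_inj hφ.mem _ (hx.symm.trans ax)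
      rw [abs_lt]; constructor <;> linarith
    linarith
  -- If the arc from `P` ended before or at `ξ`, its end would be strictly cut off by some side
  -- `e'`. The arc of `e'` starts after `P`, as otherwise it would contain the whole arc of `e`; so
  -- its first endpoint lies between `P` and `ξ`, against the choice of `P`.
  have hlt : θ P < φ := by
    by_contra hge
    push Not at hge
    obtain ⟨e', he', l, hl, hl0, hneg⟩ := T.exists_sideWall_neg hE hfirst hpar (rot_mem (s := φ) hφ.mem)
    obtain ⟨P', hP'⟩ := T.exists_isFirstEndpoint he'
    obtain ⟨φ', hφ'⟩ := T.isArc_of_isFirstEndpoint he' hP'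
    obtain ⟨s, hs0, hs1, hs⟩ := exists_rot_eq hφ'.mem (rot_mem (s := φ) hφ.mem)
    rw [hs] at hneg
    have hsφ := hφ'.lt_of_ev_neg hl hl0 hs0 hs1 hneg
    have hPP : P = rot (s - φ) P' := by
      have := congrArg (rot (-φ)) hs
      rw [rot_rot, rot_rot, add_neg_cancel, rot_zero] at this
      rw [this, sub_eq_add_neg]
    have hsφ2 : s < φ := by
      by_contra hge2
      push Not at hge2
      have h2 := hφ'.ev_nonpos hl hl0 (s := s - φ) (by linarith) (by linarith [hφ.pos])
      rw [← hPP] at h2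
      have := hφ.eq_of_nonpos e' he' l hl hl0 h2 (by rw [hs]; exact hneg.le)
      subst this
      have h3 := hφ.formula l hl hl0 φ
      rw [sub_self, zero_div, Real.sin_zero, mul_zero, mul_zero, hs] at h3
      exact (mul_neg_of_neg_of_pos hneg hφ.cos_pos).ne h3
    refine hno e' he' (φ - s) (by linarith) (by linarith) ?_
    have : rot (φ - s) P = P' := by
      rw [hPP, rot_rot, show s - φ + (φ - s) = 0 by ring, rot_zero]
    rwa [this]
  obtain ⟨l, hl, hl0⟩ := T.exists_defines_pos (T.sideWall_mem_walls he) G.one_mem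
  refine ⟨e, he, l, hl, hl0, ?_, ?_⟩
  · filter_upwards [Ioo_mem_nhdsGT (sub_pos.2 hlt)] with s hs
    rw [HypDisc.ev_neg, neg_pos, hx, rot_rot]
    exact hφ.ev_neg hl hl0 (by linarith [hs.1]) (by linarith [hs.2])
  -- First endpoints are finite in number, so none occurs just after `ξ` and the branch at `ξ`
  -- persists there.
  · have hev : ∀ P' ∈ Pts, ∀ᶠ s in 𝓝[≥] (0 : ℝ), ∀ u, 0 < u → u ≤ s → P' ≠ rot u ξ := by
      intro P' hP'
      by_cases hPξ : P' = ξ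
      · filter_upwards [Ico_mem_nhdsGE (by linarith : (0 : ℝ) < Real.pi)] with s hs u hu0 hus heq
        rw [hPξ] at heq
        have : (0 : ℝ) = u := by
          apply rot_inj hξ _ ((rot_zero ξ).trans heq)
          rw [abs_lt]; constructor <;> linarith [hs.2]
        linarith
      · have ht := (continuous_rot ξ).tendsto 0
        rw [rot_zero] at ht
        have h2 : ∀ᶠ s in 𝓝 (0 : ℝ), rot s ξ ≠ P' := ht.eventually_ne (Ne.symm hPξ)
        obtain ⟨ε, hε, hb⟩ := Metric.eventually_nhds_iff.1 h2
        filter_upwards [Ico_mem_nhdsGE hε] with s hs u hu0 hus heq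
        refine hb ?_ heq.symm
        rw [Real.dist_eq, sub_zero, abs_of_pos hu0]
        linarith [hs.2]
    filter_upwards [(eventually_all_finite hfin).2 hev, Ico_mem_nhdsGE (sub_pos.2 hlt)] with s hs hsφ
    have hs0 := hsφ.1
    have hs1 := hsφ.2
    have hφpi := hφ.lt_pi
    refine T.bowenSeries_eq ⟨he, P, θ P + s, hP, by linarith, by linarith, ?_, ?_⟩
    · conv_lhs => rw [hx]
      rw [rot_rot]
    · intro e' he' ψ hψ0 hψ hfe
      rcases le_or_gt ψ (θ P) with hle | hgt
      · exact hno e' he' ψ hψ0 hle hfe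
      · refine hs _ ⟨e', he', hfe⟩ (ψ - θ P) (by linarith) (by linarith) ?_
        conv_rhs => rw [hx]
        rw [rot_rot, add_sub_cancel]

/-- The iterates of the Bowen–Series map follow a path of tiles on the way to `ξ`. -/
theorem exists_iterate_bowenSeries (T : Tiling G R) (hE : (sidePairings G R).Finite)
    (hfirst : IsFirstKind G) (hpar : ∀ g ∈ G, ¬ IsParabolic g) {ξ : CDisc} (hξ : ξ ∈ unitCircle)
    (n : ℕ) : ∃ h, Toward G R ξ h ∧ (sep G R 1 h).ncard = n ∧
      ∀ᶠ s in 𝓝[≥] (0 : ℝ), (bowenSeries G R)^[n] (rot s ξ) = h⁻¹ (rot s ξ) := by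
  induction n with
  | zero =>
    exact ⟨1, toward_one ξ, by rw [sep_self, ncard_empty], Eventually.of_forall fun s => by simp⟩
  | succ n ih =>
    obtain ⟨h, h1, h2, h3⟩ := ih
    have hm := (T.moeb h h1.1).inv
    have hx : h⁻¹ ξ ∈ unitCircle := hm.mem_unitCircle.2 hξ
    obtain ⟨e, he, l, hl, hl0, hg, hbs⟩ := T.exists_bowenSeries_germ hE hfirst hpar hx
    obtain ⟨h4, h5⟩ := T.toward_mul hξ h1 he hl hl0 hg
    refine ⟨h * e, h4, by rw [h5, h2], ?_⟩
    rw [eventually_nhdsGE_iff] at h3 hbs ⊢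
    have hinv : ∀ z, (h * e)⁻¹ z = e⁻¹ (h⁻¹ z) := fun z => by rw [mul_inv_rev]; rfl
    constructor
    · rw [Function.iterate_succ_apply', h3.1, hinv, rot_zero]
      have := hbs.1
      rwa [rot_zero] at this
    -- `h⁻¹` preserves the orientation of the circle, so points just after `ξ` go to points just
    -- after `h⁻¹ ξ`, where the next branch is known.
    · obtain ⟨σ, hσ, hr⟩ := hm.exists_rot hξ
      filter_upwards [h3.2, hσ.eventually hbs.2] with s hs1 hs2
      rw [Function.iterate_succ_apply', hs1, hinv, hr, hs2]

end Tiling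

end HypDisc

end

theorem proposition2p1 (G : Subgroup (Equiv.Perm HypDisc.CDisc)) (R : Set HypDisc.CDisc)
    (hG : HypDisc.IsFuchsian G) (hfg : G.FG) (hfirst : HypDisc.IsFirstKind G)
    (hR : HypDisc.IsFundamentalDomain G R) (hadm : HypDisc.IsAdmissible G R)
    (hpar : ∀ g ∈ G, ¬ HypDisc.IsParabolic g) :
    ∃ C₀ : ℝ, 0 < C₀ ∧
      ∀ γ ∈ HypDisc.geodesicsThrough R, ∀ (ξ : HypDisc.CDisc) (g : ℕ → Equiv.Perm HypDisc.CDisc),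
        Tendsto γ atTop (𝓝 ξ) → HypDisc.IsCuttingSequence G R γ g →
        ∀ n : ℕ,
          |HypDisc.growth g n
              - Real.log ‖HypDisc.moebiusDeriv (HypDisc.prefixProd g n)⁻¹ ξ‖| ≤ C₀ ∧
          |HypDisc.growth g n
              - Real.log (HypDisc.circleAbsDeriv ((HypDisc.bowenSeries G R)^[n]) ξ)| ≤ C₀ := by
  have T : HypDisc.Tiling G R := ⟨hG.1, hR, hadm.evenCorners⟩
  have hE := T.finite_sidePairings hfg
  obtain ⟨δ, hδ, hD⟩ := T.exists_le_norm_of_toward hE hfirst hpar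
  obtain ⟨C, hC⟩ := T.exists_growth_bound hE hfirst hpar
  -- The logarithm bounds the error in the derivative, `C` compares the prefix with the branch of
  -- `f^n`, and `1` ensures positivity.
  refine ⟨|C| + |2 * Real.log (2 / δ)| + 1, by positivity, fun γ hγ ξ g hξ hc n => ?_⟩
  obtain ⟨ξ', hξ', -, -, -, htop, -⟩ := hγ.1.sign
  obtain rfl := tendsto_nhds_unique htop hξ
  obtain ⟨hg, hgn⟩ := T.toward_prefixProd hγ hξ hc n
  obtain ⟨h, hh, hhn, hf⟩ := T.exists_iterate_bowenSeries hE hfirst hpar hξ' n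
  have h1 := HypDisc.abs_growth_sub_le (T.moeb _ hg.1) hξ' hδ (hD _ hξ' _ hg)
  have h2 := HypDisc.abs_growth_sub_le (T.moeb _ hh.1) hξ' hδ (hD _ hξ' _ hh)
  have h3 := hC _ hξ' _ _ hg hh (hgn.trans hhn.symm)
  have h4 := le_abs_self C
  have h5 := le_abs_self (2 * Real.log (2 / δ))
  have h6 := abs_nonneg C
  rw [HypDisc.circleAbsDeriv_eq (T.moeb _ hh.1).inv hξ' hf]
  unfold HypDisc.growth
  refine ⟨h1.trans (by linarith), ?_⟩
  refine (abs_sub_le _ (HypDisc.hdist HypDisc.origin (h HypDisc.origin)) _).trans ?_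
  linarith
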